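/- Let $M$ be a connected unimodular Lie group of dimension three (unimodular: its left Haar measure is right-invariant), with a left-invariant contact sub-Riemannian structure: a left-invariant distribution $\mathcal D\subset TM$ of rank two with a left-invariant scalar product, $\mathcal D=\ker\omega$, where the contact form $\omega$ is normalized so that $d\omega|_{\mathcal D}$ is the area form of the scalar product (for one of the two orientations of $\mathcal D$). Let $X_0$ be the Reeb vector field, $\omega(X_0)=1$, $d\omega(X_0,\cdot)=0$. For a vector field $X$ on $M$ let $h_X(\lambda)=\langle\lambda,X\rangle$ on $T^*M$, and write $h_i=h_{X_i}$. Let $\sigma$ be the canonical symplectic form on $T^*M$ (the differential of the tautological form), $\vec a$ the Hamiltonian vector field of a function $a$, $da=\sigma(\cdot,\vec a)$, and $\{a,b\}=\vec a(b)$. Let $H=\frac12(h_{Y_1}^2+h_{Y_2}^2)$, for any orthonormal frame $Y_1,Y_2$ of $\mathcal D$, be the sub-Riemannian Hamiltonian. Let $\chi=\sqrt{-\det\{H,h_0\}_x}\ge 0$, where $\{H,h_0\}_x$, the restriction of $\{H,h_0\}$ to $T^*_xM$, is regarded as a quadratic form on $\mathcal D_x^*$, with determinant taken in an orthonormal basis;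 and let $$\kappa=Y_2(c_{12}^1)-Y_1(c_{12}^2)-(c_{12}^1)^2-(c_{12}^2)^2+\tfrac12(c_{01}^2-c_{02}^1),$$ where $Y_1,Y_2$ is any smooth local orthonormal frame of $\mathcal D$ with $[Y_1,X_0]=c_{01}^1Y_1+c_{01}^2Y_2$, $[Y_2,X_0]=c_{02}^1Y_1+c_{02}^2Y_2$, $[Y_2,Y_1]=c_{12}^1Y_1+c_{12}^2Y_2+X_0$. Both are evaluated at a point of $M$ (the choice of the point and of the frames is immaterial). Assume $\chi>0$. Then there exists a left-invariant orthonormal frame $X_1,X_2$ of $\mathcal D$ such that $\{H,h_0\}=2\chi h_1h_2$ on $T^*M$ and $$[X_1,X_0]=(\chi+\kappa)X_2,\qquad [X_2,X_0]=(\chi-\kappa)X_1,\qquad [X_2,X_1]=X_0 .$$ The function $E=\dfrac{h_0^2}{2\chi}+h_2^2$ on $T^*M$ is a constant of the motion: $\{H,E\}=0$. Moreover, let $\lambda(t)$, $t$ in an open interval $J$, be an integral curve of $\vec H$ with $H(\lambda(t))>0$, that is, the extremal of a nontrivial normal geodesic $\gamma$. For a field $Z$ along $\lambda$ write $\dot Z=[\vec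 H,Z]$ (computed with any smooth extension of $Z$). Then there is a canonical frame along $\lambda$, that is, a smooth moving frame $E_{\mathsf b},F_{\mathsf b}$, $\mathsf b\in\{11,12,21\}$, of $T(T^*M)$ along $\lambda$, and symmetric matrices $R(t)$ with $R_{11,12}=0$ (the normality condition for the Young diagram with rows of lengths $2$ and $1$), such that the $E_{\mathsf b}$ span the vertical subspace $\ker\pi_*$; $\sigma(E_{\mathsf b},E_{\mathsf c})=\sigma(F_{\mathsf b},F_{\mathsf c})=0$, $\sigma(E_{\mathsf b},F_{\mathsf c})=\delta_{\mathsf b\mathsf c}$; and $$\dot E_{12}=E_{11},\quad \dot E_{11}=-F_{11},\quad \dot E_{21}=-F_{21},$$ $$\dot F_{11}=\sum_{\mathsf b}R_{11,\mathsf b}E_{\mathsf b}-F_{12},\quad \dot F_{12}=\sum_{\mathsf b}R_{12,\mathsf b}E_{\mathsf b},\quad \dot F_{21}=\sum_{\mathsf b}R_{21,\mathsf b}E_{\mathsf b}.$$ For every canonical frame along $\lambda$, the Ricci curvatures $\mathrm{Ric}_\gamma^{\alpha_1}=R_{11,11}$ and $\mathrm{Ric}_\gamma^{\alpha_2}=R_{12,12}$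 of $\gamma$, associated with the two boxes $\alpha_1=\{11\}$ and $\alpha_2=\{12\}$ of the first row, satisfy along $\lambda(t)$, for every $t\in J$, $$\mathrm{Ric}_\gamma^{\alpha_1}=h_0^2+3\chi(h_1^2-h_2^2)+\kappa(h_1^2+h_2^2),$$ $$\mathrm{Ric}_\gamma^{\alpha_2}=6\chi(h_1^2-h_2^2)h_0^2-2\chi(\chi+\kappa)h_1^4-12\chi^2h_1^2h_2^2-2\chi(\chi-\kappa)h_2^4 .$$ -/

import Mathlib

open Bundle Set Filter Topology VectorField MeasureTheory
open scoped Manifold ContDiff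

noncomputable section

namespace SubRiem

section Manifold

variable {E : Type*} [NormedAddCommGroup E] [NormedSpace ℝ E]
  {H : Type*} [TopologicalSpace H] (I : ModelWithCorners ℝ E H)
  (M : Type*) [TopologicalSpace M] [ChartedSpace H M] [IsManifold I ∞ M]

/-! ### Vector fields and one-forms on a manifold -/

/-- (Not necessarily smooth) vector fields on `M`. -/
abbrev VF : Type _ := (x : M) → TangentSpace I x

/-- (Not necessarily smooth) one-forms on `M`. -/
abbrev OneForm : Type _ := (x : M) → (TangentSpace I x →L[ℝ] ℝ)

variable {M}

/-- The vector field `X` is smooth on some neighbourhood of the point `x`. -/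
def VF.SmoothNear (X : VF I M) (x : M) : Prop :=
  ∃ U ∈ 𝓝 x, ContMDiffOn I I.tangent ∞ (fun y ↦ (⟨y, X y⟩ : TangentBundle I M)) U

/-- The pullback `(φ⁻¹)^* α` of a one-form `α` to the model vector space, where `φ` is the
preferred chart at `x`. -/
def OneForm.inChart (α : OneForm I M) (x : M) (u : E) : E →L[ℝ] ℝ :=
  (α ((extChartAt I x).symm u)).comp
    (mfderivWithin 𝓘(ℝ, E) I (extChartAt I x).symm (range I) u)

/-- The exterior derivative of a one-form: `d α = φ^* d ((φ⁻¹)^* α)`, where `φ` is the preferred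
chart at `x` and, in the model vector space, `d β (u, v) = ∂_u β (v) - ∂_v β (u)`. Thus
`d α (V, W) = V (α W) - W (α V) - α [V, W]`. -/
def OneForm.extDeriv (α : OneForm I M) (x : M) (v w : TangentSpace I x) : ℝ :=
  let φ := mfderiv I 𝓘(ℝ, E) (extChartAt I x) x
  let D := fderivWithin ℝ (OneForm.inChart I α x) (range I) (extChartAt I x x)
  D (φ v) (φ w) - D (φ w) (φ v)

/-- The derivative at `x` of the real function `f` in the direction of the tangent vector `v`. -/
def dirDeriv (f : M → ℝ) (x : M) (v : TangentSpace I x) : ℝ := mfderiv I 𝓘(ℝ, ℝ) f x v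

/-- `HasLieDerivAlong I A c Z t W`: the Lie derivative in the direction of the vector field `A`
of the field `Z` along the curve `c` (in applications, an integral curve of `A`) equals `W` at
time `t`, i.e. `Z` has a smooth extension `V` to a neighbourhood of `c t` and
`[A, V] (c t) = W`. -/
def HasLieDerivAlong (A : VF I M) (c : ℝ → M) (Z : (t : ℝ) → TangentSpace I (c t)) (t : ℝ)
    (W : TangentSpace I (c t)) : Prop :=
  ∃ V : VF I M, VF.SmoothNear I V (c t) ∧ (∀ᶠ s in 𝓝 t, V (c s) = Z s) ∧
    mlieBracket I A V (c t) = W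

/-! ### The cotangent bundle and its canonical symplectic structure -/

variable (M) in
/-- The cotangent bundle `T^*M`; a point is a pair `⟨x, μ⟩` with `μ` a covector at `x`. -/
abbrev Cotangent : Type _ := TotalSpace (E →L[ℝ] ℝ) (fun x : M ↦ TangentSpace I x →L[ℝ] ℝ)

/-- The model with corners of the manifold `T^*M`. -/
abbrev cotModel : ModelWithCorners ℝ (E × (E →L[ℝ] ℝ)) (ModelProd H (E →L[ℝ] ℝ)) :=
  I.prod 𝓘(ℝ, E →L[ℝ] ℝ)

/-- The one-form `α` is smooth, as a section of the cotangent bundle. -/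
def OneForm.Smooth (α : OneForm I M) : Prop :=
  ContMDiff I (cotModel I) ∞ (fun x ↦ (⟨x, α x⟩ : Cotangent I M))

/-- The differential `π_*` at a point `p` of the projection `π : T^*M → M`. -/
def projDeriv (p : Cotangent I M) : TangentSpace (cotModel I) p →L[ℝ] TangentSpace I p.1 :=
  mfderiv (cotModel I) I (fun q : Cotangent I M ↦ q.1) p

/-- The tautological (Liouville) one-form on `T^*M`. -/
def tautological : OneForm (cotModel I) (Cotangent I M) := fun p ↦ p.2.comp (projDeriv I p)

/-- The canonical symplectic form `σ` on `T^*M`, the differential of the tautological form. -/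
def sympl (p : Cotangent I M) (ξ η : TangentSpace (cotModel I) p) : ℝ :=
  OneForm.extDeriv (cotModel I) (tautological I) p ξ η

/-- The Hamiltonian vector field of `a`: the unique vector field with `da = σ(·, a⃗)`. -/
def hamVF (a : Cotangent I M → ℝ) : VF (cotModel I) (Cotangent I M) := fun p ↦
  Classical.epsilon fun v : TangentSpace (cotModel I) p ↦
    ∀ ξ, dirDeriv (cotModel I) a p ξ = sympl I p ξ v

/-- The Poisson bracket `{a, b} = a⃗ (b)` on `T^*M`. -/
def poisson (a b : Cotangent I M → ℝ) (p : Cotangent I M) : ℝ :=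
  dirDeriv (cotModel I) b p (hamVF I a p)

/-- The linear-on-fibres function `h_X (μ) = ⟨μ, X⟩` on `T^*M` of a vector field `X`. -/
def linFun (X : VF I M) (p : Cotangent I M) : ℝ := p.2 (X p.1)

/-! ### Sub-Riemannian structures with a distribution of rank two -/

/-- `v, w` is an orthonormal basis of the subspace `D` with scalar product `g`. -/
def IsOrthonormalPair {V : Type*} [AddCommGroup V] [Module ℝ V] (D : Submodule ℝ V)
    (g : LinearMap.BilinForm ℝ D) (v w : V) : Prop :=
  Submodule.span ℝ {v, w} = D ∧ ∃ (hv : v ∈ D) (hw : w ∈ D),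
    g ⟨v, hv⟩ ⟨v, hv⟩ = 1 ∧ g ⟨w, hw⟩ ⟨w, hw⟩ = 1 ∧ g ⟨v, hv⟩ ⟨w, hw⟩ = 0

variable (M) in
/-- A smooth distribution of rank two with a smooth Riemannian metric on it: near every point
there is a smooth local orthonormal frame. The bracket-generating condition is not a field, since
it is automatic for the contact structures considered below. -/
structure SubRiemStr where
  /-- The distribution. -/
  distr : (x : M) → Submodule ℝ (TangentSpace I x)
  /-- The scalar product on the distribution. -/
  metric : (x : M) → LinearMap.BilinForm ℝ (distr x)
  metric_symm : ∀ x u v, metric x u v = metric x v u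
  metric_pos : ∀ x u, u ≠ 0 → 0 < metric x u u
  exists_frame : ∀ x, ∃ X₁ X₂ : VF I M, VF.SmoothNear I X₁ x ∧ VF.SmoothNear I X₂ x ∧
    ∀ᶠ y in 𝓝 x, IsOrthonormalPair (distr y) (metric y) (X₁ y) (X₂ y)

namespace SubRiemStr

variable {I}
variable (S : SubRiemStr I M)

/-- `u, v` is an orthonormal basis of the distribution at `x`. -/
def IsOrthonormal (x : M) (u v : TangentSpace I x) : Prop :=
  IsOrthonormalPair (S.distr x) (S.metric x) u v

/-- `X₁, X₂` is a smooth orthonormal frame of the distribution on a neighbourhood of `x`. -/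
def IsLocalFrame (x : M) (X₁ X₂ : VF I M) : Prop :=
  VF.SmoothNear I X₁ x ∧ VF.SmoothNear I X₂ x ∧ ∀ᶠ y in 𝓝 x, S.IsOrthonormal y (X₁ y) (X₂ y)

/-- The sub-Riemannian Hamiltonian `H (μ) = (⟨μ, X₁⟩² + ⟨μ, X₂⟩²) / 2`, where `X₁, X₂` is a local
orthonormal frame (it does not matter which one). -/
def hamiltonian (p : Cotangent I M) : ℝ :=
  let h := S.exists_frame p.1
  let X₁ : VF I M := h.choose
  let X₂ : VF I M := h.choose_spec.choose
  (linFun I X₁ p ^ 2 + linFun I X₂ p ^ 2) / 2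

/-- `α` is a contact form of the structure, normalized so that `dα` restricted to the
distribution is the area form of the metric, for one of the two orientations. -/
def IsNormalizedContactForm (α : OneForm I M) : Prop :=
  OneForm.Smooth I α ∧ (∀ x (v : TangentSpace I x), v ∈ S.distr x ↔ α x v = 0) ∧
    ∀ x (u v : TangentSpace I x), S.IsOrthonormal x u v → |OneForm.extDeriv I α x u v| = 1

/-- `χ` is the value at `x` of the first invariant: for each `x` the restriction of `{H, h₀}` to
`T_x^*M` is a quadratic form on the dual of the distribution, with symmetric matrix `A` in terms
of an orthonormal frame, and `χ = √(-det A)`. Here `X₀` is the Reeb vector field. -/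
def HasChi (X₀ : VF I M) (x : M) (χ : ℝ) : Prop :=
  ∃ X₁ X₂ : VF I M, S.IsLocalFrame x X₁ X₂ ∧
    ∃ A : Matrix (Fin 2) (Fin 2) ℝ, A.IsSymm ∧
      (∀ p : Cotangent I M, p.1 = x → poisson I S.hamiltonian (linFun I X₀) p =
        A 0 0 * linFun I X₁ p ^ 2 + 2 * A 0 1 * (linFun I X₁ p * linFun I X₂ p)
          + A 1 1 * linFun I X₂ p ^ 2) ∧
      χ = √(-A.det)

/-- `κ` is the value at `x` of the second invariant, computed from the structure functions of a
local orthonormal frame `X₁, X₂` and the Reeb vector field `X₀`; below, `aij` and `bij` are the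
structure functions usually written `c_{ij}^1` and `c_{ij}^2`. -/
def HasKappa (X₀ : VF I M) (x : M) (κ : ℝ) : Prop :=
  ∃ X₁ X₂ : VF I M, S.IsLocalFrame x X₁ X₂ ∧
    ∃ a01 b01 a02 b02 a12 b12 : M → ℝ,
      (∀ᶠ y in 𝓝 x, mlieBracket I X₁ X₀ y = a01 y • X₁ y + b01 y • X₂ y ∧
        mlieBracket I X₂ X₀ y = a02 y • X₁ y + b02 y • X₂ y ∧
        mlieBracket I X₂ X₁ y = a12 y • X₁ y + b12 y • X₂ y + X₀ y) ∧
      κ = dirDeriv I a12 x (X₂ x) - dirDeriv I b12 x (X₁ x)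
        - a12 x ^ 2 - b12 x ^ 2 + (b01 x - a02 x) / 2

/-- Normal extremals on the set of times `J`: integral curves of the Hamiltonian vector field of
`H`. They are nontrivial (they project to nonconstant geodesics) if `H > 0` along them. -/
def IsNontrivialExtremal (lam : ℝ → Cotangent I M) (J : Set ℝ) : Prop :=
  IsMIntegralCurveOn lam (hamVF I S.hamiltonian) J ∧ ∀ t ∈ J, 0 < S.hamiltonian (lam t)

/-- `Z` is a field along `lam` with derivative `Ż = [H⃗, Z] = W` on `J`. -/
def HasDot (lam : ℝ → Cotangent I M) (J : Set ℝ)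
    (Z W : (t : ℝ) → TangentSpace (cotModel I) (lam t)) : Prop :=
  ∀ t ∈ J, HasLieDerivAlong (cotModel I) (hamVF I S.hamiltonian) lam Z t (W t)

/-- `E, F` is a canonical moving frame along the extremal `lam`, with curvature matrix `R`, for
the Young diagram with two boxes `11`, `12` in the first row and one box `21` in the second row.
This is the diagram of every nontrivial geodesic of a contact structure in dimension three. The
boxes `11`, `12`, `21` are labelled `0`, `1`, `2` respectively.

For this diagram every superbox has size one, and the only condition in the normality of the
matrix `R` is the partial skew-symmetry `R_{11,12} = - R_{11,12}` of the first row, that is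
`R_{11,12} = 0`. Smoothness of `E`, `F` is part of `HasDot`, and implies that of `R`. -/
structure IsCanonicalFrame (lam : ℝ → Cotangent I M) (J : Set ℝ)
    (E F : Fin 3 → (t : ℝ) → TangentSpace (cotModel I) (lam t))
    (R : ℝ → Matrix (Fin 3) (Fin 3) ℝ) : Prop where
  vertical : ∀ t ∈ J, Submodule.span ℝ (range fun i ↦ E i t) =
    LinearMap.ker (projDeriv I (lam t)).toLinearMap
  darboux_EE : ∀ t ∈ J, ∀ i j, sympl I (lam t) (E i t) (E j t) = 0
  darboux_FF : ∀ t ∈ J, ∀ i j, sympl I (lam t) (F i t) (F j t) = 0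
  darboux_EF : ∀ t ∈ J, ∀ i j, sympl I (lam t) (E i t) (F j t) = if i = j then 1 else 0
  dot_E12 : S.HasDot lam J (E 1) (E 0)
  dot_E11 : S.HasDot lam J (E 0) (fun t ↦ - F 0 t)
  dot_E21 : S.HasDot lam J (E 2) (fun t ↦ - F 2 t)
  dot_F11 : S.HasDot lam J (F 0) (fun t ↦ (∑ j, R t 0 j • E j t) - F 1 t)
  dot_F12 : S.HasDot lam J (F 1) (fun t ↦ ∑ j, R t 1 j • E j t)
  dot_F21 : S.HasDot lam J (F 2) (fun t ↦ ∑ j, R t 2 j • E j t)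
  symm : ∀ t ∈ J, (R t).IsSymm
  normal : ∀ t ∈ J, R t 0 1 = 0

/-- The sub-Riemannian Ricci curvature of the geodesic associated with the superbox `α₁ = {11}`:
the partial trace of the curvature matrix over this superbox. -/
def ric₁ (R : ℝ → Matrix (Fin 3) (Fin 3) ℝ) (t : ℝ) : ℝ := ∑ i ∈ ({0} : Finset (Fin 3)), R t i i

/-- The sub-Riemannian Ricci curvature of the geodesic associated with the superbox `α₂ = {12}`:
the partial trace of the curvature matrix over this superbox. -/
def ric₂ (R : ℝ → Matrix (Fin 3) (Fin 3) ℝ) (t : ℝ) : ℝ := ∑ i ∈ ({1} : Finset (Fin 3)), R t i i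

end SubRiemStr

/-- `X₀` is the Reeb vector field of the contact form `α`. -/
def IsReeb (α : OneForm I M) (X₀ : VF I M) : Prop :=
  ∀ x, α x (X₀ x) = 1 ∧ ∀ v, OneForm.extDeriv I α x (X₀ x) v = 0

end Manifold

/-! ### Left-invariance and unimodularity -/

section Group

variable {E : Type*} [NormedAddCommGroup E] [NormedSpace ℝ E]
  {H : Type*} [TopologicalSpace H] (I : ModelWithCorners ℝ E H)
  {G : Type*} [TopologicalSpace G] [ChartedSpace H G] [Group G]

/-- The differential at `y` of the left translation by `x`. -/
def dLeft (x y : G) : TangentSpace I y →L[ℝ] TangentSpace I (x * y) :=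
  mfderiv I I (fun z ↦ x * z) y

/-- The vector field `X` is left-invariant. -/
def VF.IsLeftInvariant (X : VF I G) : Prop := ∀ x y, dLeft I x y (X y) = X (x * y)

/-- The differentials of left translations map the distribution to itself, isometrically. -/
def SubRiemStr.IsLeftInvariant {I : ModelWithCorners ℝ E H} [IsManifold I ∞ G]
    (S : SubRiemStr I G) : Prop :=
  (∀ x y, (S.distr y).map (dLeft I x y).toLinearMap = S.distr (x * y)) ∧
    ∀ (x y : G) (u v : S.distr y) (hu : dLeft I x y u ∈ S.distr (x * y))
      (hv : dLeft I x y v ∈ S.distr (x * y)),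
      S.metric (x * y) ⟨dLeft I x y u, hu⟩ ⟨dLeft I x y v, hv⟩ = S.metric y u v

variable (G) in
/-- The group `G` is unimodular: its left Haar measure is also right-invariant. -/
def IsUnimodular [MeasurableSpace G] : Prop :=
  ∃ μ : Measure G, μ.IsHaarMeasure ∧ μ.IsMulRightInvariant

end Group

end SubRiem

end

open SubRiem

noncomputable section

namespace SubRiem

set_option linter.unusedSectionVars false

section Calculus

variable {E : Type*} [NormedAddCommGroup E] [NormedSpace ℝ E]
  {H : Type*} [TopologicalSpace H] {I : ModelWithCorners ℝ E H}
  {M : Type*} [TopologicalSpace M] [ChartedSpace H M]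

lemma dirDeriv_congr {f g : M → ℝ} {x : M} (h : f =ᶠ[𝓝 x] g) (v : TangentSpace I x) :
    dirDeriv I f x v = dirDeriv I g x v := by
  unfold dirDeriv
  rw [h.mfderiv_eq]
  rfl

lemma dirDeriv_add_vec (f : M → ℝ) (x : M) (v w : TangentSpace I x) :
    dirDeriv I f x (v + w) = dirDeriv I f x v + dirDeriv I f x w := map_add (mvfderiv I f x) v w

lemma dirDeriv_smul_vec (f : M → ℝ) (x : M) (c : ℝ) (v : TangentSpace I x) :
    dirDeriv I f x (c • v) = c * dirDeriv I f x v := map_smul (mvfderiv I f x) c v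

lemma dirDeriv_zero_vec (f : M → ℝ) (x : M) :
    dirDeriv I f x 0 = 0 := map_zero (mvfderiv I f x)

lemma dirDeriv_sum_vec {ι : Type*} (s : Finset ι) (f : M → ℝ) (x : M) (v : ι → TangentSpace I x) :
    dirDeriv I f x (∑ i ∈ s, v i) = ∑ i ∈ s, dirDeriv I f x (v i) := map_sum (mvfderiv I f x) v s

lemma dirDeriv_const (c : ℝ) (x : M) (v : TangentSpace I x) :
    dirDeriv I (fun _ : M ↦ c) x v = 0 := by
  change mvfderiv I (fun _ : M ↦ c) x v = 0
  rw [mvfderiv_const]; rfl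

lemma dirDeriv_add {f g : M → ℝ} {x : M} (hf : MDifferentiableAt I 𝓘(ℝ, ℝ) f x)
    (hg : MDifferentiableAt I 𝓘(ℝ, ℝ) g x) (v : TangentSpace I x) :
    dirDeriv I (fun y ↦ f y + g y) x v = dirDeriv I f x v + dirDeriv I g x v := by
  change mvfderiv I (f + g) x v = mvfderiv I f x v + mvfderiv I g x v
  rw [mvfderiv_add hf hg]; rfl

lemma dirDeriv_sub {f g : M → ℝ} {x : M} (hf : MDifferentiableAt I 𝓘(ℝ, ℝ) f x)
    (hg : MDifferentiableAt I 𝓘(ℝ, ℝ) g x) (v : TangentSpace I x) :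
    dirDeriv I (fun y ↦ f y - g y) x v = dirDeriv I f x v - dirDeriv I g x v := by
  change mvfderiv I (f - g) x v = mvfderiv I f x v - mvfderiv I g x v
  rw [mvfderiv_sub hf hg]; rfl

lemma dirDeriv_mul {f g : M → ℝ} {x : M} (hf : MDifferentiableAt I 𝓘(ℝ, ℝ) f x)
    (hg : MDifferentiableAt I 𝓘(ℝ, ℝ) g x) (v : TangentSpace I x) :
    dirDeriv I (fun y ↦ f y * g y) x v = f x * dirDeriv I g x v + g x * dirDeriv I f x v := by
  change mvfderiv I (f * g) x v = f x * mvfderiv I g x v + g x * mvfderiv I f x v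
  rw [mvfderiv_mul hf hg]; rfl

lemma dirDeriv_neg {f : M → ℝ} {x : M} (v : TangentSpace I x) :
    dirDeriv I (fun y ↦ - f y) x v = - dirDeriv I f x v := by
  change mvfderiv I (- f) x v = - mvfderiv I f x v
  rw [mvfderiv_neg]; rfl

lemma dirDeriv_const_mul {f : M → ℝ} {x : M} (c : ℝ) (hf : MDifferentiableAt I 𝓘(ℝ, ℝ) f x)
    (v : TangentSpace I x) :
    dirDeriv I (fun y ↦ c * f y) x v = c * dirDeriv I f x v := by
  rw [dirDeriv_mul mdifferentiableAt_const hf, dirDeriv_const]; ring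

lemma mdifferentiableAt_finset_sum {ι : Type*} (s : Finset ι) {f : ι → M → ℝ} {x : M}
    (hf : ∀ i ∈ s, MDifferentiableAt I 𝓘(ℝ, ℝ) (f i) x) :
    MDifferentiableAt I 𝓘(ℝ, ℝ) (fun y ↦ ∑ i ∈ s, f i y) x := by
  classical
  induction s using Finset.induction_on with
  | empty => simpa using mdifferentiableAt_const
  | insert a s ha ih =>
    simp only [Finset.sum_insert ha]
    exact (hf a (by simp)).add (ih fun i hi ↦ hf i (Finset.mem_insert_of_mem hi))

lemma dirDeriv_sum {ι : Type*} (s : Finset ι) {f : ι → M → ℝ} {x : M}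
    (hf : ∀ i ∈ s, MDifferentiableAt I 𝓘(ℝ, ℝ) (f i) x) (v : TangentSpace I x) :
    dirDeriv I (fun y ↦ ∑ i ∈ s, f i y) x v = ∑ i ∈ s, dirDeriv I (f i) x v := by
  classical
  induction s using Finset.induction_on with
  | empty => simpa using dirDeriv_const 0 x v
  | insert a s ha ih =>
    simp only [Finset.sum_insert ha]
    have hs : ∀ i ∈ s, MDifferentiableAt I 𝓘(ℝ, ℝ) (f i) x :=
      fun i hi ↦ hf i (Finset.mem_insert_of_mem hi)
    rw [dirDeriv_add (hf a (by simp)) (mdifferentiableAt_finset_sum s hs), ih hs]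

lemma dirDeriv_comp {g : ℝ → ℝ} {f : M → ℝ} {x : M} {g' : ℝ} (hg : HasDerivAt g g' (f x))
    (hf : MDifferentiableAt I 𝓘(ℝ, ℝ) f x) (v : TangentSpace I x) :
    dirDeriv I (fun y ↦ g (f y)) x v = g' * dirDeriv I f x v := by
  have h1 := hg.hasFDerivAt.hasMFDerivAt.comp x hf.hasMFDerivAt
  change mfderiv I 𝓘(ℝ, ℝ) (g ∘ f) x v = _
  rw [h1.mfderiv]
  exact mul_comm (dirDeriv I f x v) g'

variable [I.Boundaryless]

/-- The vector field `V` read in the preferred chart at `x`. -/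
def VF.inChart (V : VF I M) (x : M) : E → E :=
  mpullbackWithin 𝓘(ℝ, E) I (extChartAt I x).symm V (range I)

variable [IsManifold I ∞ M]

lemma VF.smoothNear_iff {V : VF I M} {x : M} :
    VF.SmoothNear I V x ↔
      ∀ᶠ y in 𝓝 x, ContMDiffAt I I.tangent ∞ (fun y ↦ (⟨y, V y⟩ : TangentBundle I M)) y := by
  constructor
  · rintro ⟨U, hU, h⟩
    filter_upwards [eventually_mem_nhds_iff.2 hU] with y hy
    exact h.contMDiffAt hy
  · intro h
    exact ⟨_, h, fun y hy ↦ ContMDiffAt.contMDiffWithinAt hy⟩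

lemma VF.SmoothNear.contMDiffAt {V : VF I M} {x : M} (h : VF.SmoothNear I V x) :
    ContMDiffAt I I.tangent ∞ (fun y ↦ (⟨y, V y⟩ : TangentBundle I M)) x :=
  (VF.smoothNear_iff.1 h).self_of_nhds

lemma VF.SmoothNear.mdifferentiableAt {V : VF I M} {x : M} (h : VF.SmoothNear I V x) :
    MDifferentiableAt I I.tangent (fun y ↦ (⟨y, V y⟩ : TangentBundle I M)) x :=
  h.contMDiffAt.mdifferentiableAt (by simp)

lemma VF.inChart_apply (V : VF I M) (x : M) {u : E} (hu : u ∈ (extChartAt I x).target) :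
    V.inChart x u =
      mfderiv I 𝓘(ℝ, E) (extChartAt I x) ((extChartAt I x).symm u)
        (V ((extChartAt I x).symm u)) := by
  have h := ContinuousLinearMap.inverse_eq
    (mfderivWithin_extChartAt_symm_comp_mfderiv_extChartAt (I := I) hu)
    (mfderiv_extChartAt_comp_mfderivWithin_extChartAt_symm hu)
  exact congrArg (fun L ↦ L (V ((extChartAt I x).symm u))) h

lemma mdifferentiableAt_extChartAt_symm {x : M} {u : E} (hu : u ∈ (extChartAt I x).target) :
    MDifferentiableAt 𝓘(ℝ, E) I (extChartAt I x).symm u := by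
  have := mdifferentiableWithinAt_extChartAt_symm hu
  rwa [I.range_eq_univ, mdifferentiableWithinAt_univ] at this

lemma dirDeriv_eq_fderiv_inChart {g : M → ℝ} {x : M} {u : E} (hu : u ∈ (extChartAt I x).target)
    (hg : MDifferentiableAt I 𝓘(ℝ, ℝ) g ((extChartAt I x).symm u)) (V : VF I M) :
    dirDeriv I g ((extChartAt I x).symm u) (V ((extChartAt I x).symm u)) =
      fderiv ℝ (g ∘ (extChartAt I x).symm) u (V.inChart x u) := by
  set φ := extChartAt I x
  have hy : φ.symm u ∈ φ.source := φ.map_target hu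
  have h1 : MDifferentiableAt 𝓘(ℝ, E) 𝓘(ℝ, ℝ) (g ∘ φ.symm) (φ (φ.symm u)) := by
    rw [φ.right_inv hu]
    exact hg.comp u (mdifferentiableAt_extChartAt_symm hu)
  have h2 : MDifferentiableAt I 𝓘(ℝ, E) φ (φ.symm u) :=
    mdifferentiableAt_extChartAt (by rwa [← extChartAt_source (I := I)])
  have h3 : g =ᶠ[𝓝 (φ.symm u)] (g ∘ φ.symm) ∘ φ := by
    filter_upwards [(isOpen_extChartAt_source x).mem_nhds hy] with z hz
    simp only [Function.comp_apply, φ]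
    rw [(extChartAt I x).left_inv hz]
  rw [dirDeriv_congr h3]
  unfold dirDeriv
  rw [mfderiv_comp _ h1 h2, VF.inChart_apply V x hu, φ.right_inv hu, mfderiv_eq_fderiv]
  rfl

lemma dirDeriv_eq_fderiv_inChart_self {g : M → ℝ} {x : M}
    (hg : MDifferentiableAt I 𝓘(ℝ, ℝ) g x) (V : VF I M) :
    dirDeriv I g x (V x) =
      fderiv ℝ (g ∘ (extChartAt I x).symm) (extChartAt I x x)
        (V.inChart x (extChartAt I x x)) := by
  have := dirDeriv_eq_fderiv_inChart (V := V) (g := g) (mem_extChartAt_target (I := I) x)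
    (by rwa [extChartAt_to_inv])
  rwa [extChartAt_to_inv] at this

lemma VF.differentiableAt_inChart [CompleteSpace E] {V : VF I M} {x : M}
    (hV : MDifferentiableAt I I.tangent (fun y ↦ (⟨y, V y⟩ : TangentBundle I M)) x) :
    DifferentiableAt ℝ (V.inChart x) (extChartAt I x x) := by
  have h : DifferentiableWithinAt ℝ (V.inChart x) ((extChartAt I x).symm ⁻¹' univ ∩ range I)
      (extChartAt I x x) :=
    MDifferentiableWithinAt.differentiableWithinAt_mpullbackWithin_vectorField
      (mdifferentiableWithinAt_univ.2 hV)
  rwa [preimage_univ, univ_inter, I.range_eq_univ, differentiableWithinAt_univ] at h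

lemma mlieBracket_eq_inChart (V W : VF I M) (x : M) :
    mfderiv I 𝓘(ℝ, E) (extChartAt I x) x (mlieBracket I V W x) =
      lieBracket ℝ (V.inChart x) (W.inChart x) (extChartAt I x x) := by
  have h : lieBracketWithin ℝ (V.inChart x) (W.inChart x)
      ((extChartAt I x).symm ⁻¹' univ ∩ range I) =
      lieBracket ℝ (V.inChart x) (W.inChart x) := by
    rw [preimage_univ, univ_inter, I.range_eq_univ, lieBracketWithin_univ]
  exact ((isInvertible_mfderiv_extChartAt (mem_extChartAt_source x)).self_apply_inverse _).trans
    (congrFun h _)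

lemma mlieBracket_inChart_self (V W : VF I M) (x : M) :
    VF.inChart (mlieBracket I V W) x (extChartAt I x x) =
      lieBracket ℝ (V.inChart x) (W.inChart x) (extChartAt I x x) := by
  rw [VF.inChart_apply _ _ (mem_extChartAt_target x), extChartAt_to_inv]
  exact mlieBracket_eq_inChart V W x

lemma contDiffAt_comp_extChartAt_symm {n : ℕ∞} {g : M → ℝ} {x : M}
    (hg : ContMDiffAt I 𝓘(ℝ, ℝ) n g x) :
    ContDiffAt ℝ n (g ∘ (extChartAt I x).symm) (extChartAt I x x) := by
  have := (contMDiffAt_iff.1 hg).2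
  rw [I.range_eq_univ] at this
  exact this.contDiffAt univ_mem

lemma eventually_mdifferentiableAt_of_contMDiffAt {g : M → ℝ} {x : M}
    (hg : ContMDiffAt I 𝓘(ℝ, ℝ) 1 g x) : ∀ᶠ y in 𝓝 x, MDifferentiableAt I 𝓘(ℝ, ℝ) g y := by
  filter_upwards [(contMDiffAt_iff_contMDiffAt_nhds (by simp)).1 hg] with y hy
  exact hy.mdifferentiableAt (by simp)

/-- A derivation of a smooth function read in a chart. -/
lemma dirDeriv_comp_symm_eventuallyEq {g : M → ℝ} {x : M} (hg : ContMDiffAt I 𝓘(ℝ, ℝ) 1 g x)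
    (V : VF I M) :
    (fun y ↦ dirDeriv I g y (V y)) ∘ (extChartAt I x).symm =ᶠ[𝓝 (extChartAt I x x)]
      fun u ↦ fderiv ℝ (g ∘ (extChartAt I x).symm) u (V.inChart x u) := by
  have hc := (continuousAt_extChartAt_symm (I := I) x)
  have h0 := eventually_mdifferentiableAt_of_contMDiffAt hg
  rw [ContinuousAt, extChartAt_to_inv] at hc
  filter_upwards [extChartAt_target_mem_nhds (I := I) x, hc.eventually h0] with u hu hgu
  exact dirDeriv_eq_fderiv_inChart hu hgu V

theorem dirDeriv_mlieBracket [CompleteSpace E] {V W : VF I M} {x : M} {g : M → ℝ}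
    (hV : MDifferentiableAt I I.tangent (fun y ↦ (⟨y, V y⟩ : TangentBundle I M)) x)
    (hW : MDifferentiableAt I I.tangent (fun y ↦ (⟨y, W y⟩ : TangentBundle I M)) x)
    (hg : ContMDiffAt I 𝓘(ℝ, ℝ) 2 g x)
    (hVg : MDifferentiableAt I 𝓘(ℝ, ℝ) (fun y ↦ dirDeriv I g y (V y)) x)
    (hWg : MDifferentiableAt I 𝓘(ℝ, ℝ) (fun y ↦ dirDeriv I g y (W y)) x) :
    dirDeriv I g x (mlieBracket I V W x) =
      dirDeriv I (fun y ↦ dirDeriv I g y (W y)) x (V x)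
        - dirDeriv I (fun y ↦ dirDeriv I g y (V y)) x (W x) := by
  have hg1 : ContMDiffAt I 𝓘(ℝ, ℝ) 1 g x := hg.of_le (by norm_num)
  have hG : ContDiffAt ℝ 2 (g ∘ (extChartAt I x).symm) (extChartAt I x x) :=
    contDiffAt_comp_extChartAt_symm (n := 2) hg
  rw [dirDeriv_eq_fderiv_inChart_self (hg.mdifferentiableAt (by simp)),
    dirDeriv_eq_fderiv_inChart_self hWg, dirDeriv_eq_fderiv_inChart_self hVg,
    (dirDeriv_comp_symm_eventuallyEq hg1 W).fderiv_eq,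
    (dirDeriv_comp_symm_eventuallyEq hg1 V).fderiv_eq, mlieBracket_inChart_self]
  have hD : DifferentiableAt ℝ (fderiv ℝ (g ∘ (extChartAt I x).symm)) (extChartAt I x x) :=
    (hG.fderiv_right (m := 1) (by norm_num)).differentiableAt (by simp)
  rw [fderiv_clm_apply hD (VF.differentiableAt_inChart hW),
    fderiv_clm_apply hD (VF.differentiableAt_inChart hV)]
  have hs := hG.isSymmSndFDerivAt (by simp)
  have := hs (V.inChart x (extChartAt I x x)) (W.inChart x (extChartAt I x x))
  simp only [add_apply, ContinuousLinearMap.comp_apply,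
    ContinuousLinearMap.flip_apply, lieBracket, map_sub, this]
  ring

lemma VF.inChart_self (V : VF I M) (x : M) :
    V.inChart x (extChartAt I x x) = mfderiv I 𝓘(ℝ, E) (extChartAt I x) x (V x) := by
  rw [VF.inChart_apply _ _ (mem_extChartAt_target x), extChartAt_to_inv]

lemma OneForm.inChart_apply_inChart (α : OneForm I M) (V : VF I M) (x : M) {u : E}
    (hu : u ∈ (extChartAt I x).target) :
    α.inChart I x u (V.inChart x u) =
      α ((extChartAt I x).symm u) (V ((extChartAt I x).symm u)) := by
  rw [VF.inChart_apply V x hu]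
  have h := mfderivWithin_extChartAt_symm_comp_mfderiv_extChartAt (I := I) hu
  exact congrArg (α ((extChartAt I x).symm u))
    (congrArg (fun L ↦ L (V ((extChartAt I x).symm u))) h)

theorem OneForm.extDeriv_apply [CompleteSpace E] {α : OneForm I M} {V W : VF I M} {x : M}
    (hα : DifferentiableAt ℝ (α.inChart I x) (extChartAt I x x))
    (hV : MDifferentiableAt I I.tangent (fun y ↦ (⟨y, V y⟩ : TangentBundle I M)) x)
    (hW : MDifferentiableAt I I.tangent (fun y ↦ (⟨y, W y⟩ : TangentBundle I M)) x)
    (hαV : MDifferentiableAt I 𝓘(ℝ, ℝ) (fun y ↦ α y (V y)) x)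
    (hαW : MDifferentiableAt I 𝓘(ℝ, ℝ) (fun y ↦ α y (W y)) x) :
    α.extDeriv I x (V x) (W x) =
      dirDeriv I (fun y ↦ α y (W y)) x (V x) - dirDeriv I (fun y ↦ α y (V y)) x (W x)
        - α x (mlieBracket I V W x) := by
  have key (V : VF I M) : (fun y ↦ α y (V y)) ∘ (extChartAt I x).symm =ᶠ[𝓝 (extChartAt I x x)]
      fun u ↦ α.inChart I x u (V.inChart x u) := by
    filter_upwards [extChartAt_target_mem_nhds (I := I) x] with u hu
    exact (OneForm.inChart_apply_inChart α V x hu).symm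
  have hbr := OneForm.inChart_apply_inChart α (mlieBracket I V W) x (mem_extChartAt_target x)
  rw [extChartAt_to_inv, mlieBracket_inChart_self] at hbr
  rw [dirDeriv_eq_fderiv_inChart_self hαW, dirDeriv_eq_fderiv_inChart_self hαV,
    (key V).fderiv_eq, (key W).fderiv_eq, ← hbr,
    fderiv_clm_apply hα (VF.differentiableAt_inChart hW),
    fderiv_clm_apply hα (VF.differentiableAt_inChart hV)]
  have h0 : α.extDeriv I x (V x) (W x) =
      fderiv ℝ (α.inChart I x) (extChartAt I x x) (V.inChart x (extChartAt I x x))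
          (W.inChart x (extChartAt I x x))
        - fderiv ℝ (α.inChart I x) (extChartAt I x x) (W.inChart x (extChartAt I x x))
          (V.inChart x (extChartAt I x x)) := by
    rw [VF.inChart_self, VF.inChart_self]
    unfold OneForm.extDeriv
    rw [I.range_eq_univ, fderivWithin_univ]
  rw [h0]
  simp only [add_apply, ContinuousLinearMap.comp_apply,
    ContinuousLinearMap.flip_apply, lieBracket, map_sub]
  ring

/-- Tangent vectors are separated by smooth functions. -/
lemma eq_of_dirDeriv_eq {x : M} {v w : TangentSpace I x}
    (h : ∀ f : M → ℝ, (∀ᶠ y in 𝓝 x, ContMDiffAt I 𝓘(ℝ, ℝ) ∞ f y) →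
      dirDeriv I f x v = dirDeriv I f x w) : v = w := by
  have hinj := (isInvertible_mfderiv_extChartAt (I := I) (mem_extChartAt_source x)).injective
  apply hinj
  refine (SeparatingDual.eq_iff_forall_dual_eq (R := ℝ) (V := E)).2 fun ℓ ↦ ?_
  have h1 : ∀ y ∈ (extChartAt I x).source,
      ContMDiffAt I 𝓘(ℝ, ℝ) ∞ (fun z ↦ ℓ (extChartAt I x z)) y := fun y hy ↦
    ℓ.contMDiff.contMDiffAt.comp y (contMDiffAt_extChartAt' (by rwa [← extChartAt_source (I := I)]))
  have h2 (u : TangentSpace I x) : dirDeriv I (fun z ↦ ℓ (extChartAt I x z)) x u =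
      ℓ (mfderiv I 𝓘(ℝ, E) (extChartAt I x) x u) := by
    have := ℓ.hasMFDerivAt.comp x
      (mdifferentiableAt_extChartAt (I := I) (mem_chart_source H x)).hasMFDerivAt
    change mfderiv I 𝓘(ℝ, ℝ) (ℓ ∘ (extChartAt I x)) x u = _
    rw [this.mfderiv]
    rfl
  have h3 := h (fun z ↦ ℓ (extChartAt I x z)) (by
    filter_upwards [extChartAt_source_mem_nhds (I := I) x] with y hy using h1 y hy)
  rwa [h2, h2] at h3

/-- A smooth vector field maps smooth functions to smooth functions. -/
lemma contMDiffAt_dirDeriv {V : VF I M} {x : M} {g : M → ℝ}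
    (hV : ContMDiffAt I I.tangent ∞ (fun y ↦ (⟨y, V y⟩ : TangentBundle I M)) x)
    (hg : ContMDiffAt I 𝓘(ℝ, ℝ) ∞ g x) :
    ContMDiffAt I 𝓘(ℝ, ℝ) ∞ (fun y ↦ dirDeriv I g y (V y)) x := by
  have h1 := ContMDiffAt.mfderiv_const (m := ∞) hg (by simp)
  have h2 : ContMDiffAt I 𝓘(ℝ, ℝ).tangent ∞
      (fun y ↦ (⟨g y, mfderiv I 𝓘(ℝ, ℝ) g y (V y)⟩ : TangentBundle 𝓘(ℝ, ℝ) ℝ)) x :=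
    ContMDiffAt.clm_apply_of_inCoordinates (b₁ := id) (b₂ := g) (m₀ := x)
      (ϕ := fun y ↦ mfderiv I 𝓘(ℝ, ℝ) g y) (v := V) h1 hV hg
  exact (contMDiff_snd_tangentBundle_modelSpace ℝ 𝓘(ℝ, ℝ)).contMDiffAt.comp x h2

theorem VF.SmoothNear.dirDeriv_mlieBracket [CompleteSpace E] {V W : VF I M} {x : M} {g : M → ℝ}
    (hV : VF.SmoothNear I V x) (hW : VF.SmoothNear I W x) (hg : ContMDiffAt I 𝓘(ℝ, ℝ) ∞ g x) :
    dirDeriv I g x (mlieBracket I V W x) =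
      dirDeriv I (fun y ↦ dirDeriv I g y (W y)) x (V x)
        - dirDeriv I (fun y ↦ dirDeriv I g y (V y)) x (W x) :=
  SubRiem.dirDeriv_mlieBracket hV.mdifferentiableAt hW.mdifferentiableAt
    (hg.of_le (WithTop.coe_le_coe.2 le_top))
    ((contMDiffAt_dirDeriv hV.contMDiffAt hg).mdifferentiableAt (by simp))
    ((contMDiffAt_dirDeriv hW.contMDiffAt hg).mdifferentiableAt (by simp))

lemma VF.SmoothNear.smul {V : VF I M} {f : M → ℝ} {x : M}
    (hf : ∀ᶠ y in 𝓝 x, ContMDiffAt I 𝓘(ℝ, ℝ) ∞ f y) (hV : VF.SmoothNear I V x) :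
    VF.SmoothNear I (fun y ↦ f y • V y) x := by
  rw [VF.smoothNear_iff] at *
  filter_upwards [hV, hf] with y h1 h2 using ContMDiffAt.smul_section h2 h1

lemma VF.SmoothNear.congr {V W : VF I M} {x : M} (hV : VF.SmoothNear I V x)
    (h : ∀ᶠ y in 𝓝 x, W y = V y) : VF.SmoothNear I W x := by
  rw [VF.smoothNear_iff] at *
  filter_upwards [hV, h.eventually_nhds] with y h1 h2
  exact h1.congr_of_eventuallyEq (by filter_upwards [h2] with z hz; rw [hz])

lemma VF.SmoothNear.sum {ι : Type*} (s : Finset ι) {V : ι → VF I M} {x : M}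
    (hV : ∀ i ∈ s, VF.SmoothNear I (V i) x) : VF.SmoothNear I (fun y ↦ ∑ i ∈ s, V i y) x := by
  rw [VF.smoothNear_iff]
  have h : ∀ᶠ y in 𝓝 x, ∀ i ∈ s,
      ContMDiffAt I I.tangent ∞ (fun y ↦ (⟨y, V i y⟩ : TangentBundle I M)) y :=
    (Filter.eventually_all_finset s).2 fun i hi ↦ VF.smoothNear_iff.1 (hV i hi)
  filter_upwards [h] with y hy using ContMDiffAt.sum_section hy

section Coordinates

lemma isInvertible_of_injective {E F : Type*} [NormedAddCommGroup E] [NormedSpace ℝ E]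
    [NormedAddCommGroup F] [NormedSpace ℝ F] [FiniteDimensional ℝ E] [FiniteDimensional ℝ F]
    (h : Module.finrank ℝ E = Module.finrank ℝ F) (L : E →L[ℝ] F) (hL : Function.Injective L) :
    L.IsInvertible :=
  ⟨(LinearEquiv.ofInjectiveOfFinrankEq L.toLinearMap hL h).toContinuousLinearEquiv, by
    ext; rfl⟩

variable {ι : Type*} [Fintype ι] [DecidableEq ι]

omit [DecidableEq ι] in
lemma mfderiv_pi_apply {f : ι → M → ℝ} {x : M} (hf : ∀ i, ContMDiffAt I 𝓘(ℝ, ℝ) ∞ (f i) x)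
    (v : TangentSpace I x) (i : ι) :
    (mfderiv I 𝓘(ℝ, ι → ℝ) (fun y i ↦ f i y) x v : ι → ℝ) i = dirDeriv I (f i) x v := by
  have h1 : MDifferentiableAt I 𝓘(ℝ, ι → ℝ) (fun y i ↦ f i y) x :=
    (contMDiffAt_pi_space.2 hf).mdifferentiableAt (by simp)
  have h2 := (ContinuousLinearMap.proj (R := ℝ) (φ := fun _ : ι ↦ ℝ) i).hasMFDerivAt.comp x
    h1.hasMFDerivAt
  change _ = mfderiv I 𝓘(ℝ, ℝ) ((ContinuousLinearMap.proj (R := ℝ) (φ := fun _ : ι ↦ ℝ) i) ∘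
    (fun y i ↦ f i y)) x v
  rw [h2.mfderiv]
  rfl

/-- A vector field is smooth if its components with respect to local coordinates are. -/
theorem VF.smoothNear_of_coordinates [FiniteDimensional ℝ E] {f : ι → M → ℝ} {x : M}
    (hcard : Fintype.card ι = Module.finrank ℝ E)
    (hf : ∀ i, ∀ᶠ y in 𝓝 x, ContMDiffAt I 𝓘(ℝ, ℝ) ∞ (f i) y)
    (hinj : ∀ᶠ y in 𝓝 x, ∀ v : TangentSpace I y, (∀ i, dirDeriv I (f i) y v = 0) → v = 0)
    {V : VF I M} (hV : ∀ i, ∀ᶠ y in 𝓝 x,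
      ContMDiffAt I 𝓘(ℝ, ℝ) ∞ (fun y ↦ dirDeriv I (f i) y (V y)) y) :
    VF.SmoothNear I V x := by
  set Φ : M → (ι → ℝ) := fun y i ↦ f i y with hΦ
  have hinv : ∀ᶠ y in 𝓝 x, (mfderiv I 𝓘(ℝ, ι → ℝ) Φ y).IsInvertible := by
    filter_upwards [hinj, eventually_all.2 hf] with y hy hfy
    let L : E →L[ℝ] (ι → ℝ) := mfderiv I 𝓘(ℝ, ι → ℝ) Φ y
    have h1 : ∀ v : E, L v = 0 → v = 0 := fun v hv ↦ hy v fun i ↦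
      (mfderiv_pi_apply hfy v i).symm.trans (congrFun hv i)
    have h2 : Module.finrank ℝ E = Module.finrank ℝ (ι → ℝ) := by
      rw [Module.finrank_fintype_fun_eq_card, hcard]
    exact isInvertible_of_injective h2 L ((injective_iff_map_eq_zero L).2 h1)
  let e : ι → VF I M := fun i ↦ mpullback I 𝓘(ℝ, ι → ℝ) Φ (fun _ ↦ Pi.single i (1 : ℝ))
  have he : ∀ i, VF.SmoothNear I (e i) x := by
    intro i
    rw [VF.smoothNear_iff]
    filter_upwards [hinv, eventually_all.2 hf] with y hy hfy
    have : ContMDiffAt I 𝓘(ℝ, ι → ℝ) ∞ Φ y := contMDiffAt_pi_space.2 hfy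
    refine ContMDiffAt.mpullback_vectorField_preimage (n := ∞) ?_ this hy (by simp)
    exact contMDiffAt_vectorSpace_iff_contDiffAt.2 contDiffAt_const
  have := VF.SmoothNear.sum Finset.univ fun i _ ↦ VF.SmoothNear.smul (hV i) (he i)
  refine this.congr ?_
  filter_upwards [hinv, eventually_all.2 hf] with y hy hfy
  have hE : ∀ i, mfderiv I 𝓘(ℝ, ι → ℝ) Φ y (e i y) = (Pi.single i (1 : ℝ) : ι → ℝ) :=
    fun i ↦ hy.self_apply_inverse _
  apply hy.injective
  have h1 : mfderiv I 𝓘(ℝ, ι → ℝ) Φ y (∑ i, dirDeriv I (f i) y (V y) • e i y) =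
      ∑ i, dirDeriv I (f i) y (V y) • (Pi.single i (1 : ℝ) : ι → ℝ) := by
    refine (map_sum (mfderiv I 𝓘(ℝ, ι → ℝ) Φ y) _ _).trans (Finset.sum_congr rfl fun i _ ↦ ?_)
    rw [← hE]
    exact map_smul (mfderiv I 𝓘(ℝ, ι → ℝ) Φ y) _ _
  rw [h1]
  refine funext fun j ↦ (mfderiv_pi_apply hfy (V y) j).trans ?_
  simp [Finset.sum_apply, Pi.single_apply]

end Coordinates

end Calculus

section CotangentBundle

variable {E : Type*} [NormedAddCommGroup E] [NormedSpace ℝ E]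
  {H : Type*} [TopologicalSpace H] {I : ModelWithCorners ℝ E H}
  {M : Type*} [TopologicalSpace M] [ChartedSpace H M]  [IsManifold I ∞ M] [I.Boundaryless]

lemma hasMFDerivAt_prodMk_space {F F' : Type*} [NormedAddCommGroup F] [NormedSpace ℝ F]
    [NormedAddCommGroup F'] [NormedSpace ℝ F'] {f : M → F} {g : M → F'} {x : M} {f' : E →L[ℝ] F}
    {g' : E →L[ℝ] F'} (hf : HasMFDerivAt I 𝓘(ℝ, F) f x f') (hg : HasMFDerivAt I 𝓘(ℝ, F') g x g') :
    HasMFDerivAt I 𝓘(ℝ, F × F') (fun y ↦ (f y, g y)) x (f'.prod g') :=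
  ⟨hf.1.prodMk hg.1, hf.2.prodMk hg.2⟩

lemma contMDiff_cotangent_proj :
    ContMDiff (cotModel I) I ∞ (fun q : Cotangent I M ↦ q.1) :=
  Bundle.contMDiff_proj _

lemma mdifferentiableAt_cotangent_proj (p : Cotangent I M) :
    MDifferentiableAt (cotModel I) I (fun q : Cotangent I M ↦ q.1) p :=
  contMDiff_cotangent_proj.contMDiffAt.mdifferentiableAt (by simp)

lemma contMDiffAt_comp_proj {f : M → ℝ} {p : Cotangent I M} {n : ℕ∞}
    (hf : ContMDiffAt I 𝓘(ℝ, ℝ) n f p.1) :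
    ContMDiffAt (cotModel I) 𝓘(ℝ, ℝ) n (fun q : Cotangent I M ↦ f q.1) p :=
  hf.comp p (contMDiff_cotangent_proj.of_le (by exact_mod_cast le_top)).contMDiffAt

lemma tendsto_cotangent_proj (p : Cotangent I M) :
    Tendsto (fun q : Cotangent I M ↦ q.1) (𝓝 p) (𝓝 p.1) :=
  (contMDiff_cotangent_proj (I := I)).continuous.tendsto p

lemma dirDeriv_comp_proj {f : M → ℝ} {p : Cotangent I M}
    (hf : MDifferentiableAt I 𝓘(ℝ, ℝ) f p.1) (ξ : TangentSpace (cotModel I) p) :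
    dirDeriv (cotModel I) (fun q : Cotangent I M ↦ f q.1) p ξ =
      dirDeriv I f p.1 (projDeriv I p ξ) := by
  have := hf.hasMFDerivAt.comp p (mdifferentiableAt_cotangent_proj p).hasMFDerivAt
  change mfderiv (cotModel I) 𝓘(ℝ, ℝ) (f ∘ (fun q : Cotangent I M ↦ q.1)) p ξ = _
  rw [this.mfderiv]
  rfl

lemma contMDiffAt_linFun {X : VF I M} {p : Cotangent I M}
    (hX : ContMDiffAt I I.tangent ∞ (fun y ↦ (⟨y, X y⟩ : TangentBundle I M)) p.1) :
    ContMDiffAt (cotModel I) 𝓘(ℝ, ℝ) ∞ (linFun I X) p := by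
  have h1 : ContMDiffAt (cotModel I) (I.prod 𝓘(ℝ, ℝ)) ∞
      (fun q : Cotangent I M ↦ TotalSpace.mk' ℝ (E := Bundle.Trivial M ℝ) q.1 (q.2 (X q.1))) p :=
    ContMDiffAt.clm_bundle_apply (E₁ := TangentSpace I) (E₂ := Bundle.Trivial M ℝ)
      (b := fun q : Cotangent I M ↦ q.1) (ϕ := fun q ↦ q.2) (v := fun q ↦ X q.1)
      contMDiffAt_id (hX.comp p contMDiff_cotangent_proj.contMDiffAt)
  exact (contMDiffAt_totalSpace.1 h1).2

/-- The momentum component of a covector in the trivialization at `p`. -/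
def momentum (p q : Cotangent I M) : E →L[ℝ] ℝ :=
  (trivializationAt (E →L[ℝ] ℝ) (fun x : M ↦ TangentSpace I x →L[ℝ] ℝ) p.1 q).2

lemma contMDiffAt_momentum (p : Cotangent I M) :
    ContMDiffAt (cotModel I) 𝓘(ℝ, E →L[ℝ] ℝ) ∞ (momentum p) p :=
  (contMDiffAt_totalSpace.1 (contMDiffAt_id (I := cotModel I) (M := Cotangent I M) (x := p))).2

/-- A vector field in the trivialization of the tangent bundle at `x`. -/
def VF.inTriv (X : VF I M) (x y : M) : E :=
  (trivializationAt E (TangentSpace I) x ⟨y, X y⟩).2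

lemma linFun_eventuallyEq (X : VF I M) (p : Cotangent I M) :
    linFun I X =ᶠ[𝓝 p] fun q ↦ momentum p q (X.inTriv p.1 q.1) := by
  have h := (tendsto_cotangent_proj p).eventually
    ((trivializationAt E (TangentSpace I) p.1).open_baseSet.mem_nhds
      (FiberBundle.mem_baseSet_trivializationAt' p.1))
  filter_upwards [h] with q hq
  have h1 : momentum p q = (ContinuousLinearMap.inCoordinates E (TangentSpace I) ℝ
      (Bundle.Trivial M ℝ) p.1 q.1 p.1 q.1 q.2) := rfl
  rw [h1, ContinuousLinearMap.inCoordinates_eq hq (mem_univ _)]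
  have h2 := ((trivializationAt E (TangentSpace I) p.1).continuousLinearEquivAt ℝ q.1 hq
    ).symm_apply_apply (X q.1)
  exact (congrArg q.2 h2).symm

lemma extChartAt_cotangent (p q : Cotangent I M) :
    extChartAt (cotModel I) p q = (extChartAt I p.1
      (trivializationAt (E →L[ℝ] ℝ) (fun x : M ↦ TangentSpace I x →L[ℝ] ℝ) p.1 q).1,
        momentum p q) := by
  rw [FiberBundle.extChartAt]
  rfl

lemma extChartAt_cotangent_eventuallyEq (p : Cotangent I M) :
    extChartAt (cotModel I) p =ᶠ[𝓝 p] fun q ↦ (extChartAt I p.1 q.1, momentum p q) := by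
  have h := (tendsto_cotangent_proj p).eventually
    ((trivializationAt E (TangentSpace I) p.1).open_baseSet.mem_nhds
      (FiberBundle.mem_baseSet_trivializationAt' p.1))
  filter_upwards [h] with q hq
  rw [extChartAt_cotangent]
  rfl

lemma VF.contMDiffAt_inTriv {X : VF I M} {x : M}
    (hX : ContMDiffAt I I.tangent ∞ (fun y ↦ (⟨y, X y⟩ : TangentBundle I M)) x) :
    ContMDiffAt I 𝓘(ℝ, E) ∞ (X.inTriv x) x :=
  (contMDiffAt_totalSpace.1 hX).2

/-- On vertical vectors, the derivative of `linFun` is given by the derivative of the momentum. -/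
lemma dirDeriv_linFun_of_vertical {X : VF I M} {p : Cotangent I M}
    (hX : ContMDiffAt I I.tangent ∞ (fun y ↦ (⟨y, X y⟩ : TangentBundle I M)) p.1)
    {ξ : TangentSpace (cotModel I) p} (hξ : projDeriv I p ξ = 0) :
    dirDeriv (cotModel I) (linFun I X) p ξ =
      (mvfderiv (cotModel I) (momentum p) p ξ) (X.inTriv p.1 p.1) := by
  rw [dirDeriv_congr (linFun_eventuallyEq X p)]
  have h1 := ((contMDiffAt_momentum p).mdifferentiableAt (by simp)).hasMFDerivAt
  have h2 := ((VF.contMDiffAt_inTriv hX).mdifferentiableAt (by simp)).hasMFDerivAt.comp p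
    (mdifferentiableAt_cotangent_proj p).hasMFDerivAt
  have h3 := (isBoundedBilinearMap_apply (𝕜 := ℝ) (E := E) (F := ℝ)).hasFDerivAt
    (momentum p p, X.inTriv p.1 p.1)
  have h4 := HasMFDerivAt.comp (f := fun q ↦ (momentum p q, X.inTriv p.1 q.1)) p
    h3.hasMFDerivAt (hasMFDerivAt_prodMk_space h1 h2)
  have h5 : dirDeriv (cotModel I) (fun q ↦ momentum p q (X.inTriv p.1 q.1)) p ξ = _ :=
    congrArg (fun L ↦ L ξ) h4.mfderiv
  rw [h5]
  change momentum p p (mfderiv I 𝓘(ℝ, E) (X.inTriv p.1) p.1 (projDeriv I p ξ)) +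
    (mvfderiv (cotModel I) (momentum p) p ξ) (X.inTriv p.1 p.1) = _
  rw [hξ]
  have h6 : mfderiv I 𝓘(ℝ, E) (X.inTriv p.1) p.1 0 = (0 : E) := map_zero _
  rw [h6, map_zero, zero_add]

/-- A vector tangent to the cotangent bundle is determined by its projection and the derivatives
of the functions `linFun` of a frame. -/
lemma eq_zero_of_projDeriv_eq_zero {ι : Type*} {X : ι → VF I M} {p : Cotangent I M}
    (hX : ∀ i, ContMDiffAt I I.tangent ∞ (fun y ↦ (⟨y, X i y⟩ : TangentBundle I M)) p.1)
    (hspan : ⊤ ≤ Submodule.span ℝ (range fun i ↦ X i p.1))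
    {ξ : TangentSpace (cotModel I) p} (hξ : projDeriv I p ξ = 0)
    (h : ∀ i, dirDeriv (cotModel I) (linFun I (X i)) p ξ = 0) : ξ = 0 := by
  let m : E →L[ℝ] ℝ := mvfderiv (cotModel I) (momentum p) p ξ
  have hm : m = 0 := by
    let A := (trivializationAt E (TangentSpace I) p.1).continuousLinearEquivAt ℝ p.1
      (FiberBundle.mem_baseSet_trivializationAt' p.1)
    have h1 : ∀ v : TangentSpace I p.1, m (A v) = 0 := by
      intro v
      induction hspan (Submodule.mem_top (x := v)) using Submodule.span_induction with
      | mem v hv =>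
        obtain ⟨i, rfl⟩ := hv
        rw [← h i, dirDeriv_linFun_of_vertical (hX i) hξ]
        rfl
      | zero => rw [map_zero, map_zero]
      | add v w _ _ hv hw => rw [map_add, map_add, hv, hw, add_zero]
      | smul c v _ hv => rw [map_smul, map_smul, hv, smul_zero]
    ext u
    have := h1 (A.symm u)
    rwa [A.apply_symm_apply] at this
  have h1 := (mdifferentiableAt_extChartAt (I := I) (mem_chart_source H p.1)).hasMFDerivAt.comp p
    (mdifferentiableAt_cotangent_proj p).hasMFDerivAt
  have h2 := hasMFDerivAt_prodMk_space h1
    ((contMDiffAt_momentum p).mdifferentiableAt (by simp)).hasMFDerivAt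
  have h3 := h2.congr_of_eventuallyEq (extChartAt_cotangent_eventuallyEq p)
  have hinj :=
    (isInvertible_mfderiv_extChartAt (I := cotModel I) (mem_extChartAt_source p)).injective
  have h4 : mfderiv I 𝓘(ℝ, E) (extChartAt I p.1) p.1 (projDeriv I p ξ) = (0 : E) := by
    rw [hξ]; exact map_zero _
  refine hinj (Eq.trans ?_ (map_zero (mfderiv (cotModel I) 𝓘(ℝ, E × (E →L[ℝ] ℝ))
    (extChartAt (cotModel I) p) p)).symm)
  rw [h3.mfderiv]
  exact Prod.ext h4 hm

end CotangentBundle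

section Linear

/-- The solution of a linear system depends smoothly on its coefficients. -/
lemma contMDiffAt_of_linear_system {E : Type*} [NormedAddCommGroup E] [NormedSpace ℝ E]
    {H : Type*} [TopologicalSpace H] {I : ModelWithCorners ℝ E H}
    {M : Type*} [TopologicalSpace M] [ChartedSpace H M] {ι : Type*} [Fintype ι] [DecidableEq ι]
    {n : WithTop ℕ∞}
    {A : ι → ι → M → ℝ} {b c : ι → M → ℝ} {x : M} (hA : ∀ k i, ContMDiffAt I 𝓘(ℝ, ℝ) n (A k i) x)
    (hb : ∀ k, ContMDiffAt I 𝓘(ℝ, ℝ) n (b k) x)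
    (hinj : ∀ v : ι → ℝ, (∀ k, ∑ i, A k i x * v i = 0) → v = 0)
    (h : ∀ᶠ y in 𝓝 x, ∀ k, ∑ i, A k i y * c i y = b k y) (i : ι) :
    ContMDiffAt I 𝓘(ℝ, ℝ) n (c i) x := by
  let e (k i : ι) : (ι → ℝ) →L[ℝ] (ι → ℝ) :=
    (ContinuousLinearMap.proj (R := ℝ) (φ := fun _ : ι ↦ ℝ) i).smulRight (Pi.single k (1 : ℝ))
  let L (y : M) : (ι → ℝ) →L[ℝ] (ι → ℝ) := ∑ k, ∑ i, A k i y • e k i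
  have hLapp (y : M) (v : ι → ℝ) (k : ι) : L y v k = ∑ i, A k i y * v i := by
    simp [L, e, Finset.sum_apply, Pi.single_apply]
  have hL : ContMDiffAt I 𝓘(ℝ, (ι → ℝ) →L[ℝ] (ι → ℝ)) n L x := by
    refine contMDiffAt_finsetSum fun k _ ↦ contMDiffAt_finsetSum fun i _ ↦ ?_
    exact (hA k i).smul contMDiffAt_const
  have hLinv : (L x).IsInvertible := isInvertible_of_injective rfl _
    ((injective_iff_map_eq_zero _).2 fun v hv ↦ hinj v fun k ↦ by
      rw [← hLapp, hv]; rfl)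
  obtain ⟨e0, he0⟩ := hLinv
  have hinv : ContMDiffAt I 𝓘(ℝ, (ι → ℝ) →L[ℝ] (ι → ℝ)) n (fun y ↦ (L y).inverse) x := by
    have h1 : ContDiffAt ℝ n ContinuousLinearMap.inverse (L x) := by
      rw [← he0]; exact contDiffAt_map_inverse e0
    exact h1.contMDiffAt.comp x hL
  have hb' : ContMDiffAt I 𝓘(ℝ, ι → ℝ) n (fun y k ↦ b k y) x := contMDiffAt_pi_space.2 hb
  have hev : ∀ᶠ y in 𝓝 x, (L y).IsInvertible := by
    have h1 : ∀ᶠ T in 𝓝 (L x), T.IsInvertible := by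
      rw [← he0]
      exact (ContinuousLinearEquiv.isOpen (𝕜 := ℝ) (E := ι → ℝ) (F := ι → ℝ)).mem_nhds ⟨e0, rfl⟩
    exact hL.continuousAt.eventually h1
  refine contMDiffAt_pi_space.1 ((hinv.clm_apply hb').congr_of_eventuallyEq (f₁ := fun y k ↦ c k y)
    ?_) i
  filter_upwards [hev, h] with y hy hyc
  have h2 : L y (fun k ↦ c k y) = fun k ↦ b k y := funext fun k ↦ by rw [hLapp, hyc]
  rw [← h2, hy.inverse_apply_self]

end Linear

section LieFrame

variable {E : Type*} [NormedAddCommGroup E] [NormedSpace ℝ E] [FiniteDimensional ℝ E]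
  {H : Type*} [TopologicalSpace H] {I : ModelWithCorners ℝ E H}
  {M : Type*} [TopologicalSpace M] [ChartedSpace H M]  [IsManifold I ∞ M] [I.Boundaryless]
  {ι : Type*} [Fintype ι] [DecidableEq ι]

instance (x : M) : FiniteDimensional ℝ (TangentSpace I x) := inferInstanceAs (FiniteDimensional ℝ E)

/-- Local coordinates as a family of real functions. -/
lemma exists_local_coordinates (hcard : Fintype.card ι = Module.finrank ℝ E) (x : M) :
    ∃ f : ι → M → ℝ, (∀ i, ∀ᶠ y in 𝓝 x, ContMDiffAt I 𝓘(ℝ, ℝ) ∞ (f i) y) ∧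
      ∀ᶠ y in 𝓝 x, ∀ v : TangentSpace I y, (∀ i, dirDeriv I (f i) y v = 0) → v = 0 := by
  let b : Module.Basis ι ℝ E :=
    (Module.finBasis ℝ E).reindex (Fintype.equivOfCardEq (by simpa using hcard.symm))
  let ℓ (i : ι) : E →L[ℝ] ℝ := (b.coord i).toContinuousLinearMap
  have hd (i : ι) : ∀ y ∈ (extChartAt I x).source,
      ContMDiffAt I 𝓘(ℝ, ℝ) ∞ (fun z ↦ ℓ i (extChartAt I x z)) y := fun y hy ↦
    (ℓ i).contMDiff.contMDiffAt.comp y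
      (contMDiffAt_extChartAt' (by rwa [← extChartAt_source (I := I)]))
  refine ⟨fun i y ↦ ℓ i (extChartAt I x y), fun i ↦ ?_, ?_⟩
  · filter_upwards [extChartAt_source_mem_nhds (I := I) x] with y hy using hd i y hy
  · filter_upwards [extChartAt_source_mem_nhds (I := I) x] with y hy v hv
    have hinj := (isInvertible_mfderiv_extChartAt (I := I) hy).injective
    refine hinj (Eq.trans ?_ (map_zero (mfderiv I 𝓘(ℝ, E) (extChartAt I x) y)).symm)
    refine b.ext_elem fun i ↦ ?_
    have h1 := (ℓ i).hasMFDerivAt.comp y (mdifferentiableAt_extChartAt (I := I) (x := x)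
      (by rwa [← extChartAt_source (I := I)])).hasMFDerivAt
    have h2 : dirDeriv I (fun y ↦ ℓ i (extChartAt I x y)) y v = _ :=
      congrArg (fun L ↦ L v) h1.mfderiv
    have h3 := (h2.symm.trans (hv i))
    refine Eq.trans (h3 : b.coord i (mfderiv I 𝓘(ℝ, E) (extChartAt I x) y v) = 0) ?_
    exact (map_zero (b.coord i)).symm

/-- A smooth frame of the tangent bundle whose structure functions are constant. -/
structure IsLieFrame (X : ι → VF I M) (c : ι → ι → ι → ℝ) : Prop where
  smooth : ∀ i x, VF.SmoothNear I (X i) x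
  card_eq : Fintype.card ι = Module.finrank ℝ E
  linearIndependent : ∀ x, LinearIndependent ℝ fun i ↦ X i x
  bracket : ∀ i j x, mlieBracket I (X i) (X j) x = ∑ k, c i j k • X k x

namespace IsLieFrame

variable {X : ι → VF I M} {c : ι → ι → ι → ℝ} (hX : IsLieFrame X c)

include hX in
lemma span_eq_top (x : M) : Submodule.span ℝ (range fun i ↦ X i x) = ⊤ :=
  (hX.linearIndependent x).span_eq_top_of_card_eq_finrank' hX.card_eq

/-- The basis of the tangent space at `x`. -/
def basis (x : M) : Module.Basis ι ℝ (TangentSpace I x) :=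
  Module.Basis.mk (hX.linearIndependent x) (hX.span_eq_top x).ge

lemma basis_apply (x : M) (i : ι) : hX.basis x i = X i x := Module.Basis.mk_apply _ _ _

/-- The components of a tangent vector. -/
def coord (i : ι) (x : M) : TangentSpace I x →ₗ[ℝ] ℝ := (hX.basis x).coord i

lemma sum_coord (x : M) (v : TangentSpace I x) : ∑ i, hX.coord i x v • X i x = v := by
  conv_rhs => rw [← (hX.basis x).sum_repr v]
  simp only [basis_apply]
  rfl

lemma coord_frame (x : M) (i j : ι) : hX.coord i x (X j x) = if j = i then 1 else 0 := by
  rw [← hX.basis_apply, coord, Module.Basis.coord_apply, Module.Basis.repr_self,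
    Finsupp.single_apply]

lemma coord_sum (x : M) (a : ι → ℝ) (i : ι) : hX.coord i x (∑ j, a j • X j x) = a i := by
  rw [map_sum]
  simp [coord_frame]

lemma contMDiffAt_coord {E' : Type*} [NormedAddCommGroup E'] [NormedSpace ℝ E']
    {H' : Type*} [TopologicalSpace H'] {J : ModelWithCorners ℝ E' H'}
    {N : Type*} [TopologicalSpace N] [ChartedSpace H' N] {φ : N → M} {p : N}
    (hφ : ContMDiffAt J I ∞ φ p) {V : (q : N) → TangentSpace I (φ q)}
    (hV : ∀ f : M → ℝ, (∀ᶠ y in 𝓝 (φ p), ContMDiffAt I 𝓘(ℝ, ℝ) ∞ f y) →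
      ContMDiffAt J 𝓘(ℝ, ℝ) ∞ (fun q ↦ dirDeriv I f (φ q) (V q)) p) (i : ι) :
    ContMDiffAt J 𝓘(ℝ, ℝ) ∞ (fun q ↦ hX.coord i (φ q) (V q)) p := by
  obtain ⟨f, hf, hinj⟩ := exists_local_coordinates (I := I) hX.card_eq (φ p)
  refine contMDiffAt_of_linear_system (A := fun k i q ↦ dirDeriv I (f k) (φ q) (X i (φ q)))
    (b := fun k q ↦ dirDeriv I (f k) (φ q) (V q)) (c := fun i q ↦ hX.coord i (φ q) (V q))
    ?_ (fun k ↦ hV _ (hf k)) ?_ ?_ i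
  · intro k i
    exact (contMDiffAt_dirDeriv (hX.smooth i (φ p)).contMDiffAt (hf k).self_of_nhds).comp p hφ
  · intro v hv
    have h1 : ∑ i, v i • X i (φ p) = 0 := hinj.self_of_nhds _ fun k ↦ by
      rw [dirDeriv_sum_vec, ← hv k]
      exact Finset.sum_congr rfl fun i _ ↦ by rw [dirDeriv_smul_vec, mul_comm]
    ext i
    rw [← hX.coord_sum (φ p) v i, h1, map_zero]; rfl
  · refine Eventually.of_forall fun q k ↦ ?_
    conv_rhs => rw [← hX.sum_coord (φ q) (V q)]
    rw [dirDeriv_sum_vec]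
    exact Finset.sum_congr rfl fun i _ ↦ by rw [dirDeriv_smul_vec, mul_comm]

lemma contMDiffAt_coord_apply {V : VF I M} {x : M}
    (hV : ContMDiffAt I I.tangent ∞ (fun y ↦ (⟨y, V y⟩ : TangentBundle I M)) x) (i : ι) :
    ContMDiffAt I 𝓘(ℝ, ℝ) ∞ (fun y ↦ hX.coord i y (V y)) x :=
  hX.contMDiffAt_coord (φ := id) contMDiffAt_id
    (fun _ hf ↦ contMDiffAt_dirDeriv hV hf.self_of_nhds) i

/-! ### Coordinates on the tangent spaces of the cotangent bundle -/

/-- The horizontal components of a vector tangent to the cotangent bundle. -/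
def hor (i : ι) (q : Cotangent I M) : TangentSpace (cotModel I) q →ₗ[ℝ] ℝ :=
  hX.coord i q.1 ∘ₗ (projDeriv I q).toLinearMap

variable (X) in
/-- The vertical components of a vector tangent to the cotangent bundle: the derivatives of
the functions `linFun`. -/
def ver (i : ι) (q : Cotangent I M) : TangentSpace (cotModel I) q →ₗ[ℝ] ℝ :=
  (mvfderiv (cotModel I) (linFun I (X i)) q).toLinearMap

lemma ver_apply (i : ι) (q : Cotangent I M) (ξ : TangentSpace (cotModel I) q) :
    ver X i q ξ = dirDeriv (cotModel I) (linFun I (X i)) q ξ := rfl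

lemma hor_apply (i : ι) (q : Cotangent I M) (ξ : TangentSpace (cotModel I) q) :
    hX.hor i q ξ = hX.coord i q.1 (projDeriv I q ξ) := rfl

lemma sum_hor (q : Cotangent I M) (ξ : TangentSpace (cotModel I) q) :
    ∑ i, hX.hor i q ξ • X i q.1 = projDeriv I q ξ := hX.sum_coord _ _

lemma projDeriv_eq_zero_iff (q : Cotangent I M) (ξ : TangentSpace (cotModel I) q) :
    projDeriv I q ξ = 0 ↔ ∀ i, hX.hor i q ξ = 0 := by
  constructor
  · intro h i; rw [hor_apply, h, map_zero]
  · intro h; rw [← hX.sum_hor]; simp [h]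

include hX in
lemma contMDiffAt_linFun (i : ι) (q : Cotangent I M) :
    ContMDiffAt (cotModel I) 𝓘(ℝ, ℝ) ∞ (linFun I (X i)) q :=
  SubRiem.contMDiffAt_linFun (hX.smooth i q.1).contMDiffAt

include hX in
lemma mdifferentiableAt_linFun (i : ι) (q : Cotangent I M) :
    MDifferentiableAt (cotModel I) 𝓘(ℝ, ℝ) (linFun I (X i)) q :=
  (hX.contMDiffAt_linFun i q).mdifferentiableAt (by simp)

/-- The linear map formed by all components. -/
def components (q : Cotangent I M) : TangentSpace (cotModel I) q →ₗ[ℝ] (ι → ℝ) × (ι → ℝ) :=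
  (LinearMap.pi fun i ↦ hX.hor i q).prod (LinearMap.pi fun i ↦ ver X i q)

lemma components_injective (q : Cotangent I M) : Function.Injective (hX.components q) := by
  refine (injective_iff_map_eq_zero _).2 fun ξ hξ ↦ ?_
  have h1 (i) : hX.hor i q ξ = 0 := congrFun (congrArg Prod.fst hξ) i
  have h2 (i) : ver X i q ξ = 0 := congrFun (congrArg Prod.snd hξ) i
  exact eq_zero_of_projDeriv_eq_zero (fun i ↦ (hX.smooth i q.1).contMDiffAt)
    (hX.span_eq_top q.1).ge ((hX.projDeriv_eq_zero_iff q ξ).2 h1) h2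

lemma ext {q : Cotangent I M} {ξ η : TangentSpace (cotModel I) q}
    (hh : ∀ i, hX.hor i q ξ = hX.hor i q η) (hv : ∀ i, ver X i q ξ = ver X i q η) : ξ = η :=
  hX.components_injective q (Prod.ext (funext hh) (funext hv))

include hX in
lemma finrank_cotangent :
    Module.finrank ℝ (E × (E →L[ℝ] ℝ)) = Fintype.card ι + Fintype.card ι := by
  have h : Module.finrank ℝ (E →L[ℝ] ℝ) = Module.finrank ℝ E :=
    (LinearMap.toContinuousLinearMap (𝕜 := ℝ) (E := E) (F' := ℝ)).symm.finrank_eq.trans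
      Subspace.dual_finrank_eq
  rw [Module.finrank_prod, h, hX.card_eq]

lemma components_surjective (q : Cotangent I M) : Function.Surjective (hX.components q) := by
  have h : Module.finrank ℝ (TangentSpace (cotModel I) q) =
      Module.finrank ℝ ((ι → ℝ) × (ι → ℝ)) := by
    rw [Module.finrank_prod, Module.finrank_fintype_fun_eq_card]
    exact hX.finrank_cotangent
  exact (LinearMap.injective_iff_surjective_of_finrank_eq_finrank h).1 (hX.components_injective q)

/-- The vector with prescribed components. -/
def vec (q : Cotangent I M) (w v : ι → ℝ) : TangentSpace (cotModel I) q :=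
  (hX.components_surjective q (w, v)).choose

@[simp]
lemma hor_vec (q : Cotangent I M) (w v : ι → ℝ) (i : ι) : hX.hor i q (hX.vec q w v) = w i :=
  congrFun (congrArg Prod.fst (hX.components_surjective q (w, v)).choose_spec) i

@[simp]
lemma ver_vec (q : Cotangent I M) (w v : ι → ℝ) (i : ι) : ver X i q (hX.vec q w v) = v i :=
  congrFun (congrArg Prod.snd (hX.components_surjective q (w, v)).choose_spec) i

include hX in
lemma contMDiffAt_ver {V : VF (cotModel I) (Cotangent I M)} {p : Cotangent I M}
    (hV : VF.SmoothNear (cotModel I) V p) (i : ι) :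
    ContMDiffAt (cotModel I) 𝓘(ℝ, ℝ) ∞ (fun q ↦ ver X i q (V q)) p :=
  contMDiffAt_dirDeriv hV.contMDiffAt (hX.contMDiffAt_linFun i p)

lemma contMDiffAt_hor {V : VF (cotModel I) (Cotangent I M)} {p : Cotangent I M}
    (hV : VF.SmoothNear (cotModel I) V p) (i : ι) :
    ContMDiffAt (cotModel I) 𝓘(ℝ, ℝ) ∞ (fun q ↦ hX.hor i q (V q)) p := by
  refine hX.contMDiffAt_coord (V := fun q ↦ projDeriv I q (V q))
    contMDiff_cotangent_proj.contMDiffAt (fun f hf ↦ ?_) i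
  have h1 := contMDiffAt_dirDeriv hV.contMDiffAt
    (contMDiffAt_comp_proj (n := (⊤ : ℕ∞)) hf.self_of_nhds)
  refine h1.congr_of_eventuallyEq ?_
  filter_upwards [(tendsto_cotangent_proj p).eventually hf] with q hq
  exact (dirDeriv_comp_proj (hq.mdifferentiableAt (by simp)) _).symm

theorem smoothNear_vec {w v : Cotangent I M → ι → ℝ} {p : Cotangent I M}
    (hw : ∀ i, ∀ᶠ q in 𝓝 p, ContMDiffAt (cotModel I) 𝓘(ℝ, ℝ) ∞ (fun q ↦ w q i) q)
    (hv : ∀ i, ∀ᶠ q in 𝓝 p, ContMDiffAt (cotModel I) 𝓘(ℝ, ℝ) ∞ (fun q ↦ v q i) q) :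
    VF.SmoothNear (cotModel I) (fun q ↦ hX.vec q (w q) (v q)) p := by
  obtain ⟨f, hf, hinj⟩ := exists_local_coordinates (I := I) hX.card_eq p.1
  have hf' (k : ι) := (tendsto_cotangent_proj p).eventually (hf k)
  refine VF.smoothNear_of_coordinates (ι := ι ⊕ ι)
    (f := Sum.elim (fun k q ↦ f k q.1) fun k ↦ linFun I (X k)) ?_ ?_ ?_ ?_
  · rw [hX.finrank_cotangent, Fintype.card_sum]
  · rintro (k | k)
    · filter_upwards [hf' k] with q hq using contMDiffAt_comp_proj (n := (⊤ : ℕ∞)) hq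
    · exact Eventually.of_forall fun q ↦ hX.contMDiffAt_linFun k q
  · filter_upwards [(tendsto_cotangent_proj p).eventually hinj, eventually_all.2 hf'] with q hq hfq
    intro ξ hξ
    refine eq_zero_of_projDeriv_eq_zero (fun i ↦ (hX.smooth i q.1).contMDiffAt)
      (hX.span_eq_top q.1).ge (hq _ fun k ↦ ?_) fun i ↦ hξ (Sum.inr i)
    rw [← dirDeriv_comp_proj ((hfq k).mdifferentiableAt (by simp))]
    exact hξ (Sum.inl k)
  · rintro (k | k)
    · have h1 : ∀ᶠ q in 𝓝 p, ContMDiffAt (cotModel I) 𝓘(ℝ, ℝ) ∞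
          (fun q : Cotangent I M ↦ ∑ i, w q i * dirDeriv I (f k) q.1 (X i q.1)) q := by
        filter_upwards [eventually_all.2 hw, hf' k] with q hwq hfq
        refine contMDiffAt_finsetSum fun i _ ↦ (hwq i).mul ?_
        exact contMDiffAt_comp_proj (n := (⊤ : ℕ∞))
          (contMDiffAt_dirDeriv (hX.smooth i q.1).contMDiffAt hfq)
      filter_upwards [h1, (hf' k).eventually_nhds] with q hq hfq
      refine hq.congr_of_eventuallyEq ?_
      filter_upwards [hfq] with q' hq'
      rw [Sum.elim_inl, dirDeriv_comp_proj (hq'.mdifferentiableAt (by simp)), ← hX.sum_hor,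
        dirDeriv_sum_vec]
      exact Finset.sum_congr rfl fun i _ ↦ by rw [dirDeriv_smul_vec, hX.hor_vec]
    · filter_upwards [hv k] with q hq
      refine hq.congr_of_eventuallyEq (Eventually.of_forall fun q' ↦ ?_)
      exact hX.ver_vec q' (w q') (v q') k

/-- The vertical components of a Lie bracket. -/
theorem ver_mlieBracket {A V : VF (cotModel I) (Cotangent I M)} {p : Cotangent I M}
    (hX : IsLieFrame X c)
    (hA : VF.SmoothNear (cotModel I) A p) (hV : VF.SmoothNear (cotModel I) V p) (i : ι) :
    ver X i p (mlieBracket (cotModel I) A V p) =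
      dirDeriv (cotModel I) (fun q ↦ ver X i q (V q)) p (A p)
        - dirDeriv (cotModel I) (fun q ↦ ver X i q (A q)) p (V p) :=
  hA.dirDeriv_mlieBracket hV (hX.contMDiffAt_linFun i p)

/-- A vector field on the cotangent bundle acting on a function of the base point. -/
lemma dirDeriv_comp_proj_eventuallyEq (V : VF (cotModel I) (Cotangent I M)) {p : Cotangent I M}
    {f : M → ℝ} (hf : ∀ᶠ y in 𝓝 p.1, ContMDiffAt I 𝓘(ℝ, ℝ) ∞ f y) :
    (fun q ↦ dirDeriv (cotModel I) (fun q : Cotangent I M ↦ f q.1) q (V q)) =ᶠ[𝓝 p]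
      fun q ↦ ∑ k, hX.hor k q (V q) * dirDeriv I f q.1 (X k q.1) := by
  filter_upwards [(tendsto_cotangent_proj p).eventually hf] with q hq
  rw [dirDeriv_comp_proj (hq.mdifferentiableAt (by simp)), ← hX.sum_hor, dirDeriv_sum_vec]
  exact Finset.sum_congr rfl fun i _ ↦ by rw [dirDeriv_smul_vec]

lemma dirDeriv_dirDeriv_comp_proj {A V : VF (cotModel I) (Cotangent I M)} {p : Cotangent I M}
    (hV : VF.SmoothNear (cotModel I) V p)
    {f : M → ℝ} (hf : ∀ᶠ y in 𝓝 p.1, ContMDiffAt I 𝓘(ℝ, ℝ) ∞ f y) :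
    dirDeriv (cotModel I) (fun q ↦ dirDeriv (cotModel I) (fun q : Cotangent I M ↦ f q.1) q (V q))
        p (A p) =
      ∑ k, (dirDeriv I f p.1 (X k p.1) *
          dirDeriv (cotModel I) (fun q ↦ hX.hor k q (V q)) p (A p)
        + ∑ j, hX.hor k p (V p) * hX.hor j p (A p) *
          dirDeriv I (fun y ↦ dirDeriv I f y (X k y)) p.1 (X j p.1)) := by
  rw [dirDeriv_congr (hX.dirDeriv_comp_proj_eventuallyEq V hf)]
  have h1 (k : ι) : MDifferentiableAt I 𝓘(ℝ, ℝ) (fun y ↦ dirDeriv I f y (X k y)) p.1 :=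
    (contMDiffAt_dirDeriv (hX.smooth k p.1).contMDiffAt hf.self_of_nhds).mdifferentiableAt (by simp)
  have h2 (k : ι) : MDifferentiableAt (cotModel I) 𝓘(ℝ, ℝ)
      (fun q : Cotangent I M ↦ dirDeriv I f q.1 (X k q.1)) p :=
    (h1 k).comp p (mdifferentiableAt_cotangent_proj p)
  have h3 (k : ι) := (hX.contMDiffAt_hor hV k).mdifferentiableAt (by simp)
  have h4 (k : ι) : MDifferentiableAt (cotModel I) 𝓘(ℝ, ℝ)
      (fun q : Cotangent I M ↦ hX.hor k q (V q) * dirDeriv I f q.1 (X k q.1)) p :=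
    (h3 k).mul (h2 k)
  rw [dirDeriv_sum Finset.univ fun k _ ↦ h4 k]
  refine Finset.sum_congr rfl fun k _ ↦ ?_
  rw [dirDeriv_mul (h3 k) (h2 k), add_comm]
  congr 1
  rw [dirDeriv_comp_proj (f := fun y ↦ dirDeriv I f y (X k y)) (h1 k), ← hX.sum_hor,
    dirDeriv_sum_vec, Finset.mul_sum]
  exact Finset.sum_congr rfl fun j _ ↦ by rw [dirDeriv_smul_vec]; ring

/-- The horizontal components of a Lie bracket. -/
theorem hor_mlieBracket {A V : VF (cotModel I) (Cotangent I M)} {p : Cotangent I M}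
    (hA : VF.SmoothNear (cotModel I) A p) (hV : VF.SmoothNear (cotModel I) V p) (i : ι) :
    hX.hor i p (mlieBracket (cotModel I) A V p) =
      dirDeriv (cotModel I) (fun q ↦ hX.hor i q (V q)) p (A p)
        - dirDeriv (cotModel I) (fun q ↦ hX.hor i q (A q)) p (V p)
        + ∑ j, ∑ k, c j k i * hX.hor j p (A p) * hX.hor k p (V p) := by
  have key : projDeriv I p (mlieBracket (cotModel I) A V p) =
      ∑ i, (dirDeriv (cotModel I) (fun q ↦ hX.hor i q (V q)) p (A p)
        - dirDeriv (cotModel I) (fun q ↦ hX.hor i q (A q)) p (V p)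
        + ∑ j, ∑ k, c j k i * hX.hor j p (A p) * hX.hor k p (V p)) • X i p.1 := by
    refine eq_of_dirDeriv_eq fun f hf ↦ ?_
    have hf0 := hf.self_of_nhds
    rw [← dirDeriv_comp_proj (hf0.mdifferentiableAt (by simp)),
      hA.dirDeriv_mlieBracket hV (contMDiffAt_comp_proj (n := (⊤ : ℕ∞)) hf0),
      hX.dirDeriv_dirDeriv_comp_proj hV hf, hX.dirDeriv_dirDeriv_comp_proj hA hf,
      dirDeriv_sum_vec]
    simp only [dirDeriv_smul_vec]
    have hbr (j k : ι) : ∑ i, c j k i * dirDeriv I f p.1 (X i p.1) =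
        dirDeriv I (fun y ↦ dirDeriv I f y (X k y)) p.1 (X j p.1)
          - dirDeriv I (fun y ↦ dirDeriv I f y (X j y)) p.1 (X k p.1) := by
      rw [← (hX.smooth j p.1).dirDeriv_mlieBracket (hX.smooth k p.1) hf0, hX.bracket,
        dirDeriv_sum_vec]
      simp only [dirDeriv_smul_vec]
    have h4 : ∑ i, (∑ j, ∑ k, c j k i * hX.hor j p (A p) * hX.hor k p (V p)) *
        dirDeriv I f p.1 (X i p.1) =
        ∑ j, ∑ k, hX.hor j p (A p) * hX.hor k p (V p) *
          (dirDeriv I (fun y ↦ dirDeriv I f y (X k y)) p.1 (X j p.1)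
            - dirDeriv I (fun y ↦ dirDeriv I f y (X j y)) p.1 (X k p.1)) := by
      simp only [← hbr, Finset.sum_mul, Finset.mul_sum]
      rw [Finset.sum_comm]
      refine Finset.sum_congr rfl fun j _ ↦ ?_
      rw [Finset.sum_comm]
      exact Finset.sum_congr rfl fun k _ ↦ Finset.sum_congr rfl fun i _ ↦ by ring
    simp only [add_mul, sub_mul, Finset.sum_add_distrib, Finset.sum_sub_distrib, h4, mul_sub]
    rw [Finset.sum_comm (f := fun k j ↦ hX.hor k p (V p) * hX.hor j p (A p) *
          dirDeriv I (fun y ↦ dirDeriv I f y (X k y)) p.1 (X j p.1))]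
    simp only [mul_comm (dirDeriv I f p.1 _)]
    have h5 : ∀ j k : ι, hX.hor k p (V p) * hX.hor j p (A p) =
      hX.hor j p (A p) * hX.hor k p (V p) := fun _ _ ↦ mul_comm _ _
    simp only [h5]
    ring
  rw [hor_apply, key, hX.coord_sum]

end IsLieFrame

/-- A one-form is differentiable in a chart if its values on a frame are differentiable. -/
lemma OneForm.differentiableAt_inChart {α : OneForm I M} {x : M} {e : ι → VF I M}
    (hcard : Fintype.card ι = Module.finrank ℝ E)
    (he : ∀ i, MDifferentiableAt I I.tangent (fun y ↦ (⟨y, e i y⟩ : TangentBundle I M)) x)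
    (hli : LinearIndependent ℝ fun i ↦ e i x)
    (hα : ∀ i, MDifferentiableAt I 𝓘(ℝ, ℝ) (fun y ↦ α y (e i y)) x) :
    DifferentiableAt ℝ (α.inChart I x) (extChartAt I x x) := by
  let pr (i : ι) : (ι → ℝ) →L[ℝ] ℝ := ContinuousLinearMap.proj (R := ℝ) (φ := fun _ : ι ↦ ℝ) i
  let T (u : E) : (ι → ℝ) →L[ℝ] E := ∑ i, (pr i).smulRight ((e i).inChart x u)
  let S (u : E) : (ι → ℝ) →L[ℝ] ℝ :=
    ∑ i, ((fun y ↦ α y (e i y)) ∘ (extChartAt I x).symm) u • pr i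
  have hT : DifferentiableAt ℝ T (extChartAt I x x) := by
    refine DifferentiableAt.fun_sum fun i _ ↦ ?_
    exact (ContinuousLinearMap.smulRightL ℝ (ι → ℝ) E (pr i)).differentiableAt.comp _
      (VF.differentiableAt_inChart (he i))
  have hS : DifferentiableAt ℝ S (extChartAt I x x) := by
    refine DifferentiableAt.fun_sum fun i _ ↦ DifferentiableAt.smul_const ?_ _
    have h1 := MDifferentiableWithinAt.differentiableWithinAt_comp_extChartAt_symm
      (mdifferentiableWithinAt_univ.2 (hα i))
    rwa [preimage_univ, univ_inter, I.range_eq_univ, differentiableWithinAt_univ] at h1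
  have hTinj : Function.Injective (T (extChartAt I x x)) := by
    refine (injective_iff_map_eq_zero _).2 fun v hv ↦ ?_
    have h1 : (mfderiv I 𝓘(ℝ, E) (extChartAt I x) x) (∑ i, v i • e i x) = 0 := by
      refine Eq.trans ?_ hv
      refine (map_sum (mfderiv I 𝓘(ℝ, E) (extChartAt I x) x) _ _).trans ?_
      simp only [T, pr, sum_apply, VF.inChart_self]
      exact Finset.sum_congr rfl fun i _ ↦ map_smul (mfderiv I 𝓘(ℝ, E) (extChartAt I x) x) _ _
    have h2 := (isInvertible_mfderiv_extChartAt (I := I) (mem_extChartAt_source x)).injective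
      (h1.trans (map_zero _).symm)
    exact funext (Fintype.linearIndependent_iff.1 hli v h2)
  obtain ⟨e0, he0⟩ := isInvertible_of_injective (by simpa using hcard) _ hTinj
  have hinv : DifferentiableAt ℝ (fun u ↦ (T u).inverse) (extChartAt I x x) := by
    have h1 : ContDiffAt ℝ 1 ContinuousLinearMap.inverse (T (extChartAt I x x)) := by
      rw [← he0]; exact contDiffAt_map_inverse e0
    exact (h1.differentiableAt (by simp)).comp _ hT
  have hev : ∀ᶠ u in 𝓝 (extChartAt I x x), (T u).IsInvertible := by
    have h1 : ∀ᶠ L in 𝓝 (T (extChartAt I x x)), L.IsInvertible := by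
      rw [← he0]
      exact (ContinuousLinearEquiv.isOpen (𝕜 := ℝ) (E := ι → ℝ) (F := E)).mem_nhds ⟨e0, rfl⟩
    exact hT.continuousAt.eventually h1
  refine (hS.clm_comp hinv).congr_of_eventuallyEq ?_
  filter_upwards [hev, extChartAt_target_mem_nhds (I := I) x] with u hu hut
  have h1 : (α.inChart I x u).comp (T u) = S u := by
    ext v
    simp only [T, S, pr, ContinuousLinearMap.comp_apply, sum_apply,
      ContinuousLinearMap.smulRight_apply, map_sum, map_smul, ContinuousLinearMap.proj_apply,
      OneForm.inChart_apply_inChart α _ x hut, smul_apply, smul_eq_mul,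
      Function.comp_apply, mul_comm]
  rw [← h1]
  ext v
  simp only [ContinuousLinearMap.comp_apply]
  rw [hu.self_apply_inverse]

namespace IsLieFrame

variable {X : ι → VF I M} {c : ι → ι → ι → ℝ} (hX : IsLieFrame X c)

lemma tautological_apply (q : Cotangent I M) (ξ : TangentSpace (cotModel I) q) :
    tautological I q ξ = ∑ i, hX.hor i q ξ * linFun I (X i) q := by
  change q.2 (projDeriv I q ξ) = _
  rw [← hX.sum_hor, map_sum]
  exact Finset.sum_congr rfl fun i _ ↦ map_smul q.2 _ _

/-- The canonical symplectic form in terms of a frame. -/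
theorem sympl_apply (q : Cotangent I M) (ξ η : TangentSpace (cotModel I) q) :
    sympl I q ξ η = ∑ i, (ver X i q ξ * hX.hor i q η - ver X i q η * hX.hor i q ξ)
      - ∑ i, ∑ j, ∑ k, c i j k * hX.hor i q ξ * hX.hor j q η * linFun I (X k) q := by
  let fld (w v : ι → ℝ) : VF (cotModel I) (Cotangent I M) := fun q ↦ hX.vec q w v
  have hs (w v : ι → ℝ) : VF.SmoothNear (cotModel I) (fld w v) q :=
    hX.smoothNear_vec (fun _ ↦ Eventually.of_forall fun _ ↦ contMDiffAt_const)
      (fun _ ↦ Eventually.of_forall fun _ ↦ contMDiffAt_const)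
  have hθ (w v : ι → ℝ) : (fun q ↦ tautological I q (fld w v q)) =
      fun q ↦ ∑ i, w i * linFun I (X i) q := by
    ext q
    simp only [hX.tautological_apply, fld, hX.hor_vec]
  have hm (w : ι → ℝ) (i : ι) : MDifferentiableAt (cotModel I) 𝓘(ℝ, ℝ)
      (fun q ↦ w i * linFun I (X i) q) q :=
    mdifferentiableAt_const.mul (hX.mdifferentiableAt_linFun i q)
  have hθm (w v : ι → ℝ) : MDifferentiableAt (cotModel I) 𝓘(ℝ, ℝ)
      (fun q ↦ tautological I q (fld w v q)) q := by
    rw [hθ]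
    exact mdifferentiableAt_finset_sum _ fun i _ ↦ hm w i
  have hθd (w v : ι → ℝ) (ζ : TangentSpace (cotModel I) q) :
      dirDeriv (cotModel I) (fun q ↦ tautological I q (fld w v q)) q ζ =
        ∑ i, w i * ver X i q ζ := by
    rw [hθ, dirDeriv_sum _ fun i _ ↦ hm w i]
    exact Finset.sum_congr rfl fun i _ ↦ dirDeriv_const_mul _ (hX.mdifferentiableAt_linFun i q) _
  have hc : DifferentiableAt ℝ ((tautological I).inChart (cotModel I) q)
      (extChartAt (cotModel I) q q) := by
    refine OneForm.differentiableAt_inChart (ι := ι ⊕ ι)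
      (e := Sum.elim (fun i ↦ fld (Pi.single i 1) 0) fun i ↦ fld 0 (Pi.single i 1)) ?_ ?_ ?_ ?_
    · rw [hX.finrank_cotangent, Fintype.card_sum]
    · rintro (i | i) <;> exact (hs _ _).mdifferentiableAt
    · refine LinearIndependent.of_comp (hX.components q) ?_
      have hb := ((Pi.basisFun ℝ ι).prod (Pi.basisFun ℝ ι)).linearIndependent
      convert! hb using 1
      ext a j
      · rcases a with i | i <;> simp [components, fld]
      · rcases a with i | i <;> simp [components, fld]
    · rintro (i | i) <;> exact hθm _ _
  have hval (ζ : TangentSpace (cotModel I) q) :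
      fld (fun i ↦ hX.hor i q ζ) (fun i ↦ ver X i q ζ) q = ζ :=
    hX.ext (fun i ↦ hX.hor_vec _ _ _ _) (fun i ↦ hX.ver_vec _ _ _ _)
  have hd := OneForm.extDeriv_apply hc
    (hs (fun i ↦ hX.hor i q ξ) (fun i ↦ ver X i q ξ)).mdifferentiableAt
    (hs (fun i ↦ hX.hor i q η) (fun i ↦ ver X i q η)).mdifferentiableAt (hθm _ _) (hθm _ _)
  rw [hval, hval, hθd, hθd, hX.tautological_apply] at hd
  have hbr (i : ι) := hX.hor_mlieBracket (hs (fun i ↦ hX.hor i q ξ) (fun i ↦ ver X i q ξ))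
    (hs (fun i ↦ hX.hor i q η) (fun i ↦ ver X i q η)) i
  simp only [hval, fld, hX.hor_vec, dirDeriv_const] at hbr
  change sympl I q ξ η = _ at hd
  rw [hd]
  simp only [fld, hbr, Finset.sum_sub_distrib, sub_zero, zero_add, Finset.sum_mul]
  congr 1
  · congr 1 <;> exact Finset.sum_congr rfl fun i _ ↦ mul_comm _ _
  · rw [Finset.sum_comm]
    exact Finset.sum_congr rfl fun j _ ↦ Finset.sum_comm

end IsLieFrame

end LieFrame

section Orthonormal

variable {V : Type*} [AddCommGroup V] [Module ℝ V] {D : Submodule ℝ V}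
  {g : LinearMap.BilinForm ℝ D}

/-- Two orthonormal pairs differ by an orthogonal matrix. -/
lemma IsOrthonormalPair.exists_rotation {u₁ u₂ v₁ v₂ : V} (hs : ∀ x y, g x y = g y x)
    (hu : IsOrthonormalPair D g u₁ u₂) (hv : IsOrthonormalPair D g v₁ v₂) :
    ∃ c s ε : ℝ, c ^ 2 + s ^ 2 = 1 ∧ ε ^ 2 = 1 ∧ v₁ = c • u₁ + s • u₂ ∧
      v₂ = (-(ε * s)) • u₁ + (ε * c) • u₂ := by
  obtain ⟨hspan, hu1, hu2, h11, h22, h12⟩ := hu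
  obtain ⟨-, hv1, hv2, k11, k22, k12⟩ := hv
  obtain ⟨a, b, rfl⟩ := Submodule.mem_span_pair.1 (hspan.ge hv1)
  obtain ⟨a', b', rfl⟩ := Submodule.mem_span_pair.1 (hspan.ge hv2)
  have e (a b : ℝ) (h : a • u₁ + b • u₂ ∈ D) :
      (⟨a • u₁ + b • u₂, h⟩ : D) = a • ⟨u₁, hu1⟩ + b • ⟨u₂, hu2⟩ := rfl
  have h21 : g ⟨u₂, hu2⟩ ⟨u₁, hu1⟩ = 0 := by rw [hs, h12]
  rw [e] at k11 k22
  rw [e, e] at k12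
  simp only [map_add, map_smul, LinearMap.add_apply, LinearMap.smul_apply, h11, h12, h21, h22,
    smul_eq_mul] at k11 k22 k12
  have h1 : a ^ 2 + b ^ 2 = 1 := by linarith
  have h2 : a' ^ 2 + b' ^ 2 = 1 := by linarith
  have h3 : a * a' + b * b' = 0 := by linarith
  refine ⟨a, b, a * b' - b * a', h1, ?_, rfl, ?_⟩
  · linear_combination (a' ^ 2 + b' ^ 2) * h1 + h2 - (a * a' + b * b') * h3
  · congr 2
    · linear_combination (-a') * h1 + a * h3
    · linear_combination (-b') * h1 + b * h3

/-- Rotations and reflections of orthonormal pairs are orthonormal. -/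
lemma IsOrthonormalPair.rotate {u₁ u₂ : V} (hs : ∀ x y, g x y = g y x)
    (hu : IsOrthonormalPair D g u₁ u₂) {c s ε : ℝ} (h : c ^ 2 + s ^ 2 = 1) (hε : ε ^ 2 = 1) :
    IsOrthonormalPair D g (c • u₁ + s • u₂) ((-(ε * s)) • u₁ + (ε * c) • u₂) := by
  obtain ⟨hspan, hu1, hu2, h11, h22, h12⟩ := hu
  have h21 : g ⟨u₂, hu2⟩ ⟨u₁, hu1⟩ = 0 := by rw [hs, h12]
  have hmem (a b : ℝ) : a • u₁ + b • u₂ ∈ D := D.add_mem (D.smul_mem _ hu1) (D.smul_mem _ hu2)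
  have e (a b : ℝ) : (⟨a • u₁ + b • u₂, hmem a b⟩ : D) = a • ⟨u₁, hu1⟩ + b • ⟨u₂, hu2⟩ := rfl
  refine ⟨le_antisymm ?_ ?_, hmem _ _, hmem _ _, ?_, ?_, ?_⟩
  · rw [Submodule.span_le]
    rintro _ (rfl | rfl) <;> exact hmem _ _
  · rw [← hspan, Submodule.span_le]
    rintro _ (rfl | rfl)
    · refine Submodule.mem_span_pair.2 ⟨c, -(ε * s), ?_⟩
      simp only [smul_add, smul_smul]
      have h1 : c * c + -(ε * s) * -(ε * s) = 1 := by linear_combination h + s ^ 2 * hε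
      have h2 : c * s + -(ε * s) * (ε * c) = 0 := by linear_combination (-c * s) * hε
      rw [add_add_add_comm, ← add_smul, ← add_smul, h1, h2]; simp
    · refine Submodule.mem_span_pair.2 ⟨s, ε * c, ?_⟩
      simp only [smul_add, smul_smul]
      have h1 : s * s + ε * c * (ε * c) = 1 := by linear_combination h + c ^ 2 * hε
      have h2 : s * c + ε * c * -(ε * s) = 0 := by linear_combination (-c * s) * hε
      rw [add_add_add_comm, ← add_smul, ← add_smul, h1, h2]; simp
  all_goals
    simp only [e]
    simp only [map_add, map_smul, LinearMap.add_apply, LinearMap.smul_apply, h11, h12, h21, h22,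
      smul_eq_mul]
  · linear_combination h
  · linear_combination ε ^ 2 * h + hε
  · ring

end Orthonormal

section Hamiltonian

variable {E : Type*} [NormedAddCommGroup E] [NormedSpace ℝ E] [FiniteDimensional ℝ E]
  {H : Type*} [TopologicalSpace H] {I : ModelWithCorners ℝ E H}
  {M : Type*} [TopologicalSpace M] [ChartedSpace H M]  [IsManifold I ∞ M] [I.Boundaryless]

lemma SubRiemStr.hamiltonian_eq (S : SubRiemStr I M) {X₁ X₂ : VF I M} {p : Cotangent I M}
    (h : S.IsOrthonormal p.1 (X₁ p.1) (X₂ p.1)) :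
    S.hamiltonian p = (linFun I X₁ p ^ 2 + linFun I X₂ p ^ 2) / 2 := by
  have h1 := (S.exists_frame p.1).choose_spec.choose_spec.2.2.self_of_nhds
  obtain ⟨c, s, ε, hcs, hε, e1, e2⟩ := h.exists_rotation (S.metric_symm p.1) h1
  have f1 := congrArg p.2 e1
  have f2 := congrArg p.2 e2
  rw [map_add, map_smul, map_smul] at f1 f2
  simp only [SubRiemStr.hamiltonian, linFun]
  rw [f1, f2]
  simp only [smul_eq_mul]
  linear_combination ((p.2 (X₁ p.1)) ^ 2 * s ^ 2 + (p.2 (X₂ p.1)) ^ 2 * c ^ 2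
    - 2 * (p.2 (X₁ p.1)) * (p.2 (X₂ p.1)) * c * s) / 2 * hε
    + ((p.2 (X₁ p.1)) ^ 2 + (p.2 (X₂ p.1)) ^ 2) / 2 * hcs

namespace IsLieFrame

section General
variable {ι : Type*} [Fintype ι] [DecidableEq ι]
  {X : ι → VF I M} {c : ι → ι → ι → ℝ} (hX : IsLieFrame X c)

include hX in
/-- The canonical symplectic form is nondegenerate. -/
lemma eq_of_sympl_eq {q : Cotangent I M} {η η' : TangentSpace (cotModel I) q}
    (h : ∀ ξ, sympl I q ξ η = sympl I q ξ η') : η = η' := by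
  have h1 (i) : hX.hor i q η = hX.hor i q η' := by
    have := h (hX.vec q 0 (Pi.single i 1))
    simpa [hX.sympl_apply, Pi.single_apply] using this
  refine hX.ext h1 fun i ↦ ?_
  have := h (hX.vec q (Pi.single i 1) 0)
  simpa [hX.sympl_apply, h1, Pi.single_apply] using this

include hX in
lemma hamVF_eq {a : Cotangent I M → ℝ} {q : Cotangent I M} {η : TangentSpace (cotModel I) q}
    (h : ∀ ξ, dirDeriv (cotModel I) a q ξ = sympl I q ξ η) : hamVF I a q = η := by
  have h1 : ∀ ξ, dirDeriv (cotModel I) a q ξ = sympl I q ξ (hamVF I a q) :=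
    Classical.epsilon_spec (p := fun v ↦ ∀ ξ, dirDeriv (cotModel I) a q ξ = sympl I q ξ v) ⟨η, h⟩
  exact hX.eq_of_sympl_eq fun ξ ↦ (h1 ξ).symm.trans (h ξ)

end General

end IsLieFrame

/-- The structure constants of the relations `[X₁, X₀] = p X₁ + b X₂`, `[X₂, X₀] = a X₁ - p X₂`,
`[X₂, X₁] = X₀`. -/
def structConst (p a b : ℝ) : Fin 3 → Fin 3 → Fin 3 → ℝ :=
  ![![![0, 0, 0], ![0, -p, -b], ![0, -a, p]],
    ![![0, p, b], ![0, 0, 0], ![-1, 0, 0]],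
    ![![0, a, -p], ![1, 0, 0], ![0, 0, 0]]]

namespace IsLieFrame

variable {X : Fin 3 → VF I M} {p a b : ℝ} (hX : IsLieFrame X (structConst p a b))

lemma sympl_eq (q : Cotangent I M) (ξ η : TangentSpace (cotModel I) q) :
    sympl I q ξ η =
      ver X 0 q ξ * hX.hor 0 q η + ver X 1 q ξ * hX.hor 1 q η + ver X 2 q ξ * hX.hor 2 q η
      - (ver X 0 q η * hX.hor 0 q ξ + ver X 1 q η * hX.hor 1 q ξ + ver X 2 q η * hX.hor 2 q ξ)
      - ((hX.hor 1 q ξ * hX.hor 0 q η - hX.hor 0 q ξ * hX.hor 1 q η) *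
            (p * linFun I (X 1) q + b * linFun I (X 2) q)
        + (hX.hor 2 q ξ * hX.hor 0 q η - hX.hor 0 q ξ * hX.hor 2 q η) *
            (a * linFun I (X 1) q - p * linFun I (X 2) q)
        + (hX.hor 2 q ξ * hX.hor 1 q η - hX.hor 1 q ξ * hX.hor 2 q η) * linFun I (X 0) q) := by
  rw [hX.sympl_apply]
  simp [Fin.sum_univ_three, structConst]
  ring

variable (S : SubRiemStr I M)

include hX in
/-- The Hamiltonian vector field of the sub-Riemannian Hamiltonian. -/
lemma hamVF_hamiltonian (hS : ∀ y, S.IsOrthonormal y (X 1 y) (X 2 y)) (q : Cotangent I M) :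
    hamVF I S.hamiltonian q = hX.vec q ![0, linFun I (X 1) q, linFun I (X 2) q]
      ![p * linFun I (X 1) q ^ 2 + (a + b) * (linFun I (X 1) q * linFun I (X 2) q)
          - p * linFun I (X 2) q ^ 2,
        linFun I (X 0) q * linFun I (X 2) q, - (linFun I (X 0) q * linFun I (X 1) q)] := by
  refine hX.hamVF_eq fun ξ ↦ ?_
  have h1 : S.hamiltonian = fun q ↦ (1 / 2) *
      (linFun I (X 1) q * linFun I (X 1) q + linFun I (X 2) q * linFun I (X 2) q) := by
    ext q; rw [S.hamiltonian_eq (hS q.1)]; ring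
  have hm (i) := hX.mdifferentiableAt_linFun i q
  have hmm (i) : MDifferentiableAt (cotModel I) 𝓘(ℝ, ℝ)
    (fun q ↦ linFun I (X i) q * linFun I (X i) q) q := (hm i).mul (hm i)
  have hmm' : MDifferentiableAt (cotModel I) 𝓘(ℝ, ℝ)
    (fun q ↦ linFun I (X 1) q * linFun I (X 1) q + linFun I (X 2) q * linFun I (X 2) q) q :=
    (hmm 1).add (hmm 2)
  rw [h1, dirDeriv_const_mul _ hmm', dirDeriv_add (hmm 1) (hmm 2), dirDeriv_mul (hm 1) (hm 1),
    dirDeriv_mul (hm 2) (hm 2), ← ver_apply, ← ver_apply, hX.sympl_eq]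
  simp only [hX.hor_vec, hX.ver_vec, Matrix.cons_val]
  ring

lemma poisson_hamiltonian_linFun_zero (hS : ∀ y, S.IsOrthonormal y (X 1 y) (X 2 y))
    (hX : IsLieFrame X (structConst p a b)) (q : Cotangent I M) :
    poisson I S.hamiltonian (linFun I (X 0)) q =
      p * linFun I (X 1) q ^ 2 + (a + b) * (linFun I (X 1) q * linFun I (X 2) q)
          - p * linFun I (X 2) q ^ 2 := by
  unfold poisson
  rw [hX.hamVF_hamiltonian S hS, ← ver_apply, hX.ver_vec]
  rfl

lemma poisson_hamiltonian_constant_of_motion (hS : ∀ y, S.IsOrthonormal y (X 1 y) (X 2 y))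
    {χ : ℝ} (hχ : χ ≠ 0) (hX : IsLieFrame X (structConst 0 a b)) (hab : a + b = 2 * χ)
    (q : Cotangent I M) :
    poisson I S.hamiltonian
      (fun q ↦ linFun I (X 0) q ^ 2 / (2 * χ) + linFun I (X 2) q ^ 2) q = 0 := by
  have hm (i) := hX.mdifferentiableAt_linFun i q
  have hd (i) := dirDeriv_comp (I := cotModel I) (g := fun x : ℝ ↦ x ^ 2)
    (hasDerivAt_pow 2 _) (hm i)
  have hd' := dirDeriv_comp (I := cotModel I) (g := fun x : ℝ ↦ x ^ 2 / (2 * χ))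
    ((hasDerivAt_pow 2 _).div_const _) (hm 0)
  unfold poisson
  rw [dirDeriv_add, hd, hd', hX.hamVF_hamiltonian S hS, ← ver_apply, ← ver_apply, hX.ver_vec,
    hX.ver_vec, hab]
  · simp only [Matrix.cons_val]
    field_simp
    ring
  · exact ((hasDerivAt_pow 2 _).div_const (2 * χ)).differentiableAt.mdifferentiableAt.comp q (hm 0)
  · exact (hm 2).pow 2

end IsLieFrame

end Hamiltonian

section Extremal

variable {E : Type*} [NormedAddCommGroup E] [NormedSpace ℝ E] [FiniteDimensional ℝ E]
  {H : Type*} [TopologicalSpace H] {I : ModelWithCorners ℝ E H}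
  {M : Type*} [TopologicalSpace M] [ChartedSpace H M]  [IsManifold I ∞ M] [I.Boundaryless]

lemma hasDerivAt_comp_integralCurve {N : Type*} [TopologicalSpace N] [ChartedSpace H N]
    {A : VF I N} {c : ℝ → N} {J : Set ℝ} (hJ : IsOpen J)
    (hc : IsMIntegralCurveOn c A J) {t : ℝ} (ht : t ∈ J) {f : N → ℝ}
    (hf : MDifferentiableAt I 𝓘(ℝ, ℝ) f (c t)) :
    HasDerivAt (fun s ↦ f (c s)) (dirDeriv I f (c t) (A (c t))) t := by
  have h1 := (hc t ht).hasMFDerivAt (hJ.mem_nhds ht)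
  have h2 : HasFDerivAt (fun s ↦ f (c s)) (_ : ℝ →L[ℝ] ℝ) t :=
    (hf.hasMFDerivAt.comp t h1).hasFDerivAt
  refine h2.hasDerivAt.congr_deriv ?_
  refine congrArg (mfderiv I 𝓘(ℝ, ℝ) f (c t)) ?_
  exact one_smul ℝ (A (c t))

namespace IsLieFrame

variable {X : Fin 3 → VF I M} {χ κ : ℝ}

variable (X χ κ) in
/-- The horizontal components of the Lie derivative along an extremal of a field with components
`w`, `v` whose derivatives are `dw`, `dv`. -/
def dotHor (q : Cotangent I M) (dw w v : Fin 3 → ℝ) : Fin 3 → ℝ :=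
  ![dw 0 + linFun I (X 2) q * w 1 - linFun I (X 1) q * w 2,
    dw 1 - v 1 + (χ - κ) * linFun I (X 2) q * w 0,
    dw 2 - v 2 + (χ + κ) * linFun I (X 1) q * w 0]

variable (X χ) in
/-- The vertical components of the Lie derivative along an extremal of a field with vertical
components `v` whose derivatives are `dv`. -/
def dotVer (q : Cotangent I M) (dv v : Fin 3 → ℝ) : Fin 3 → ℝ :=
  ![dv 0 - 2 * χ * (v 1 * linFun I (X 2) q + linFun I (X 1) q * v 2),
    dv 1 - v 0 * linFun I (X 2) q - linFun I (X 0) q * v 2,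
    dv 2 + v 0 * linFun I (X 1) q + linFun I (X 0) q * v 1]

variable (hX : IsLieFrame X (structConst 0 (χ - κ) (χ + κ))) {S : SubRiemStr I M}
  (hS : ∀ y, S.IsOrthonormal y (X 1 y) (X 2 y))

include hX hS

lemma hor_hamVF (q : Cotangent I M) (i : Fin 3) :
    hX.hor i q (hamVF I S.hamiltonian q) = ![0, linFun I (X 1) q, linFun I (X 2) q] i := by
  rw [hX.hamVF_hamiltonian S hS, hX.hor_vec]

lemma ver_hamVF (q : Cotangent I M) (i : Fin 3) :
    ver X i q (hamVF I S.hamiltonian q) = ![2 * χ * (linFun I (X 1) q * linFun I (X 2) q),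
      linFun I (X 0) q * linFun I (X 2) q, - (linFun I (X 0) q * linFun I (X 1) q)] i := by
  rw [hX.hamVF_hamiltonian S hS, hX.ver_vec]
  fin_cases i <;> simp
  left; ring

lemma smoothNear_hamVF (p : Cotangent I M) :
    VF.SmoothNear (cotModel I) (hamVF I S.hamiltonian) p := by
  have hs (i) (q) := hX.contMDiffAt_linFun i q
  have e : hamVF I S.hamiltonian = fun q ↦ hX.vec q ![0, linFun I (X 1) q, linFun I (X 2) q]
      ![2 * χ * (linFun I (X 1) q * linFun I (X 2) q),
      linFun I (X 0) q * linFun I (X 2) q, (-1) * (linFun I (X 0) q * linFun I (X 1) q)] := by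
    ext1 q
    refine hX.ext (fun i ↦ ?_) fun i ↦ ?_
    · rw [hX.hor_hamVF hS, hX.hor_vec]
    · rw [hX.ver_hamVF hS, hX.ver_vec, neg_one_mul]
  rw [e]
  refine hX.smoothNear_vec (fun i ↦ Eventually.of_forall fun q ↦ ?_)
    fun i ↦ Eventually.of_forall fun q ↦ ?_
  · fin_cases i
    · exact contMDiffAt_const
    · exact hs 1 q
    · exact hs 2 q
  · fin_cases i
    · exact contMDiffAt_const.mul ((hs 1 q).mul (hs 2 q))
    · exact (hs 0 q).mul (hs 2 q)
    · exact contMDiffAt_const.mul ((hs 0 q).mul (hs 1 q))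

lemma hor_mlieBracket_hamVF {V : VF (cotModel I) (Cotangent I M)} {p : Cotangent I M}
    (hV : VF.SmoothNear (cotModel I) V p) (i : Fin 3) :
    hX.hor i p (mlieBracket (cotModel I) (hamVF I S.hamiltonian) V p) =
      dotHor X χ κ p (fun i ↦ dirDeriv (cotModel I) (fun q ↦ hX.hor i q (V q)) p
        (hamVF I S.hamiltonian p)) (fun i ↦ hX.hor i p (V p)) (fun i ↦ ver X i p (V p)) i := by
  rw [hX.hor_mlieBracket (hX.smoothNear_hamVF hS p) hV]
  simp only [hX.hor_hamVF hS]
  fin_cases i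
  · simp [Fin.sum_univ_three, structConst, dotHor, dirDeriv_const]
    ring
  · simp [Fin.sum_univ_three, structConst, dotHor, ver_apply]
  · simp [Fin.sum_univ_three, structConst, dotHor, ver_apply]

lemma ver_mlieBracket_hamVF {V : VF (cotModel I) (Cotangent I M)} {p : Cotangent I M}
    (hV : VF.SmoothNear (cotModel I) V p) (i : Fin 3) :
    ver X i p (mlieBracket (cotModel I) (hamVF I S.hamiltonian) V p) =
      dotVer X χ p (fun i ↦ dirDeriv (cotModel I) (fun q ↦ ver X i q (V q)) p
        (hamVF I S.hamiltonian p)) (fun i ↦ ver X i p (V p)) i := by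
  rw [hX.ver_mlieBracket (hX.smoothNear_hamVF hS p) hV]
  have hm (i) := hX.mdifferentiableAt_linFun i p
  have hmm (i j) : MDifferentiableAt (cotModel I) 𝓘(ℝ, ℝ)
    (fun q ↦ linFun I (X i) q * linFun I (X j) q) p := (hm i).mul (hm j)
  simp only [hX.ver_hamVF hS]
  fin_cases i
  · simp [dotVer, dirDeriv_const_mul _ (hmm 1 2), dirDeriv_mul (hm 1) (hm 2), ← ver_apply]
    left; ring
  · simp [dotVer, dirDeriv_mul (hm 0) (hm 2), ← ver_apply]
    ring
  · simp [dotVer, dirDeriv_neg, dirDeriv_mul (hm 0) (hm 1), ← ver_apply]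
    ring

variable {lam : ℝ → Cotangent I M} {J : Set ℝ} (hJ : IsOpen J)
  (hlam : IsMIntegralCurveOn lam (hamVF I S.hamiltonian) J) {t : ℝ} (ht : t ∈ J)

include hJ hlam ht

lemma hasDerivAt_linFun (i : Fin 3) :
    HasDerivAt (fun s ↦ linFun I (X i) (lam s))
      (![2 * χ * (linFun I (X 1) (lam t) * linFun I (X 2) (lam t)),
      linFun I (X 0) (lam t) * linFun I (X 2) (lam t),
      - (linFun I (X 0) (lam t) * linFun I (X 1) (lam t))] i) t := by
  rw [← hX.ver_hamVF hS]
  exact hasDerivAt_comp_integralCurve hJ hlam ht (hX.mdifferentiableAt_linFun i _)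

/-- The components of a Lie derivative along an extremal. -/
lemma exists_hasDerivAt_of_hasLieDerivAlong {Z : (t : ℝ) → TangentSpace (cotModel I) (lam t)}
    {W : TangentSpace (cotModel I) (lam t)}
    (h : HasLieDerivAlong (cotModel I) (hamVF I S.hamiltonian) lam Z t W) :
    ∃ dw dv : Fin 3 → ℝ, (∀ i, HasDerivAt (fun s ↦ hX.hor i (lam s) (Z s)) (dw i) t) ∧
      (∀ i, HasDerivAt (fun s ↦ ver X i (lam s) (Z s)) (dv i) t) ∧
      (∀ i, hX.hor i (lam t) W = dotHor X χ κ (lam t) dw (fun i ↦ hX.hor i (lam t) (Z t))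
        (fun i ↦ ver X i (lam t) (Z t)) i) ∧
      ∀ i, ver X i (lam t) W = dotVer X χ (lam t) dv (fun i ↦ ver X i (lam t) (Z t)) i := by
  obtain ⟨V, hV, hVZ, rfl⟩ := h
  have h0 : V (lam t) = Z t := hVZ.self_of_nhds
  refine ⟨fun i ↦ dirDeriv (cotModel I) (fun q ↦ hX.hor i q (V q)) (lam t)
        (hamVF I S.hamiltonian (lam t)), fun i ↦ dirDeriv (cotModel I) (fun q ↦ ver X i q (V q))
        (lam t) (hamVF I S.hamiltonian (lam t)), fun i ↦ ?_, fun i ↦ ?_, fun i ↦ ?_, fun i ↦ ?_⟩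
  · refine (hasDerivAt_comp_integralCurve hJ hlam ht
      ((hX.contMDiffAt_hor hV i).mdifferentiableAt (by simp))).congr_of_eventuallyEq ?_
    filter_upwards [hVZ] with s hs using by rw [hs]
  · refine (hasDerivAt_comp_integralCurve hJ hlam ht
      ((hX.contMDiffAt_ver hV i).mdifferentiableAt (by simp))).congr_of_eventuallyEq ?_
    filter_upwards [hVZ] with s hs using by rw [hs]
  · rw [hX.hor_mlieBracket_hamVF hS hV, h0]
  · rw [hX.ver_mlieBracket_hamVF hS hV, h0]

/-- The Lie derivative along an extremal of a field given in components. -/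
lemma hasLieDerivAlong_vec {w v : Cotangent I M → Fin 3 → ℝ}
    (hw : ∀ i, ∀ᶠ q in 𝓝 (lam t), ContMDiffAt (cotModel I) 𝓘(ℝ, ℝ) ∞ (fun q ↦ w q i) q)
    (hv : ∀ i, ∀ᶠ q in 𝓝 (lam t), ContMDiffAt (cotModel I) 𝓘(ℝ, ℝ) ∞ (fun q ↦ v q i) q)
    {dw dv : Fin 3 → ℝ} (hdw : ∀ i, HasDerivAt (fun s ↦ w (lam s) i) (dw i) t)
    (hdv : ∀ i, HasDerivAt (fun s ↦ v (lam s) i) (dv i) t)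
    {W : TangentSpace (cotModel I) (lam t)}
    (hor_eq : ∀ i, hX.hor i (lam t) W = dotHor X χ κ (lam t) dw (w (lam t)) (v (lam t)) i)
    (ver_eq : ∀ i, ver X i (lam t) W = dotVer X χ (lam t) dv (v (lam t)) i) :
    HasLieDerivAlong (cotModel I) (hamVF I S.hamiltonian) lam
      (fun s ↦ hX.vec (lam s) (w (lam s)) (v (lam s))) t W := by
  have hV := hX.smoothNear_vec hw hv
  refine ⟨fun q ↦ hX.vec q (w q) (v q), hV, Eventually.of_forall fun _ ↦ rfl,
    hX.ext (fun i ↦ ?_) fun i ↦ ?_⟩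
  · rw [hX.hor_mlieBracket_hamVF hS hV, hor_eq]
    simp only [hX.hor_vec, hX.ver_vec]
    congr 1
    ext i
    exact (hasDerivAt_comp_integralCurve hJ hlam ht
      ((hw i).self_of_nhds.mdifferentiableAt (by simp))).unique (hdw i)
  · rw [hX.ver_mlieBracket_hamVF hS hV, ver_eq]
    simp only [hX.ver_vec]
    congr 1
    ext i
    exact (hasDerivAt_comp_integralCurve hJ hlam ht
      ((hv i).self_of_nhds.mdifferentiableAt (by simp))).unique (hdv i)

end IsLieFrame

end Extremal

section CanonicalFrame

variable {E : Type*} [NormedAddCommGroup E] [NormedSpace ℝ E] [FiniteDimensional ℝ E]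
  {H : Type*} [TopologicalSpace H] {I : ModelWithCorners ℝ E H}
  {M : Type*} [TopologicalSpace M] [ChartedSpace H M]  [IsManifold I ∞ M] [I.Boundaryless]

/-- The function `f` is smooth near `c t`, and its derivative along the curve `c` is `f'`. -/
structure SmoothAlong {N : Type*} [TopologicalSpace N] [ChartedSpace H N]
    (I : ModelWithCorners ℝ E H)
    (c : ℝ → N) (t : ℝ) (f : N → ℝ) (f' : ℝ) : Prop where
  smooth : ∀ᶠ q in 𝓝 (c t), ContMDiffAt I 𝓘(ℝ, ℝ) ∞ f q
  hasDerivAt : HasDerivAt (fun s ↦ f (c s)) f' t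

namespace SmoothAlong

variable {N : Type*} [TopologicalSpace N] [ChartedSpace H N] {c : ℝ → N} {t : ℝ} {f g : N → ℝ}
  {f' g' : ℝ}

lemma const (a : ℝ) : SmoothAlong I c t (fun _ ↦ a) 0 :=
  ⟨Eventually.of_forall fun _ ↦ contMDiffAt_const, hasDerivAt_const _ _⟩

lemma add (hf : SmoothAlong I c t f f') (hg : SmoothAlong I c t g g') :
    SmoothAlong I c t (fun q ↦ f q + g q) (f' + g') :=
  ⟨by filter_upwards [hf.1, hg.1] with q h1 h2 using h1.add h2, hf.2.add hg.2⟩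

lemma sub (hf : SmoothAlong I c t f f') (hg : SmoothAlong I c t g g') :
    SmoothAlong I c t (fun q ↦ f q - g q) (f' - g') :=
  ⟨by filter_upwards [hf.1, hg.1] with q h1 h2 using h1.sub h2, hf.2.sub hg.2⟩

lemma neg (hf : SmoothAlong I c t f f') : SmoothAlong I c t (fun q ↦ - f q) (- f') :=
  ⟨by filter_upwards [hf.1] with q h1 using h1.neg, hf.2.neg⟩

lemma mul (hf : SmoothAlong I c t f f') (hg : SmoothAlong I c t g g') :
    SmoothAlong I c t (fun q ↦ f q * g q) (f' * g (c t) + f (c t) * g') :=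
  ⟨by filter_upwards [hf.1, hg.1] with q h1 h2 using h1.mul h2, hf.2.mul hg.2⟩

end SmoothAlong

namespace IsLieFrame

section Existence

variable (X : Fin 3 → VF I M) (χ κ : ℝ)

/-- Twice the Hamiltonian. -/
def normSq (q : Cotangent I M) : ℝ :=
  linFun I (X 1) q * linFun I (X 1) q + linFun I (X 2) q * linFun I (X 2) q

/-- The normalizing factor of the canonical frame. -/
def normInv (q : Cotangent I M) : ℝ := (√(normSq X q))⁻¹

/-- The Ricci curvature of the first box. -/
def ricOne (q : Cotangent I M) : ℝ :=
  linFun I (X 0) q * linFun I (X 0) q +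
    3 * χ * (linFun I (X 1) q * linFun I (X 1) q - linFun I (X 2) q * linFun I (X 2) q) +
    κ * (linFun I (X 1) q * linFun I (X 1) q + linFun I (X 2) q * linFun I (X 2) q)

/-- The Ricci curvature of the second box. -/
def ricTwo (q : Cotangent I M) : ℝ :=
  6 * χ * (linFun I (X 1) q ^ 2 - linFun I (X 2) q ^ 2) * linFun I (X 0) q ^ 2
    - 2 * χ * (χ + κ) * linFun I (X 1) q ^ 4
    - 12 * χ ^ 2 * linFun I (X 1) q ^ 2 * linFun I (X 2) q ^ 2
    - 2 * χ * (χ - κ) * linFun I (X 2) q ^ 4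

/-- The vertical components of the vertical part of the canonical frame. -/
def frameVerE (q : Cotangent I M) : Fin 3 → Fin 3 → ℝ :=
  ![![0, -(normInv X q * linFun I (X 2) q), normInv X q * linFun I (X 1) q],
    ![normInv X q, 0, 0],
    ![normInv X q * linFun I (X 0) q, normInv X q * linFun I (X 1) q,
      normInv X q * linFun I (X 2) q]]

/-- The horizontal components of the complementary part of the canonical frame. -/
def frameHorF (q : Cotangent I M) : Fin 3 → Fin 3 → ℝ :=
  ![![0, -(normInv X q * linFun I (X 2) q), normInv X q * linFun I (X 1) q],
    ![normInv X q * normSq X q, -(normInv X q * (linFun I (X 0) q * linFun I (X 1) q)),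
      -(normInv X q * (linFun I (X 0) q * linFun I (X 2) q))],
    ![0, normInv X q * linFun I (X 1) q, normInv X q * linFun I (X 2) q]]

/-- The vertical components of the complementary part of the canonical frame. -/
def frameVerF (q : Cotangent I M) : Fin 3 → Fin 3 → ℝ :=
  ![![2 * χ * (normInv X q *
      (linFun I (X 1) q * linFun I (X 1) q - linFun I (X 2) q * linFun I (X 2) q)), 0, 0],
    ![-(8 * χ) * (normInv X q * (linFun I (X 0) q * (linFun I (X 1) q * linFun I (X 2) q))),
      normInv X q * (linFun I (X 2) q * (2 * χ *
        (linFun I (X 1) q * linFun I (X 1) q - linFun I (X 2) q * linFun I (X 2) q)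
          - ricOne X χ κ q)),
      normInv X q * (linFun I (X 1) q * (ricOne X χ κ q - 2 * χ *
        (linFun I (X 1) q * linFun I (X 1) q - linFun I (X 2) q * linFun I (X 2) q)))],
    ![2 * χ * (normInv X q * (linFun I (X 1) q * linFun I (X 2) q)),
      normInv X q * (linFun I (X 0) q * linFun I (X 2) q),
      -(normInv X q * (linFun I (X 0) q * linFun I (X 1) q))]]

variable {X}

lemma normInv_mul_self {q : Cotangent I M} (h : 0 < normSq X q) :
    normInv X q * normInv X q * normSq X q = 1 := by
  have h1 : √(normSq X q) ≠ 0 := (Real.sqrt_pos.2 h).ne'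
  have h2 := Real.mul_self_sqrt h.le
  unfold normInv
  field_simp
  rw [pow_two, h2]

variable {χ κ}
variable (hX : IsLieFrame X (structConst 0 (χ - κ) (χ + κ))) {S : SubRiemStr I M}
  (hS : ∀ y, S.IsOrthonormal y (X 1 y) (X 2 y))

include hX hS in
lemma hamiltonian_eq_normSq (q : Cotangent I M) : S.hamiltonian q = normSq X q / 2 := by
  rw [S.hamiltonian_eq (hS q.1), normSq]; ring

variable {lam : ℝ → Cotangent I M} {J : Set ℝ} (hJ : IsOpen J)
  (hlam : IsMIntegralCurveOn lam (hamVF I S.hamiltonian) J) {t : ℝ} (ht : t ∈ J)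

include hX hS hJ hlam ht

lemma smoothAlong_linFun (i : Fin 3) :
    SmoothAlong (cotModel I) lam t (linFun I (X i))
      (![2 * χ * (linFun I (X 1) (lam t) * linFun I (X 2) (lam t)),
      linFun I (X 0) (lam t) * linFun I (X 2) (lam t),
      - (linFun I (X 0) (lam t) * linFun I (X 1) (lam t))] i) :=
  ⟨Eventually.of_forall fun q ↦ hX.contMDiffAt_linFun i q, hX.hasDerivAt_linFun hS hJ hlam ht i⟩

lemma smoothAlong_normSq : SmoothAlong (cotModel I) lam t (normSq X) 0 := by
  have h1 := hX.smoothAlong_linFun hS hJ hlam ht 1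
  have h2 := hX.smoothAlong_linFun hS hJ hlam ht 2
  convert! (h1.mul h1).add (h2.mul h2) using 1
  simp only [Matrix.cons_val]
  ring

lemma smoothAlong_normInv (hpos : 0 < normSq X (lam t)) :
    SmoothAlong (cotModel I) lam t (normInv X) 0 := by
  obtain ⟨h1, h2⟩ := hX.smoothAlong_normSq hS hJ hlam ht
  have hc : ∀ᶠ q in 𝓝 (lam t), 0 < normSq X q :=
    h1.self_of_nhds.continuousAt.eventually_const_lt hpos
  have hr (x : ℝ) (hx : 0 < x) : ContDiffAt ℝ ∞ (fun x : ℝ ↦ (√x)⁻¹) x :=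
    (Real.contDiffAt_sqrt hx.ne').inv (Real.sqrt_pos.2 hx).ne'
  refine ⟨?_, ?_⟩
  · filter_upwards [h1, hc] with q hq hq'
    exact (hr _ hq').contMDiffAt.comp q hq
  · have := ((hr _ hpos).differentiableAt (by simp)).hasDerivAt.comp t h2
    exact this.congr_deriv (mul_zero _)

lemma hasLieDerivAlong_of_smoothAlong {w₀ w₁ w₂ v₀ v₁ v₂ : Cotangent I M → ℝ}
    {a₀ a₁ a₂ b₀ b₁ b₂ : ℝ} (hw₀ : SmoothAlong (cotModel I) lam t w₀ a₀)
    (hw₁ : SmoothAlong (cotModel I) lam t w₁ a₁) (hw₂ : SmoothAlong (cotModel I) lam t w₂ a₂)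
    (hv₀ : SmoothAlong (cotModel I) lam t v₀ b₀) (hv₁ : SmoothAlong (cotModel I) lam t v₁ b₁)
    (hv₂ : SmoothAlong (cotModel I) lam t v₂ b₂) {W : TangentSpace (cotModel I) (lam t)}
    (hor_eq : ∀ i, hX.hor i (lam t) W = dotHor X χ κ (lam t) ![a₀, a₁, a₂]
      ![w₀ (lam t), w₁ (lam t), w₂ (lam t)] ![v₀ (lam t), v₁ (lam t), v₂ (lam t)] i)
    (ver_eq : ∀ i, ver X i (lam t) W = dotVer X χ (lam t) ![b₀, b₁, b₂]
      ![v₀ (lam t), v₁ (lam t), v₂ (lam t)] i) :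
    HasLieDerivAlong (cotModel I) (hamVF I S.hamiltonian) lam
      (fun s ↦ hX.vec (lam s) ![w₀ (lam s), w₁ (lam s), w₂ (lam s)]
        ![v₀ (lam s), v₁ (lam s), v₂ (lam s)]) t W := by
  refine hX.hasLieDerivAlong_vec hS hJ hlam ht (w := fun q ↦ ![w₀ q, w₁ q, w₂ q])
    (v := fun q ↦ ![v₀ q, v₁ q, v₂ q]) ?_ ?_ ?_ ?_ hor_eq ver_eq
  all_goals intro i; fin_cases i
  exacts [hw₀.1, hw₁.1, hw₂.1, hv₀.1, hv₁.1, hv₂.1, hw₀.2, hw₁.2, hw₂.2, hv₀.2, hv₁.2, hv₂.2]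

end Existence

section ExistenceFrame

variable {X : Fin 3 → VF I M} {χ κ : ℝ}
variable (hX : IsLieFrame X (structConst 0 (χ - κ) (χ + κ))) {S : SubRiemStr I M}
  (hS : ∀ y, S.IsOrthonormal y (X 1 y) (X 2 y))
variable {lam : ℝ → Cotangent I M} {J : Set ℝ} (hJ : IsOpen J)

include hX hS hJ in
/-- Along every nontrivial extremal there is a canonical frame. -/
theorem exists_isCanonicalFrame (hlam : S.IsNontrivialExtremal lam J) :
    ∃ E F R, S.IsCanonicalFrame lam J E F R := by
  have hpos : ∀ t ∈ J, 0 < normSq X (lam t) := fun t ht ↦ by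
    have := hlam.2 t ht
    rw [hX.hamiltonian_eq_normSq hS] at this
    linarith
  have hr t ht := normInv_mul_self (hpos t ht)
  have hl t ht := hX.smoothAlong_linFun hS hJ hlam.1 (t := t) ht
  have hR t ht := hX.smoothAlong_normInv hS hJ hlam.1 (t := t) ht (hpos t ht)
  have hN t ht := hX.smoothAlong_normSq hS hJ hlam.1 (t := t) ht
  have hQ t ht := ((hl t ht 1).mul (hl t ht 1)).sub ((hl t ht 2).mul (hl t ht 2))
  have hP t ht := ((hl t ht 1).mul (hl t ht 1)).add ((hl t ht 2).mul (hl t ht 2))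
  have hc t (a : ℝ) := SmoothAlong.const (I := cotModel I) (c := lam) (t := t) a
  have hRic t ht : SmoothAlong (cotModel I) lam t (ricOne X χ κ) _ :=
    (((hl t ht 0).mul (hl t ht 0)).add ((hc t (3 * χ)).mul (hQ t ht))).add
      ((hc t κ).mul (hP t ht))
  refine ⟨fun i t ↦ hX.vec (lam t) ![0, 0, 0] (frameVerE X (lam t) i),
    fun i t ↦ hX.vec (lam t) (frameHorF X (lam t) i) (frameVerF X χ κ (lam t) i),
    fun t ↦ Matrix.diagonal ![ricOne X χ κ (lam t), ricTwo X χ κ (lam t), 0],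
    ?_, ?_, ?_, ?_, ?_, ?_, ?_, ?_, ?_, ?_, ?_, ?_⟩
  · intro t ht
    refine le_antisymm ?_ fun ξ hξ ↦ ?_
    · rw [Submodule.span_le]
      rintro _ ⟨i, rfl⟩
      refine (hX.projDeriv_eq_zero_iff _ _).2 fun j ↦ ?_
      rw [hX.hor_vec]
      fin_cases j <;> rfl
    · have h0 := (hX.projDeriv_eq_zero_iff _ _).1 hξ
      set v := fun i ↦ ver X i (lam t) ξ with hv
      set r := normInv X (lam t) with hrdef
      set z := r * (linFun I (X 1) (lam t) * v 1 + linFun I (X 2) (lam t) * v 2) with hz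
      have key : ξ = ∑ i, ![r * (linFun I (X 1) (lam t) * v 2 - linFun I (X 2) (lam t) * v 1),
          v 0 * (r * normSq X (lam t)) - z * linFun I (X 0) (lam t), z] i •
            hX.vec (lam t) ![0, 0, 0] (frameVerE X (lam t) i) := by
        have hr' := hr t ht
        rw [← hrdef, normSq] at hr'
        refine hX.ext (fun i ↦ ?_) fun i ↦ ?_
        · rw [h0 i, Fin.sum_univ_three, map_add, map_add]
          simp only [map_smul, hX.hor_vec]
          fin_cases i <;> simp
        · rw [Fin.sum_univ_three, map_add, map_add]
          simp only [map_smul, hX.ver_vec]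
          change v i = _
          fin_cases i <;>
            simp only [frameVerE, ← hrdef, smul_eq_mul, Fin.zero_eta, Fin.mk_one,
              Fin.reduceFinMk, Matrix.cons_val, normSq, hz]
          · linear_combination (-(v 0)) * hr'
          · linear_combination (-(v 1)) * hr'
          · linear_combination (-(v 2)) * hr'
      rw [key]
      exact Submodule.sum_mem _ fun i _ ↦ Submodule.smul_mem _ _
        (Submodule.subset_span (mem_range_self i))
  · intro t ht i j
    simp only [hX.sympl_eq, hX.hor_vec, hX.ver_vec, Matrix.cons_val]
    ring
  · intro t ht i j
    simp only [hX.sympl_eq, hX.hor_vec, hX.ver_vec]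
    fin_cases i <;> fin_cases j <;>
      simp only [frameHorF, frameVerF, normSq, ricOne, Fin.zero_eta, Fin.mk_one,
              Fin.reduceFinMk, Matrix.cons_val] <;> ring
  · intro t ht i j
    have hr' := hr t ht
    rw [normSq] at hr'
    simp only [hX.sympl_eq, hX.hor_vec, hX.ver_vec]
    fin_cases i <;> fin_cases j <;>
      simp only [frameHorF, frameVerE, normSq, Fin.zero_eta, Fin.mk_one,
              Fin.reduceFinMk, Matrix.cons_val, Fin.reduceEq, if_true, if_false] <;>
      first | ring1 | linear_combination hr'
  all_goals intro t ht
  · refine hX.hasLieDerivAlong_of_smoothAlong hS hJ hlam.1 ht (hc t 0) (hc t 0) (hc t 0)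
      (hR t ht) (hc t 0) (hc t 0) (fun i ↦ ?_) fun i ↦ ?_
    all_goals
      simp only [hX.hor_vec, hX.ver_vec, dotHor, dotVer, frameVerE]
      fin_cases i <;> simp only [Fin.zero_eta, Fin.mk_one, Fin.reduceFinMk, Matrix.cons_val] <;>
        ring
  · refine hX.hasLieDerivAlong_of_smoothAlong hS hJ hlam.1 ht (hc t 0) (hc t 0) (hc t 0)
      (hc t 0) ((hR t ht).mul (hl t ht 2)).neg ((hR t ht).mul (hl t ht 1)) (fun i ↦ ?_) fun i ↦ ?_
    all_goals
      simp only [map_neg, hX.hor_vec, hX.ver_vec, dotHor, dotVer, frameHorF, frameVerF]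
      fin_cases i <;> simp only [Fin.zero_eta, Fin.mk_one, Fin.reduceFinMk, Matrix.cons_val] <;>
        ring
  · refine hX.hasLieDerivAlong_of_smoothAlong hS hJ hlam.1 ht (hc t 0) (hc t 0) (hc t 0)
      ((hR t ht).mul (hl t ht 0)) ((hR t ht).mul (hl t ht 1)) ((hR t ht).mul (hl t ht 2))
      (fun i ↦ ?_) fun i ↦ ?_
    all_goals
      simp only [map_neg, hX.hor_vec, hX.ver_vec, dotHor, dotVer, frameHorF, frameVerF]
      fin_cases i <;> simp only [Fin.zero_eta, Fin.mk_one, Fin.reduceFinMk, Matrix.cons_val] <;>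
        ring
  · refine hX.hasLieDerivAlong_of_smoothAlong hS hJ hlam.1 ht (hc t 0)
      ((hR t ht).mul (hl t ht 2)).neg ((hR t ht).mul (hl t ht 1))
      ((hc t (2 * χ)).mul ((hR t ht).mul (hQ t ht))) (hc t 0) (hc t 0) (fun i ↦ ?_) fun i ↦ ?_
    all_goals
      simp only [Fin.sum_univ_three, map_sub, map_add, map_smul, hX.hor_vec, hX.ver_vec, dotHor,
        dotVer, frameVerE, frameHorF, frameVerF, Matrix.diagonal_apply]
      fin_cases i <;> simp only [Fin.zero_eta, Fin.mk_one, Fin.reduceFinMk, Matrix.cons_val,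
        Fin.reduceEq, if_true, if_false, smul_eq_mul, normSq, ricOne] <;>
        ring
  · refine hX.hasLieDerivAlong_of_smoothAlong hS hJ hlam.1 ht ((hR t ht).mul (hN t ht))
      ((hR t ht).mul ((hl t ht 0).mul (hl t ht 1))).neg
      ((hR t ht).mul ((hl t ht 0).mul (hl t ht 2))).neg
      ((hc t (-(8 * χ))).mul ((hR t ht).mul ((hl t ht 0).mul ((hl t ht 1).mul (hl t ht 2)))))
      ((hR t ht).mul ((hl t ht 2).mul (((hc t (2 * χ)).mul (hQ t ht)).sub (hRic t ht))))
      ((hR t ht).mul ((hl t ht 1).mul ((hRic t ht).sub ((hc t (2 * χ)).mul (hQ t ht)))))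
      (fun i ↦ ?_) fun i ↦ ?_
    all_goals
      simp only [Fin.sum_univ_three, map_add, map_smul, hX.hor_vec, hX.ver_vec, dotHor,
        dotVer, frameVerE, Matrix.diagonal_apply]
      fin_cases i <;> simp only [Fin.zero_eta, Fin.mk_one, Fin.reduceFinMk, Matrix.cons_val,
        Fin.reduceEq, if_true, if_false, smul_eq_mul, normSq, ricOne, ricTwo] <;>
        ring
  · refine hX.hasLieDerivAlong_of_smoothAlong hS hJ hlam.1 ht (hc t 0)
      ((hR t ht).mul (hl t ht 1)) ((hR t ht).mul (hl t ht 2))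
      ((hc t (2 * χ)).mul ((hR t ht).mul ((hl t ht 1).mul (hl t ht 2))))
      ((hR t ht).mul ((hl t ht 0).mul (hl t ht 2)))
      ((hR t ht).mul ((hl t ht 0).mul (hl t ht 1))).neg (fun i ↦ ?_) fun i ↦ ?_
    all_goals
      simp only [Fin.sum_univ_three, map_add, map_smul, hX.hor_vec, hX.ver_vec, dotHor,
        dotVer, frameVerE, Matrix.diagonal_apply]
      fin_cases i <;> simp only [Fin.zero_eta, Fin.mk_one, Fin.reduceFinMk, Matrix.cons_val,
        Fin.reduceEq, if_true, if_false, smul_eq_mul] <;>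
        ring
  · exact Matrix.isSymm_diagonal _
  · simp

end ExistenceFrame

end IsLieFrame

end CanonicalFrame

section Uniqueness

variable {E : Type*} [NormedAddCommGroup E] [NormedSpace ℝ E] [FiniteDimensional ℝ E]
  {H : Type*} [TopologicalSpace H] {I : ModelWithCorners ℝ E H}
  {M : Type*} [TopologicalSpace M] [ChartedSpace H M]  [IsManifold I ∞ M] [I.Boundaryless]

namespace IsLieFrame

variable {X : Fin 3 → VF I M} {χ κ : ℝ}
variable (hX : IsLieFrame X (structConst 0 (χ - κ) (χ + κ))) {S : SubRiemStr I M}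
  (hS : ∀ y, S.IsOrthonormal y (X 1 y) (X 2 y))
variable {lam : ℝ → Cotangent I M} {J : Set ℝ} (hJ : IsOpen J)

/-- The canonical symplectic form in an adapted frame. -/
lemma sympl_eq_of_adapted (q : Cotangent I M) (ξ η : TangentSpace (cotModel I) q) :
    sympl I q ξ η =
      ver X 0 q ξ * hX.hor 0 q η + ver X 1 q ξ * hX.hor 1 q η + ver X 2 q ξ * hX.hor 2 q η
      - (ver X 0 q η * hX.hor 0 q ξ + ver X 1 q η * hX.hor 1 q ξ + ver X 2 q η * hX.hor 2 q ξ)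
      - ((hX.hor 1 q ξ * hX.hor 0 q η - hX.hor 0 q ξ * hX.hor 1 q η) *
            ((χ + κ) * linFun I (X 2) q)
        + (hX.hor 2 q ξ * hX.hor 0 q η - hX.hor 0 q ξ * hX.hor 2 q η) *
            ((χ - κ) * linFun I (X 1) q)
        + (hX.hor 2 q ξ * hX.hor 1 q η - hX.hor 1 q ξ * hX.hor 2 q η) * linFun I (X 0) q) := by
  rw [hX.sympl_eq]
  ring

include hX in
lemma sympl_sub_right (q : Cotangent I M) (ξ η ζ : TangentSpace (cotModel I) q) :
    sympl I q ξ (η - ζ) = sympl I q ξ η - sympl I q ξ ζ := by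
  simp only [hX.sympl_eq, map_sub]; ring

include hX in
lemma sympl_sub_left (q : Cotangent I M) (ξ η ζ : TangentSpace (cotModel I) q) :
    sympl I q (ξ - η) ζ = sympl I q ξ ζ - sympl I q η ζ := by
  simp only [hX.sympl_eq, map_sub]; ring

include hX in
lemma sympl_sum_smul_left {q : Cotangent I M} (a : Fin 3 → ℝ)
    (ξ : Fin 3 → TangentSpace (cotModel I) q) (η : TangentSpace (cotModel I) q) :
    sympl I q (∑ i, a i • ξ i) η = ∑ i, a i * sympl I q (ξ i) η := by
  simp only [hX.sympl_eq, Fin.sum_univ_three, map_add, map_smul, smul_eq_mul]; ring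

include hX in
lemma sympl_sum_smul_right {q : Cotangent I M} (a : Fin 3 → ℝ)
    (ξ : Fin 3 → TangentSpace (cotModel I) q) (η : TangentSpace (cotModel I) q) :
    sympl I q η (∑ i, a i • ξ i) = ∑ i, a i * sympl I q η (ξ i) := by
  simp only [hX.sympl_eq, Fin.sum_univ_three, map_add, map_smul, smul_eq_mul]; ring

include hS hJ

/-- The components of the derivative of a field whose components are known. -/
lemma hasDot_components (hlam : IsMIntegralCurveOn lam (hamVF I S.hamiltonian) J)
    {Z W : (t : ℝ) → TangentSpace (cotModel I) (lam t)} (h : S.HasDot lam J Z W)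
    {w v : Fin 3 → ℝ → ℝ} (hw : ∀ s ∈ J, ∀ i, hX.hor i (lam s) (Z s) = w i s)
    (hv : ∀ s ∈ J, ∀ i, ver X i (lam s) (Z s) = v i s) {t : ℝ} (ht : t ∈ J) {dw dv : Fin 3 → ℝ}
    (hdw : ∀ i, HasDerivAt (w i) (dw i) t) (hdv : ∀ i, HasDerivAt (v i) (dv i) t) :
    (∀ i, hX.hor i (lam t) (W t) = dotHor X χ κ (lam t) dw (fun i ↦ w i t) (fun i ↦ v i t) i) ∧
      ∀ i, ver X i (lam t) (W t) = dotVer X χ (lam t) dv (fun i ↦ v i t) i := by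
  obtain ⟨dw', dv', hdw', hdv', h1, h2⟩ :=
    hX.exists_hasDerivAt_of_hasLieDerivAlong hS hJ hlam ht (h t ht)
  have e1 : dw' = dw := funext fun i ↦ (hdw' i).unique ((hdw i).congr_of_eventuallyEq
    (by filter_upwards [hJ.mem_nhds ht] with s hs using hw s hs i))
  have e2 : dv' = dv := funext fun i ↦ (hdv' i).unique ((hdv i).congr_of_eventuallyEq
    (by filter_upwards [hJ.mem_nhds ht] with s hs using hv s hs i))
  subst e1 e2
  simp only [hw t ht, hv t ht] at h1 h2
  exact ⟨h1, h2⟩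

variable {F G : Fin 3 → (t : ℝ) → TangentSpace (cotModel I) (lam t)}
    {R : ℝ → Matrix (Fin 3) (Fin 3) ℝ}

omit hS hJ in
lemma hor_eq_zero_of_isCanonicalFrame (h : S.IsCanonicalFrame lam J F G R) {t : ℝ} (ht : t ∈ J)
    (j i : Fin 3) : hX.hor i (lam t) (F j t) = 0 :=
  (hX.projDeriv_eq_zero_iff _ _).1
    ((h.vertical t ht).le (Submodule.subset_span (mem_range_self j))) i

omit hS hJ in
/-- The derivative of a function `f` with `f² N = 1`, where `N` is constant, vanishes. -/
lemma _root_.HasDerivAt.eq_zero_of_sq_mul_eq_one {f N : ℝ → ℝ} {J : Set ℝ} (hJ : IsOpen J)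
    (h : ∀ s ∈ J, f s ^ 2 * N s = 1) {t f' : ℝ} (ht : t ∈ J) (hf : HasDerivAt f f' t)
    (hN : HasDerivAt N 0 t) : f' = 0 := by
  have h1 := ((hf.pow 2).mul hN).unique
    ((hasDerivAt_const t (1 : ℝ)).congr_of_eventuallyEq
      (by filter_upwards [hJ.mem_nhds ht] with s hs using h s hs))
  have h2 := h t ht
  have h3 : f t ≠ 0 := fun h0 ↦ by simp [h0] at h2
  have h4 : N t ≠ 0 := fun h0 ↦ by simp [h0] at h2
  simpa [h3, h4] using h1

/-- The part of a canonical frame associated with the first row, in components. -/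
lemma exists_firstRow (hlam : S.IsNontrivialExtremal lam J) (h : S.IsCanonicalFrame lam J F G R) :
    ∃ f : ℝ → ℝ, (∀ t ∈ J, HasDerivAt f 0 t) ∧ (∀ t ∈ J, f t ^ 2 * normSq X (lam t) = 1) ∧
      (∀ t ∈ J, ∀ i, ver X i (lam t) (F 1 t) = ![f t, 0, 0] i) ∧
      (∀ t ∈ J, ∀ i, ver X i (lam t) (F 0 t) =
        ![0, -(f t * linFun I (X 2) (lam t)), f t * linFun I (X 1) (lam t)] i) ∧
      (∀ t ∈ J, ∀ i, hX.hor i (lam t) (G 0 t) =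
        ![0, -(f t * linFun I (X 2) (lam t)), f t * linFun I (X 1) (lam t)] i) ∧
      (∀ t ∈ J, ∀ i, ver X i (lam t) (G 0 t) = ![2 * χ * f t *
        (linFun I (X 1) (lam t) ^ 2 - linFun I (X 2) (lam t) ^ 2), 0, 0] i) := by
  have hz := fun t ht ↦ hX.hor_eq_zero_of_isCanonicalFrame h (t := t) ht
  have hl := fun t ht ↦ hX.hasDerivAt_linFun hS hJ hlam.1 (t := t) ht
  have hN := fun t ht ↦ (hX.smoothAlong_normSq hS hJ hlam.1 (t := t) ht).2
  have hzero : ∀ {t} (_ : t ∈ J) {dw : Fin 3 → ℝ} {j : Fin 3},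
      (∀ i, HasDerivAt (fun s ↦ hX.hor i (lam s) (F j s)) (dw i) t) → dw = 0 := by
    intro t ht dw j hdw
    exact funext fun i ↦ (hdw i).unique ((hasDerivAt_const t (0 : ℝ)).congr_of_eventuallyEq
      (by filter_upwards [hJ.mem_nhds ht] with s hs using hz s hs j i))
  -- the second box
  have h1 : ∀ t ∈ J, ver X 1 (lam t) (F 1 t) = 0 ∧ ver X 2 (lam t) (F 1 t) = 0 := by
    intro t ht
    obtain ⟨dw, dv, hdw, hdv, e1, e2⟩ :=
      hX.exists_hasDerivAt_of_hasLieDerivAlong hS hJ hlam.1 ht (h.dot_E12 t ht)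
    obtain rfl := hzero ht hdw
    have a1 := e1 1
    have a2 := e1 2
    simp [dotHor, hz t ht] at a1 a2
    exact ⟨a1, a2⟩
  obtain ⟨f, hf⟩ : ∃ f : ℝ → ℝ, ∀ t, ver X 0 (lam t) (F 1 t) = f t := ⟨_, fun _ ↦ rfl⟩
  have hv1 : ∀ t ∈ J, ∀ i, ver X i (lam t) (F 1 t) = ![f t, 0, 0] i := by
    intro t ht i
    fin_cases i
    exacts [hf t, (h1 t ht).1, (h1 t ht).2]
  -- the first box
  have h2 : ∀ t ∈ J, HasDerivAt f (ver X 0 (lam t) (F 0 t)) t ∧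
      ver X 1 (lam t) (F 0 t) = -(f t * linFun I (X 2) (lam t)) ∧
      ver X 2 (lam t) (F 0 t) = f t * linFun I (X 1) (lam t) := by
    intro t ht
    obtain ⟨dw, dv, hdw, hdv, e1, e2⟩ :=
      hX.exists_hasDerivAt_of_hasLieDerivAlong hS hJ hlam.1 ht (h.dot_E12 t ht)
    have b (i) (hi : i ≠ 0) : dv i = 0 := (hdv i).unique
      ((hasDerivAt_const t (0 : ℝ)).congr_of_eventuallyEq (by
        filter_upwards [hJ.mem_nhds ht] with s hs
        rw [hv1 s hs]; fin_cases i <;> simp at hi ⊢))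
    have a0 := e2 0
    have a1 := e2 1
    have a2 := e2 2
    simp [dotVer, hv1 t ht, b] at a0 a1 a2
    have d0 := hdv 0
    simp only [hf] at d0
    exact ⟨a0 ▸ d0, a1, a2⟩
  have h3 : ∀ t ∈ J, hX.hor 0 (lam t) (G 0 t) = 0 ∧
      hX.hor 1 (lam t) (G 0 t) = -(f t * linFun I (X 2) (lam t)) ∧
      hX.hor 2 (lam t) (G 0 t) = f t * linFun I (X 1) (lam t) := by
    intro t ht
    obtain ⟨dw, dv, hdw, hdv, e1, e2⟩ :=
      hX.exists_hasDerivAt_of_hasLieDerivAlong hS hJ hlam.1 ht (h.dot_E11 t ht)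
    obtain rfl := hzero ht hdw
    have a0 := e1 0
    have a1 := e1 1
    have a2 := e1 2
    simp [dotHor, hz t ht, h2 t ht] at a0 a1 a2
    exact ⟨a0, by linarith, by linarith⟩
  have hfN : ∀ t ∈ J, f t ^ 2 * normSq X (lam t) = 1 := by
    intro t ht
    have := h.darboux_EF t ht 0 0
    rw [hX.sympl_eq_of_adapted] at this
    simp [hz t ht, h2 t ht, h3 t ht] at this
    rw [normSq]
    linear_combination this
  have h4 : ∀ t ∈ J, ver X 0 (lam t) (F 0 t) = 0 := fun t ht ↦
    (h2 t ht).1.eq_zero_of_sq_mul_eq_one hJ hfN ht (hN t ht)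
  have hf' : ∀ t ∈ J, HasDerivAt f 0 t := fun t ht ↦ h4 t ht ▸ (h2 t ht).1
  have hv0 : ∀ t ∈ J, ∀ i, ver X i (lam t) (F 0 t) =
        ![0, -(f t * linFun I (X 2) (lam t)), f t * linFun I (X 1) (lam t)] i := by
    intro t ht i
    fin_cases i
    exacts [h4 t ht, (h2 t ht).2.1, (h2 t ht).2.2]
  refine ⟨f, hf', hfN, hv1, hv0, fun t ht i ↦ ?_, fun t ht i ↦ ?_⟩
  · fin_cases i
    exacts [(h3 t ht).1, (h3 t ht).2.1, (h3 t ht).2.2]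
  · have e := (hX.hasDot_components hS hJ hlam.1 h.dot_E11 (w := fun i s ↦ 0)
      (v := ![fun s ↦ 0, fun s ↦ -(f s * linFun I (X 2) (lam s)),
        fun s ↦ f s * linFun I (X 1) (lam s)]) (fun s hs i ↦ hz s hs 0 i)
        (fun s hs i ↦ by rw [hv0 s hs]; fin_cases i <;> rfl) ht (dw := 0) (dv := ![0, _, _])
        (fun i ↦ hasDerivAt_const _ _) (by
          intro i
          fin_cases i
          · exact hasDerivAt_const _ _
          · exact ((hf' t ht).mul (hl t ht 2)).neg
          · exact (hf' t ht).mul (hl t ht 1))).2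
    have a0 := e 0
    have a1 := e 1
    have a2 := e 2
    simp [dotVer] at a0 a1 a2
    fin_cases i
    · simp; linarith
    · simp; linarith
    · simp; linarith

end IsLieFrame

end Uniqueness

section Curvature

variable {E : Type*} [NormedAddCommGroup E] [NormedSpace ℝ E] [FiniteDimensional ℝ E]
  {H : Type*} [TopologicalSpace H] {I : ModelWithCorners ℝ E H}
  {M : Type*} [TopologicalSpace M] [ChartedSpace H M]  [IsManifold I ∞ M] [I.Boundaryless]

namespace IsLieFrame

variable {X : Fin 3 → VF I M} {χ κ : ℝ}
variable (hX : IsLieFrame X (structConst 0 (χ - κ) (χ + κ))) {S : SubRiemStr I M}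
  (hS : ∀ y, S.IsOrthonormal y (X 1 y) (X 2 y))
variable {lam : ℝ → Cotangent I M} {J : Set ℝ} (hJ : IsOpen J)
variable {F G : Fin 3 → (t : ℝ) → TangentSpace (cotModel I) (lam t)}
    {R : ℝ → Matrix (Fin 3) (Fin 3) ℝ}

include hX hS hJ

/-- The Ricci curvatures of a canonical frame. -/
theorem ricci_of_isCanonicalFrame (hlam : S.IsNontrivialExtremal lam J)
    (h : S.IsCanonicalFrame lam J F G R) {t : ℝ} (ht : t ∈ J) :
    R t 0 0 = ricOne X χ κ (lam t) ∧ R t 1 1 = ricTwo X χ κ (lam t) := by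
  have hz := fun t ht ↦ hX.hor_eq_zero_of_isCanonicalFrame h (t := t) ht
  have hl := fun t ht ↦ hX.hasDerivAt_linFun hS hJ hlam.1 (t := t) ht
  have hN := fun t ht ↦ (hX.smoothAlong_normSq hS hJ hlam.1 (t := t) ht).2
  obtain ⟨f, hf', hfN, hF1, hF0, hG0h, hG0v⟩ := hX.exists_firstRow hS hJ hlam h
  obtain ⟨h₀, e₀⟩ : ∃ g : ℝ → ℝ, ∀ s, linFun I (X 0) (lam s) = g s := ⟨_, fun _ ↦ rfl⟩
  obtain ⟨h₁, e₁⟩ : ∃ g : ℝ → ℝ, ∀ s, linFun I (X 1) (lam s) = g s := ⟨_, fun _ ↦ rfl⟩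
  obtain ⟨h₂, e₂⟩ : ∃ g : ℝ → ℝ, ∀ s, linFun I (X 2) (lam s) = g s := ⟨_, fun _ ↦ rfl⟩
  have d₀ : ∀ t ∈ J, HasDerivAt h₀ (2 * χ * (h₁ t * h₂ t)) t := fun t ht ↦ by
    simpa [e₀, e₁, e₂] using hl t ht 0
  have d₁ : ∀ t ∈ J, HasDerivAt h₁ (h₀ t * h₂ t) t := fun t ht ↦ by
    simpa [e₀, e₁, e₂] using hl t ht 1
  have d₂ : ∀ t ∈ J, HasDerivAt h₂ (-(h₀ t * h₁ t)) t := fun t ht ↦ by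
    simpa [e₀, e₁, e₂] using hl t ht 2
  simp only [normSq, ricOne, ricTwo, e₀, e₁, e₂] at hfN hF1 hF0 hG0h hG0v hN ⊢
  -- the derivative of the first complementary field
  set D : (t : ℝ) → TangentSpace (cotModel I) (lam t) :=
    fun t ↦ (∑ j, R t 0 j • F j t) - G 1 t with hD
  have hDc : ∀ t ∈ J, (∀ i, hX.hor i (lam t) (D t) = ![-(f t * (h₁ t * h₁ t + h₂ t * h₂ t)),
        f t * (h₀ t * h₁ t), f t * (h₀ t * h₂ t)] i) ∧
      ∀ i, ver X i (lam t) (D t) = ![8 * χ * f t * (h₀ t * h₁ t * h₂ t),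
        -(2 * χ * f t * (h₁ t ^ 2 - h₂ t ^ 2) * h₂ t),
        2 * χ * f t * (h₁ t ^ 2 - h₂ t ^ 2) * h₁ t] i := by
    intro t ht
    obtain ⟨a, b⟩ := hX.hasDot_components hS hJ hlam.1 h.dot_F11 (ht := ht)
      (w := ![fun _ ↦ 0, fun s ↦ -(f s * h₂ s), fun s ↦ f s * h₁ s])
      (v := ![fun s ↦ 2 * χ * f s * (h₁ s ^ 2 - h₂ s ^ 2), fun _ ↦ 0, fun _ ↦ 0])
      (fun s hs i ↦ by rw [hG0h s hs]; fin_cases i <;> rfl)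
      (fun s hs i ↦ by rw [hG0v s hs]; fin_cases i <;> rfl) (dw := ![0, _, _]) (dv := ![_, 0, 0])
      (by
        intro i
        fin_cases i
        · exact hasDerivAt_const _ _
        · exact ((hf' t ht).mul (d₂ t ht)).neg
        · exact (hf' t ht).mul (d₁ t ht))
      (by
        intro i
        fin_cases i
        · exact ((hf' t ht).const_mul (2 * χ)).mul (((d₁ t ht).pow 2).sub ((d₂ t ht).pow 2))
        · exact hasDerivAt_const _ _
        · exact hasDerivAt_const _ _)
    refine ⟨fun i ↦ (a i).trans ?_, fun i ↦ (b i).trans ?_⟩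
    all_goals
      simp only [dotHor, dotVer, e₀, e₁, e₂]
      fin_cases i <;> simp <;> ring
  have hG1 : ∀ t, G 1 t = (∑ j, R t 0 j • F j t) - D t := fun t ↦ (sub_sub_cancel _ _).symm
  have hnz : ∀ t ∈ J, h₁ t * h₁ t + h₂ t * h₂ t ≠ 0 := fun t ht h0 ↦ by
    have := hfN t ht
    simp [h0] at this
  have hfz : ∀ t ∈ J, f t ≠ 0 := fun t ht h0 ↦ by
    have := hfN t ht
    simp [h0] at this
  -- the first box
  have hR0 : ∀ t ∈ J, R t 0 0 = h₀ t * h₀ t + 3 * χ * (h₁ t * h₁ t - h₂ t * h₂ t) +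
      κ * (h₁ t * h₁ t + h₂ t * h₂ t) := by
    intro t ht
    have e : sympl I (lam t) (D t) (G 0 t) = R t 0 0 := by
      rw [hD, hX.sympl_sub_left, hX.sympl_sum_smul_left, h.darboux_FF t ht]
      simp [h.darboux_EF t ht]
    rw [← e, hX.sympl_eq_of_adapted]
    simp only [(hDc t ht).1, (hDc t ht).2, hG0h t ht, hG0v t ht, e₀, e₁, e₂, Matrix.cons_val]
    linear_combination (h₀ t * h₀ t + 3 * χ * (h₁ t * h₁ t - h₂ t * h₂ t) +
      κ * (h₁ t * h₁ t + h₂ t * h₂ t)) * hfN t ht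
  have hR01 : ∀ t ∈ J, R t 0 1 = 0 := h.normal
  -- the second row
  obtain ⟨k, hk⟩ : ∃ k : ℝ → ℝ, ∀ t, k t = (ver X 1 (lam t) (F 2 t) * h₁ t +
      ver X 2 (lam t) (F 2 t) * h₂ t) / (h₁ t * h₁ t + h₂ t * h₂ t) := ⟨_, fun _ ↦ rfl⟩
  have hF2 : ∀ t ∈ J, ∀ i, ver X i (lam t) (F 2 t) = ![k t * h₀ t, k t * h₁ t, k t * h₂ t] i := by
    intro t ht i
    have a1 := h.darboux_EF t ht 2 0
    have a2 := h.darboux_EF t ht 2 1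
    rw [hG1, hX.sympl_sub_right, hX.sympl_sum_smul_right] at a2
    simp only [h.darboux_EE t ht, mul_zero, Finset.sum_const_zero, hX.sympl_eq_of_adapted,
      (hDc t ht).1, hG0h t ht, hz t ht, e₀, e₁, e₂, Matrix.cons_val, Fin.reduceEq, if_false]
      at a1 a2
    have b1 : ver X 2 (lam t) (F 2 t) * h₁ t = ver X 1 (lam t) (F 2 t) * h₂ t := by
      refine mul_left_cancel₀ (hfz t ht) ?_
      linear_combination a1
    have b2 : ver X 0 (lam t) (F 2 t) * (h₁ t * h₁ t + h₂ t * h₂ t) =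
        h₀ t * (ver X 1 (lam t) (F 2 t) * h₁ t + ver X 2 (lam t) (F 2 t) * h₂ t) := by
      refine mul_left_cancel₀ (hfz t ht) ?_
      linear_combination a2
    have hn := hnz t ht
    fin_cases i
    · simp only [hk, Fin.zero_eta, Matrix.cons_val]
      rw [div_mul_eq_mul_div, eq_div_iff hn]
      linear_combination b2
    · simp only [hk, Fin.mk_one, Matrix.cons_val]
      rw [div_mul_eq_mul_div, eq_div_iff hn]
      linear_combination (-h₂ t) * b1
    · simp only [hk, Fin.reduceFinMk, Matrix.cons_val]
      rw [div_mul_eq_mul_div, eq_div_iff hn]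
      linear_combination (h₁ t) * b1
  have hG2h : ∀ t ∈ J, ∀ i, hX.hor i (lam t) (G 2 t) = ![0, k t * h₁ t, k t * h₂ t] i := by
    intro t ht i
    obtain ⟨dw, dv, hdw, hdv, e1, -⟩ :=
      hX.exists_hasDerivAt_of_hasLieDerivAlong hS hJ hlam.1 ht (h.dot_E21 t ht)
    have hdw0 (i) : dw i = 0 := (hdw i).unique
      ((hasDerivAt_const t (0 : ℝ)).congr_of_eventuallyEq
        (by filter_upwards [hJ.mem_nhds ht] with s hs using hz s hs 2 i))
    have := e1 i
    simp only [map_neg, dotHor, hdw0, hz t ht, hF2 t ht] at this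
    fin_cases i <;> simp at this ⊢ <;> linarith
  have hk' : ∀ t ∈ J, HasDerivAt k 0 t := by
    intro t ht
    obtain ⟨dw, dv, hdw, hdv, -, -⟩ :=
      hX.exists_hasDerivAt_of_hasLieDerivAlong hS hJ hlam.1 ht (h.dot_E21 t ht)
    have hkd : DifferentiableAt ℝ k t := by
      rw [funext hk]
      exact (((hdv 1).differentiableAt.mul (d₁ t ht).differentiableAt).add
        ((hdv 2).differentiableAt.mul (d₂ t ht).differentiableAt)).div
        (((d₁ t ht).differentiableAt.mul (d₁ t ht).differentiableAt).add
        ((d₂ t ht).differentiableAt.mul (d₂ t ht).differentiableAt)) (hnz t ht)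
    have hkN : ∀ s ∈ J, k s ^ 2 * (h₁ s * h₁ s + h₂ s * h₂ s) = 1 := by
      intro s hs
      have := h.darboux_EF s hs 2 2
      simp only [hX.sympl_eq_of_adapted, hG2h s hs, hz s hs, hF2 s hs, Matrix.cons_val,
        if_true] at this
      linear_combination this
    have := hkd.hasDerivAt.eq_zero_of_sq_mul_eq_one hJ hkN ht (hN t ht)
    exact this ▸ hkd.hasDerivAt
  have hG2v : ∀ t ∈ J, ∀ i, ver X i (lam t) (G 2 t) = ![2 * χ * k t * (h₁ t * h₂ t),
      k t * (h₀ t * h₂ t), -(k t * (h₀ t * h₁ t))] i := by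
    intro t ht i
    have e := (hX.hasDot_components hS hJ hlam.1 h.dot_E21 (ht := ht) (w := fun i s ↦ 0)
      (v := ![fun s ↦ k s * h₀ s, fun s ↦ k s * h₁ s, fun s ↦ k s * h₂ s])
      (fun s hs i ↦ hz s hs 2 i) (fun s hs i ↦ by rw [hF2 s hs]; fin_cases i <;> rfl)
      (dw := 0) (dv := ![_, _, _]) (fun i ↦ hasDerivAt_const _ _) (by
          intro i
          fin_cases i
          · exact (hk' t ht).mul (d₀ t ht)
          · exact (hk' t ht).mul (d₁ t ht)
          · exact (hk' t ht).mul (d₂ t ht))).2 i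
    simp only [map_neg, dotVer, e₀, e₁, e₂] at e
    fin_cases i <;> simp at e ⊢ <;> linarith
  have hR02 : ∀ t ∈ J, R t 0 2 = 0 := by
    intro t ht
    have e : sympl I (lam t) (D t) (G 2 t) = R t 0 2 := by
      rw [hD, hX.sympl_sub_left, hX.sympl_sum_smul_left, h.darboux_FF t ht]
      simp [h.darboux_EF t ht]
    rw [← e, hX.sympl_eq_of_adapted]
    simp only [(hDc t ht).1, (hDc t ht).2, hG2h t ht, hG2v t ht, e₀, e₁, e₂, Matrix.cons_val]
    ring
  -- the second box
  have hG1' : ∀ t ∈ J, G 1 t = R t 0 0 • F 0 t - D t := fun t ht ↦ by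
    rw [hG1, Fin.sum_univ_three, hR01 t ht, hR02 t ht]; simp
  have hG1h : ∀ t ∈ J, ∀ i, hX.hor i (lam t) (G 1 t) = ![f t * (h₁ t * h₁ t + h₂ t * h₂ t),
        -(f t * (h₀ t * h₁ t)), -(f t * (h₀ t * h₂ t))] i := by
    intro t ht i
    rw [hG1' t ht, map_sub, map_smul, hz t ht, (hDc t ht).1]
    fin_cases i <;> simp
  have hG1v : ∀ t ∈ J, ∀ i, ver X i (lam t) (G 1 t) = ![-(8 * χ) * f t * (h₀ t * h₁ t * h₂ t),
      f t * (h₂ t * (2 * χ * (h₁ t ^ 2 - h₂ t ^ 2) - (h₀ t * h₀ t +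
        3 * χ * (h₁ t * h₁ t - h₂ t * h₂ t) + κ * (h₁ t * h₁ t + h₂ t * h₂ t)))),
      f t * (h₁ t * (h₀ t * h₀ t + 3 * χ * (h₁ t * h₁ t - h₂ t * h₂ t) +
        κ * (h₁ t * h₁ t + h₂ t * h₂ t) - 2 * χ * (h₁ t ^ 2 - h₂ t ^ 2)))] i := by
    intro t ht i
    rw [hG1' t ht, map_sub, map_smul, hF0 t ht, (hDc t ht).2, hR0 t ht]
    fin_cases i <;> simp <;> ring
  refine ⟨hR0 t ht, ?_⟩
  have e : sympl I (lam t) (∑ j, R t 1 j • F j t) (G 1 t) = R t 1 1 := by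
    rw [hX.sympl_sum_smul_left]
    simp [h.darboux_EF t ht]
  have dQ := ((d₁ t ht).pow 2).sub ((d₂ t ht).pow 2)
  have dP := ((d₁ t ht).mul (d₁ t ht)).add ((d₂ t ht).mul (d₂ t ht))
  have dRic := (((d₀ t ht).mul (d₀ t ht)).add ((((d₁ t ht).mul (d₁ t ht)).sub
    ((d₂ t ht).mul (d₂ t ht))).const_mul (3 * χ))).add (dP.const_mul κ)
  obtain ⟨a, b⟩ := hX.hasDot_components hS hJ hlam.1 h.dot_F12 (ht := ht)
    (w := ![fun s ↦ f s * (h₁ s * h₁ s + h₂ s * h₂ s), fun s ↦ -(f s * (h₀ s * h₁ s)),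
      fun s ↦ -(f s * (h₀ s * h₂ s))])
    (v := ![fun s ↦ -(8 * χ) * f s * (h₀ s * h₁ s * h₂ s),
      fun s ↦ f s * (h₂ s * (2 * χ * (h₁ s ^ 2 - h₂ s ^ 2) - (h₀ s * h₀ s +
        3 * χ * (h₁ s * h₁ s - h₂ s * h₂ s) + κ * (h₁ s * h₁ s + h₂ s * h₂ s)))),
      fun s ↦ f s * (h₁ s * (h₀ s * h₀ s + 3 * χ * (h₁ s * h₁ s - h₂ s * h₂ s) +
        κ * (h₁ s * h₁ s + h₂ s * h₂ s) - 2 * χ * (h₁ s ^ 2 - h₂ s ^ 2)))])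
    (fun s hs i ↦ by rw [hG1h s hs]; fin_cases i <;> rfl)
    (fun s hs i ↦ by rw [hG1v s hs]; fin_cases i <;> rfl) (dw := ![_, _, _]) (dv := ![_, _, _])
    (by
      intro i
      fin_cases i
      · exact (hf' t ht).mul dP
      · exact ((hf' t ht).mul ((d₀ t ht).mul (d₁ t ht))).neg
      · exact ((hf' t ht).mul ((d₀ t ht).mul (d₂ t ht))).neg)
    (by
      intro i
      fin_cases i
      · exact ((hf' t ht).const_mul (-(8 * χ))).mul (((d₀ t ht).mul (d₁ t ht)).mul (d₂ t ht))
      · exact (hf' t ht).mul ((d₂ t ht).mul ((dQ.const_mul (2 * χ)).sub dRic))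
      · exact (hf' t ht).mul ((d₁ t ht).mul (dRic.sub (dQ.const_mul (2 * χ)))))
  have a' : ∀ i, hX.hor i (lam t) (∑ j, R t 1 j • F j t) = 0 := by
    intro i
    rw [map_sum]
    simp [hz t ht]
  have b0 := b 0
  have b1 := b 1
  have b2 := b 2
  simp only [dotVer, e₀, e₁, e₂, Matrix.cons_val] at b0 b1 b2
  rw [← e, hX.sympl_eq_of_adapted, a', a', a', b0, b1, b2, hG1h t ht, hG1h t ht, hG1h t ht]
  simp only [Matrix.cons_val, Nat.cast_ofNat, Nat.add_one_sub_one, pow_one, Pi.mul_apply]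
  linear_combination (6 * χ * (h₁ t ^ 2 - h₂ t ^ 2) * h₀ t ^ 2
    - 2 * χ * (χ + κ) * h₁ t ^ 4 - 12 * χ ^ 2 * h₁ t ^ 2 * h₂ t ^ 2
    - 2 * χ * (χ - κ) * h₂ t ^ 4) * hfN t ht

end IsLieFrame

end Curvature

section LieGroup

variable {E : Type*} [NormedAddCommGroup E] [NormedSpace ℝ E]
  {H : Type*} [TopologicalSpace H] {I : ModelWithCorners ℝ E H}
  {G : Type*} [TopologicalSpace G] [ChartedSpace H G] [Group G] [LieGroup I ∞ G]

instance : LieGroup I (minSmoothness ℝ 3) G :=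
  LieGroup.of_le (n := ∞)
    (minSmoothness_of_isRCLikeNormedField (𝕜 := ℝ) ▸ WithTop.coe_le_coe.2 le_top)

lemma contMDiff_mfderiv_mul {a b : G → TangentBundle I G} (ha : ContMDiff I I.tangent ∞ a)
    (hb : ContMDiff I I.tangent ∞ b) :
    ContMDiff I I.tangent ∞ (fun g ↦ (⟨(a g).1 * (b g).1,
      mfderiv I I (fun h ↦ h * (b g).1) (a g).1 (a g).2 +
        mfderiv I I (fun h ↦ (a g).1 * h) (b g).1 (b g).2⟩ : TangentBundle I G)) := by
  let F₂ : (TangentBundle I G × TangentBundle I G) → TangentBundle (I.prod I) (G × G) :=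
    (equivTangentBundleProd I G I G).symm
  have S₂ : ContMDiff (I.tangent.prod I.tangent) (I.prod I).tangent ∞ F₂ :=
    contMDiff_equivTangentBundleProd_symm
  have S₃ : ContMDiff (I.prod I).tangent I.tangent ∞
      (tangentMap (I.prod I) I (fun (p : G × G) ↦ p.1 * p.2)) :=
    ContMDiff.contMDiff_tangentMap (contMDiff_mul I ∞) (m := ∞) (by simp)
  refine ((S₃.comp S₂).comp (ha.prodMk hb)).congr fun g ↦ ?_
  have h := mfderiv_prod_eq_add_apply (p := ((a g).1, (b g).1))
    (v := Prod.mk (α := E) (β := E) (a g).2 (b g).2)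
    ((contMDiff_mul I ∞).mdifferentiable (by simp) ((a g).1, (b g).1))
  exact congrArg (fun v ↦ (⟨(a g).1 * (b g).1, v⟩ : TangentBundle I G)) h.symm

/-- The right-invariant vector field with a given value at the identity. -/
def mulRightInvariantVectorField (v : TangentSpace I (1 : G)) (g : G) : TangentSpace I g :=
  mfderiv I I (fun h ↦ h * g) (1 : G) v

omit [Group G] [LieGroup I ∞ G] in
lemma TangentBundle.mk_congr {x y : G} (h : x = y) (v : E) :
   (⟨x, v⟩ : TangentBundle I G) = ⟨y, v⟩ := by subst h; rfl

lemma smooth_mulInvariantVectorField (v : TangentSpace I (1 : G)) :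
    ContMDiff I I.tangent ∞
      (fun g ↦ (⟨g, mulInvariantVectorField v g⟩ : TangentBundle I G)) := by
  have h := contMDiff_mfderiv_mul (I := I) (G := G) (a := fun g ↦ ⟨g, 0⟩) (b := fun _ ↦ ⟨1, v⟩)
    (contMDiff_zeroSection _ _) contMDiff_const
  refine h.congr fun g ↦ ?_
  have h1 : mfderiv I I (fun h ↦ h * (1 : G)) g 0 + mfderiv I I (fun h ↦ g * h) (1 : G) v =
     (mulInvariantVectorField v g : E) := by
    refine Eq.trans (congrArg (· + _) (map_zero _)) (zero_add _)
  exact (TangentBundle.mk_congr (mul_one g).symm _).trans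
    (congrArg (fun v : E ↦ (⟨g * 1, v⟩ : TangentBundle I G)) h1.symm)

lemma smooth_mulRightInvariantVectorField (v : TangentSpace I (1 : G)) :
    ContMDiff I I.tangent ∞
      (fun g ↦ (⟨g, mulRightInvariantVectorField v g⟩ : TangentBundle I G)) := by
  have h := contMDiff_mfderiv_mul (I := I) (G := G) (b := fun g ↦ ⟨g, 0⟩) (a := fun _ ↦ ⟨1, v⟩)
     contMDiff_const (contMDiff_zeroSection _ _)
  refine h.congr fun g ↦ ?_
  have h1 : mfderiv I I (fun h ↦ h * g) (1 : G) v + mfderiv I I (fun h ↦ (1 : G) * h) g 0 =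
     (mulRightInvariantVectorField v g : E) := by
    refine Eq.trans (congrArg (_ + ·) (map_zero _)) (add_zero _)
  exact (TangentBundle.mk_congr (one_mul g).symm _).trans
    (congrArg (fun v : E ↦ (⟨1 * g, v⟩ : TangentBundle I G)) h1.symm)

/-- Left-invariant fields are invariant under left translations. -/
lemma dLeft_mulInvariantVectorField (v : TangentSpace I (1 : G)) (x y : G) :
    dLeft I x y (mulInvariantVectorField v y) = mulInvariantVectorField v (x * y) := by
  have h1 : MDifferentiableAt I I (fun z ↦ x * z) (y * 1) :=
    contMDiff_mul_left.mdifferentiableAt (n := ∞) (by simp)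
  have h2 : MDifferentiableAt I I (fun z ↦ y * z) (1 : G) :=
    contMDiff_mul_left.mdifferentiableAt (n := ∞) (by simp)
  have h3 := mfderiv_comp (I' := I) (1 : G) h1 h2
  have h4 : (fun z ↦ x * z) ∘ (fun z ↦ y * z) = fun z ↦ x * y * z := by
    ext z; simp [mul_assoc]
  rw [h4] at h3
  have h5 := congrArg (fun L ↦ L v) h3
  refine Eq.trans ?_ h5.symm
  change mfderiv I I (fun z ↦ x * z) y (mfderiv I I (fun z ↦ y * z) (1 : G) v) =
    mfderiv I I (fun z ↦ x * z) (y * 1) (mfderiv I I (fun z ↦ y * z) (1 : G) v)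
  rw [mul_one]

/-- Right-invariant fields are invariant under right translations. -/
lemma mfderiv_mulRightInvariantVectorField (v : TangentSpace I (1 : G)) (x y : G) :
    mfderiv I I (fun z ↦ z * x) y (mulRightInvariantVectorField v y) =
      mulRightInvariantVectorField v (y * x) := by
  have h1 : MDifferentiableAt I I (fun z ↦ z * x) (1 * y) :=
    contMDiff_mul_right.mdifferentiableAt (n := ∞) (by simp)
  have h2 : MDifferentiableAt I I (fun z ↦ z * y) (1 : G) :=
    contMDiff_mul_right.mdifferentiableAt (n := ∞) (by simp)
  have h3 := mfderiv_comp (I' := I) (1 : G) h1 h2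
  have h4 : (fun z ↦ z * x) ∘ (fun z ↦ z * y) = fun z ↦ z * (y * x) := by
    ext z; simp [mul_assoc]
  rw [h4] at h3
  have h5 := congrArg (fun L ↦ L v) h3
  refine Eq.trans ?_ h5.symm
  change mfderiv I I (fun z ↦ z * x) y (mfderiv I I (fun z ↦ z * y) (1 : G) v) =
    mfderiv I I (fun z ↦ z * x) (1 * y) (mfderiv I I (fun z ↦ z * y) (1 : G) v)
  rw [one_mul]

lemma mulInvariantVectorField_one (v : TangentSpace I (1 : G)) :
    mulInvariantVectorField v (1 : G) = v := by
  have h : (fun z : G ↦ (1 : G) * z) = id := by ext z; simp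
  unfold mulInvariantVectorField
  rw [h, mfderiv_id]
  rfl

lemma mulRightInvariantVectorField_one (v : TangentSpace I (1 : G)) :
    mulRightInvariantVectorField v (1 : G) = v := by
  have h : (fun z : G ↦ z * (1 : G)) = id := by ext z; simp
  unfold mulRightInvariantVectorField
  rw [h, mfderiv_id]
  rfl

lemma dirDeriv_comp_mul_left {f : G → ℝ} {g : G} (hf : MDifferentiableAt I 𝓘(ℝ, ℝ) f g)
    (v : TangentSpace I (1 : G)) :
    dirDeriv I (fun h ↦ f (g * h)) 1 v = dirDeriv I f g (mulInvariantVectorField v g) := by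
  have hf' : MDifferentiableAt I 𝓘(ℝ, ℝ) f (g * 1) := by rwa [mul_one]
  have h2 : MDifferentiableAt I I (fun z ↦ g * z) (1 : G) :=
    contMDiff_mul_left.mdifferentiableAt (n := ∞) (by simp)
  have h3 := congrArg (fun L ↦ L v) (mfderiv_comp (I' := I) (1 : G) hf' h2)
  refine Eq.trans h3 ?_
  change mfderiv I 𝓘(ℝ, ℝ) f (g * 1) (mfderiv I I (fun z ↦ g * z) (1 : G) v) =
    mfderiv I 𝓘(ℝ, ℝ) f g (mfderiv I I (fun z ↦ g * z) (1 : G) v)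
  rw [mul_one]

lemma dirDeriv_comp_mul_right {f : G → ℝ} {g : G} (hf : MDifferentiableAt I 𝓘(ℝ, ℝ) f g)
    (v : TangentSpace I (1 : G)) :
    dirDeriv I (fun h ↦ f (h * g)) 1 v = dirDeriv I f g (mulRightInvariantVectorField v g) := by
  have hf' : MDifferentiableAt I 𝓘(ℝ, ℝ) f (1 * g) := by rwa [one_mul]
  have h2 : MDifferentiableAt I I (fun z ↦ z * g) (1 : G) :=
    contMDiff_mul_right.mdifferentiableAt (n := ∞) (by simp)
  have h3 := congrArg (fun L ↦ L v) (mfderiv_comp (I' := I) (1 : G) hf' h2)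
  refine Eq.trans h3 ?_
  change mfderiv I 𝓘(ℝ, ℝ) f (1 * g) (mfderiv I I (fun z ↦ z * g) (1 : G) v) =
    mfderiv I 𝓘(ℝ, ℝ) f g (mfderiv I I (fun z ↦ z * g) (1 : G) v)
  rw [one_mul]

variable [I.Boundaryless]

lemma smoothNear_mulInvariantVectorField (v : TangentSpace I (1 : G)) (x : G) :
    VF.SmoothNear I (mulInvariantVectorField v) x :=
  VF.smoothNear_iff.2 (Eventually.of_forall fun y ↦ smooth_mulInvariantVectorField v y)

lemma smoothNear_mulRightInvariantVectorField (v : TangentSpace I (1 : G)) (x : G) :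
    VF.SmoothNear I (mulRightInvariantVectorField v) x :=
  VF.smoothNear_iff.2 (Eventually.of_forall fun y ↦ smooth_mulRightInvariantVectorField v y)

omit [I.Boundaryless] in
lemma mulInvariantVectorField_injective (x : G) :
    Function.Injective fun v : TangentSpace I (1 : G) ↦ mulInvariantVectorField v x := by
  intro v w h
  have h1 := congrArg (dLeft I x⁻¹ x) h
  simp only [dLeft_mulInvariantVectorField] at h1
  have key : ∀ y : G, y = 1 → ∀ v w : TangentSpace I (1 : G),
      mulInvariantVectorField v y = mulInvariantVectorField w y → v = w := by
    rintro _ rfl v w h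
    rwa [mulInvariantVectorField_one, mulInvariantVectorField_one] at h
  exact key _ (inv_mul_cancel x) v w h1

/-- A smooth curve through the identity with a given velocity. -/
lemma exists_curve (v : TangentSpace I (1 : G)) :
    ∃ γ : ℝ → G, γ 0 = 1 ∧ ContMDiffAt 𝓘(ℝ, ℝ) I ∞ γ 0 ∧
      ∀ f : G → ℝ, MDifferentiableAt I 𝓘(ℝ, ℝ) f 1 →
        HasDerivAt (fun s ↦ f (γ s)) (dirDeriv I f 1 v) 0 := by
  set φ := extChartAt I (1 : G)
  set w : E := mfderiv I 𝓘(ℝ, E) φ 1 v with hw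
  have hline : HasDerivAt (fun s : ℝ ↦ φ 1 + s • w) w 0 := by
    simpa using ((hasDerivAt_id (0 : ℝ)).smul_const w).const_add (φ 1)
  have h0 : φ.symm (φ 1 + (0 : ℝ) • w) = 1 := by
    rw [zero_smul, add_zero]; exact extChartAt_to_inv 1
  refine ⟨fun s ↦ φ.symm (φ 1 + s • w), h0, ?_, fun f hf ↦ ?_⟩
  · have h1 : ContMDiffAt 𝓘(ℝ, E) I ∞ φ.symm (φ 1) := by
      have := contMDiffWithinAt_extChartAt_symm_range (I := I) (n := ∞) (1 : G)
        (mem_extChartAt_target (1 : G))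
      rwa [I.range_eq_univ, contMDiffWithinAt_univ] at this
    have h2 : ContMDiffAt 𝓘(ℝ, ℝ) 𝓘(ℝ, E) ∞ (fun s : ℝ ↦ φ 1 + s • w) 0 :=
      (ContDiffAt.add contDiffAt_const (contDiffAt_id.smul contDiffAt_const)).contMDiffAt
    refine ContMDiffAt.comp (0 : ℝ) (g := φ.symm) ?_ h2
    simpa using h1
  · have h1 := dirDeriv_eq_fderiv_inChart_self (V := mulInvariantVectorField v) hf
    rw [VF.inChart_self, mulInvariantVectorField_one] at h1
    have h2 : DifferentiableAt ℝ (f ∘ φ.symm) (φ 1) := by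
      have h3 := MDifferentiableWithinAt.differentiableWithinAt_comp_extChartAt_symm
        (mdifferentiableWithinAt_univ.2 hf)
      rwa [preimage_univ, univ_inter, I.range_eq_univ, differentiableWithinAt_univ] at h3
    have h3 : HasFDerivAt (f ∘ φ.symm) (fderiv ℝ (f ∘ φ.symm) (φ 1)) (φ 1 + (0 : ℝ) • w) := by
      simpa using h2.hasFDerivAt
    exact (h3.comp_hasDerivAt (0 : ℝ) hline).congr_deriv h1.symm

/-- Left-invariant and right-invariant fields commute. -/
lemma dirDeriv_mulInvariant_comm {f : G → ℝ} (hf : ContMDiffAt I 𝓘(ℝ, ℝ) ∞ f 1)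
    (v w : TangentSpace I (1 : G)) :
    dirDeriv I (fun y ↦ dirDeriv I f y (mulRightInvariantVectorField w y)) 1 v =
      dirDeriv I (fun y ↦ dirDeriv I f y (mulInvariantVectorField v y)) 1 w := by
  obtain ⟨γ, hγ0, hγ, hγf⟩ := exists_curve v
  obtain ⟨δ, hδ0, hδ, hδf⟩ := exists_curve w
  let F : ℝ × ℝ → ℝ := fun p ↦ f (δ p.1 * γ p.2)
  have hF : ContDiffAt ℝ 2 F (0, 0) := by
    have h1 : ContMDiffAt 𝓘(ℝ, ℝ × ℝ) I ∞ (fun p : ℝ × ℝ ↦ δ p.1 * γ p.2) (0, 0) :=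
      (hδ.comp (0, 0) contDiff_fst.contMDiff.contMDiffAt).mul
        (hγ.comp (0, 0) contDiff_snd.contMDiff.contMDiffAt)
    have h2 : ContMDiffAt I 𝓘(ℝ, ℝ) ∞ f (δ (0, 0).1 * γ (0, 0).2) := by
      simpa [hγ0, hδ0] using hf
    exact (contMDiffAt_iff_contDiffAt.1 (h2.comp (0, 0) h1)).of_le (WithTop.coe_le_coe.2 le_top)
  have hFd : ∀ᶠ p in 𝓝 ((0, 0) : ℝ × ℝ), DifferentiableAt ℝ F p := by
    filter_upwards [(hF.of_le (by norm_num : (1 : WithTop ℕ∞) ≤ 2)).eventually (by simp)] with p hp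
    exact hp.differentiableAt (by simp)
  have hfd : ∀ᶠ y in 𝓝 (1 : G), MDifferentiableAt I 𝓘(ℝ, ℝ) f y :=
    eventually_mdifferentiableAt_of_contMDiffAt (hf.of_le (WithTop.coe_le_coe.2 le_top))
  have hD : DifferentiableAt ℝ (fderiv ℝ F) (0, 0) :=
    (hF.fderiv_right (m := 1) (by norm_num)).differentiableAt (by simp)
  have hsymm := hF.isSymmSndFDerivAt (by simp) (1, 0) (0, 1)
  have e1 : (fun t : ℝ ↦ fderiv ℝ F (0, t) (1, 0)) =ᶠ[𝓝 0]
      fun t ↦ dirDeriv I f (γ t) (mulRightInvariantVectorField w (γ t)) := by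
    have c1 : Tendsto (fun t : ℝ ↦ ((0 : ℝ), t)) (𝓝 0) (𝓝 (0, 0)) :=
      (Continuous.prodMk_right (0 : ℝ)).tendsto 0
    have c2 : Tendsto γ (𝓝 0) (𝓝 1) := hγ0 ▸ hγ.continuousAt
    filter_upwards [c1.eventually hFd, c2.eventually hfd] with t ht ht'
    have hline : HasDerivAt (fun s : ℝ ↦ (s, t)) (1, 0) 0 :=
      (hasDerivAt_id (0 : ℝ)).prodMk (hasDerivAt_const _ _)
    have a1 := ht.hasFDerivAt.comp_hasDerivAt (0 : ℝ) hline
    have hc : MDifferentiableAt I 𝓘(ℝ, ℝ) (fun h ↦ f (h * γ t)) 1 :=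
      MDifferentiableAt.comp (I' := I) (1 : G) (g := f) (by rwa [one_mul])
        (contMDiff_mul_right.mdifferentiableAt (n := ∞) (by simp))
    have a2 := hδf _ hc
    rw [dirDeriv_comp_mul_right ht'] at a2
    exact a1.unique a2
  have e2 : (fun s : ℝ ↦ fderiv ℝ F (s, 0) (0, 1)) =ᶠ[𝓝 0]
      fun s ↦ dirDeriv I f (δ s) (mulInvariantVectorField v (δ s)) := by
    have c1 : Tendsto (fun s : ℝ ↦ (s, (0 : ℝ))) (𝓝 0) (𝓝 (0, 0)) :=
      (Continuous.prodMk_left (0 : ℝ)).tendsto 0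
    have c2 : Tendsto δ (𝓝 0) (𝓝 1) := hδ0 ▸ hδ.continuousAt
    filter_upwards [c1.eventually hFd, c2.eventually hfd] with t ht ht'
    have hline : HasDerivAt (fun s : ℝ ↦ (t, s)) (0, 1) 0 :=
      (hasDerivAt_const _ _).prodMk (hasDerivAt_id (0 : ℝ))
    have a1 := ht.hasFDerivAt.comp_hasDerivAt (0 : ℝ) hline
    have hc : MDifferentiableAt I 𝓘(ℝ, ℝ) (fun h ↦ f (δ t * h)) 1 :=
      MDifferentiableAt.comp (I' := I) (1 : G) (g := f) (by rwa [mul_one])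
        (contMDiff_mul_left.mdifferentiableAt (n := ∞) (by simp))
    have a2 := hγf _ hc
    rw [dirDeriv_comp_mul_left ht'] at a2
    exact a1.unique a2
  have d1 := hγf _ ((contMDiffAt_dirDeriv (smooth_mulRightInvariantVectorField w 1)
    hf).mdifferentiableAt (by simp))
  have d2 := hδf _ ((contMDiffAt_dirDeriv (smooth_mulInvariantVectorField v 1)
    hf).mdifferentiableAt (by simp))
  have l1 : HasDerivAt (fun t : ℝ ↦ ((0 : ℝ), t)) (0, 1) 0 :=
    (hasDerivAt_const _ _).prodMk (hasDerivAt_id (0 : ℝ))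
  have l2 : HasDerivAt (fun s : ℝ ↦ (s, (0 : ℝ))) (1, 0) 0 :=
    (hasDerivAt_id (0 : ℝ)).prodMk (hasDerivAt_const _ _)
  have b1 := (HasFDerivAt.comp_hasDerivAt (f := fun t : ℝ ↦ ((0 : ℝ), t))
    (0 : ℝ) hD.hasFDerivAt l1).clm_apply
    (hasDerivAt_const (0 : ℝ) ((1, 0) : ℝ × ℝ))
  have b2 := (HasFDerivAt.comp_hasDerivAt (f := fun t : ℝ ↦ (t, (0 : ℝ)))
    (0 : ℝ) hD.hasFDerivAt l2).clm_apply
    (hasDerivAt_const (0 : ℝ) ((0, 1) : ℝ × ℝ))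
  have r1 := (b1.congr_of_eventuallyEq e1.symm).unique d1
  have r2 := (b2.congr_of_eventuallyEq e2.symm).unique d2
  rw [← r1, ← r2]
  simpa using hsymm.symm

end LieGroup

section Unimodular

variable {E : Type*} [NormedAddCommGroup E] [NormedSpace ℝ E] [FiniteDimensional ℝ E]
  {H : Type*} [TopologicalSpace H] {I : ModelWithCorners ℝ E H} [I.Boundaryless]
  {G : Type*} [TopologicalSpace G] [ChartedSpace H G] [Group G] [LieGroup I ∞ G]
  [T2Space G] [MeasurableSpace G] [BorelSpace G]

/-- The integral of the derivative of a function along a field whose local flow preserves the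
measure vanishes. -/
lemma integral_dirDeriv_eq_zero {μ : Measure G} [IsFiniteMeasureOnCompacts μ] {A : VF I G}
    (hA : ∀ x, VF.SmoothNear I A x) {Φ : ℝ → G → G} {ε : ℝ} (hε : 0 < ε) (hΦ0 : ∀ g, Φ 0 g = g)
    (hcont : ∀ s, Continuous (Φ s)) (hμ : ∀ s, ∀ f : G → ℝ, ∫ g, f (Φ s g) ∂μ = ∫ g, f g ∂μ)
    (hcurve : ∀ g, IsMIntegralCurveOn (fun s ↦ Φ s g) A (Metric.ball 0 ε))
    (hcpt : ∀ K : Set G, IsCompact K → ∃ K', IsCompact K' ∧ ∀ s ∈ Metric.ball (0 : ℝ) ε, ∀ g,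
      Φ s g ∈ K → g ∈ K')
    {f : G → ℝ} (hf : ContMDiff I 𝓘(ℝ, ℝ) ∞ f) (hfc : HasCompactSupport f) :
    ∫ g, dirDeriv I f g (A g) ∂μ = 0 := by
  set h : G → ℝ := fun g ↦ dirDeriv I f g (A g) with hh
  have hc : Continuous h := continuous_iff_continuousAt.2 fun x ↦
    (contMDiffAt_dirDeriv (hA x).contMDiffAt (hf x)).continuousAt
  have hsupp : ∀ g, g ∉ tsupport f → h g = 0 := fun g hg ↦ by
    have h1 : f =ᶠ[𝓝 g] fun _ ↦ 0 := notMem_tsupport_iff_eventuallyEq.1 hg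
    rw [hh]
    exact (dirDeriv_congr h1 _).trans (dirDeriv_const 0 g _)
  obtain ⟨C, hC⟩ := hfc.isCompact.exists_bound_of_continuousOn hc.continuousOn
  obtain ⟨K', hK', hK⟩ := hcpt _ hfc.isCompact
  have hbound : ∀ s ∈ Metric.ball (0 : ℝ) ε, ∀ g, ‖h (Φ s g)‖ ≤ K'.indicator (fun _ ↦ |C|) g := by
    intro s hs g
    by_cases hg : Φ s g ∈ tsupport f
    · rw [indicator_of_mem (hK s hs g hg)]
      exact (hC _ hg).trans (le_abs_self C)
    · rw [hsupp _ hg, norm_zero]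
      by_cases hg' : g ∈ K'
      · rw [indicator_of_mem hg']
        exact abs_nonneg C
      · rw [indicator_of_notMem hg']
  have key := hasDerivAt_integral_of_dominated_loc_of_deriv_le (μ := μ)
    (F := fun s g ↦ f (Φ s g)) (F' := fun s g ↦ h (Φ s g)) (x₀ := (0 : ℝ))
    (bound := K'.indicator fun _ ↦ |C|) (s := Metric.ball 0 ε) (Metric.ball_mem_nhds _ hε)
    (Eventually.of_forall fun s ↦ (hf.continuous.comp (hcont s)).aestronglyMeasurable)
    (by simpa only [hΦ0] using hf.continuous.integrable_of_hasCompactSupport hfc)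
    (hc.comp (hcont 0)).aestronglyMeasurable
    (Eventually.of_forall fun g s hs ↦ hbound s hs g)
    ((integrableOn_const hK'.measure_lt_top.ne).integrable_indicator hK'.measurableSet)
    (Eventually.of_forall fun g s hs ↦ hasDerivAt_comp_integralCurve Metric.isOpen_ball
      (hcurve g) hs (hf.mdifferentiableAt (by simp)))
  have h1 := key.2
  simp only [hμ, hΦ0] at h1
  exact h1.unique (hasDerivAt_const _ _)

/-- A local integral curve through the identity with relatively compact image. -/
lemma exists_integralCurve {A : VF I G} (hA : VF.SmoothNear I A 1) :
    ∃ γ : ℝ → G, ∃ ε > 0, γ 0 = 1 ∧ IsMIntegralCurveOn γ A (Metric.ball 0 ε) ∧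
      ∃ K, IsCompact K ∧ ∀ s ∈ Metric.ball (0 : ℝ) ε, γ s ∈ K := by
  have : IsManifold I 1 G := IsManifold.of_le (n := ∞) (WithTop.coe_le_coe.2 le_top)
  obtain ⟨γ, h0, hγ⟩ := exists_isMIntegralCurveAt_of_contMDiffAt_boundaryless (t₀ := 0)
    (hA.contMDiffAt.of_le (WithTop.coe_le_coe.2 le_top))
  obtain ⟨ε, hε, hγ⟩ := isMIntegralCurveAt_iff'.1 hγ
  refine ⟨γ, ε / 2, half_pos hε, h0, hγ.mono (Metric.ball_subset_ball (by linarith)),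
    γ '' Metric.closedBall 0 (ε / 2), (isCompact_closedBall _ _).image_of_continuousOn ?_,
    fun s hs ↦ mem_image_of_mem _ (Metric.ball_subset_closedBall hs)⟩
  exact hγ.continuousOn.mono (Metric.closedBall_subset_ball (by linarith))

variable {μ : Measure G} [μ.IsHaarMeasure]

open scoped Pointwise in
lemma integral_mulRightInvariantVectorField (v : TangentSpace I (1 : G)) {f : G → ℝ}
    (hf : ContMDiff I 𝓘(ℝ, ℝ) ∞ f) (hfc : HasCompactSupport f) :
    ∫ g, dirDeriv I f g (mulRightInvariantVectorField v g) ∂μ = 0 := by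
  have : IsTopologicalGroup G := topologicalGroup_of_lieGroup I ∞
  obtain ⟨γ, ε, hε, h0, hγ, K₀, hK₀, hγK⟩ :=
    exists_integralCurve (smoothNear_mulRightInvariantVectorField v 1)
  refine integral_dirDeriv_eq_zero (Φ := fun s g ↦ γ s * g)
    (smoothNear_mulRightInvariantVectorField v) hε (by simp [h0])
    (fun s ↦ continuous_const.mul continuous_id) (fun s f ↦ integral_mul_left_eq_self f _)
    (fun g s hs ↦ ?_) (fun K hK ↦ ⟨K₀⁻¹ * K, hK₀.inv.mul hK, fun s hs g hg ↦
      ⟨(γ s)⁻¹, inv_mem_inv.2 (hγK s hs), _, hg, by simp⟩⟩) hf hfc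
  have h1 : MDifferentiableAt I I (fun z ↦ z * g) (γ s) :=
    contMDiff_mul_right.mdifferentiableAt (n := ∞) (by simp)
  have h2 := h1.hasMFDerivAt.comp_hasMFDerivWithinAt s (hγ s hs)
  refine h2.congr_mfderiv ?_
  refine ContinuousLinearMap.ext_ring ?_
  have h3 := mfderiv_mulRightInvariantVectorField v g (γ s)
  change mfderiv I I (fun z ↦ z * g) (γ s) ((1 : ℝ) • mulRightInvariantVectorField v (γ s)) =
    (1 : ℝ) • mulRightInvariantVectorField v (γ s * g)
  rw [one_smul, one_smul]
  exact h3

variable [μ.IsMulRightInvariant]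

open scoped Pointwise in
lemma integral_mulInvariantVectorField (v : TangentSpace I (1 : G)) {f : G → ℝ}
    (hf : ContMDiff I 𝓘(ℝ, ℝ) ∞ f) (hfc : HasCompactSupport f) :
    ∫ g, dirDeriv I f g (mulInvariantVectorField v g) ∂μ = 0 := by
  have : IsTopologicalGroup G := topologicalGroup_of_lieGroup I ∞
  obtain ⟨γ, ε, hε, h0, hγ, K₀, hK₀, hγK⟩ :=
    exists_integralCurve (smoothNear_mulInvariantVectorField v 1)
  refine integral_dirDeriv_eq_zero (Φ := fun s g ↦ g * γ s)
    (smoothNear_mulInvariantVectorField v) hε (by simp [h0])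
    (fun s ↦ continuous_id.mul continuous_const) (fun s f ↦ integral_mul_right_eq_self f _)
    (fun g s hs ↦ ?_) (fun K hK ↦ ⟨K * K₀⁻¹, hK.mul hK₀.inv, fun s hs g hg ↦
      ⟨_, hg, (γ s)⁻¹, inv_mem_inv.2 (hγK s hs), by simp⟩⟩) hf hfc
  have h1 : MDifferentiableAt I I (fun z ↦ g * z) (γ s) :=
    contMDiff_mul_left.mdifferentiableAt (n := ∞) (by simp)
  have h2 := h1.hasMFDerivAt.comp_hasMFDerivWithinAt s (hγ s hs)
  refine h2.congr_mfderiv ?_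
  refine ContinuousLinearMap.ext_ring ?_
  have h3 := dLeft_mulInvariantVectorField v g (γ s)
  change mfderiv I I (fun z ↦ g * z) (γ s) ((1 : ℝ) • mulInvariantVectorField v (γ s)) =
    (1 : ℝ) • mulInvariantVectorField v (g * γ s)
  rw [one_smul, one_smul]
  exact h3

end Unimodular

section Trace

variable {E : Type*} [NormedAddCommGroup E] [NormedSpace ℝ E] [FiniteDimensional ℝ E]
  {H : Type*} [TopologicalSpace H] {I : ModelWithCorners ℝ E H} [I.Boundaryless]
  {G : Type*} [TopologicalSpace G] [ChartedSpace H G] [Group G] [LieGroup I ∞ G]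
  {ι : Type*} [Fintype ι] [DecidableEq ι] {X : ι → VF I G} {c : ι → ι → ι → ℝ}

namespace IsLieFrame

/-- The derivative at the identity of the matrix expressing right-invariant fields by
left-invariant ones. -/
lemma dirDeriv_coord_mulRightInvariant (hX : IsLieFrame X c)
    (hinv : ∀ i, X i = mulInvariantVectorField (X i 1)) (i j k : ι) :
    dirDeriv I (fun g ↦ hX.coord k g (mulRightInvariantVectorField (X i 1) g)) 1 (X j 1) =
      - c j i k := by
  set A : ι → G → ℝ := fun k g ↦ hX.coord k g (mulRightInvariantVectorField (X i 1) g)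
  have hA (k) (g) : ContMDiffAt I 𝓘(ℝ, ℝ) ∞ (A k) g :=
    hX.contMDiffAt_coord_apply (smooth_mulRightInvariantVectorField _ g) k
  have hA1 (k) : A k 1 = if i = k then 1 else 0 := by
    simp only [A, mulRightInvariantVectorField_one, hX.coord_frame]
  have key : ∑ k, (dirDeriv I (A k) 1 (X j 1) + c j i k) • X k 1 = 0 := by
    refine eq_of_dirDeriv_eq fun f hf ↦ ?_
    have h1 := dirDeriv_mulInvariant_comm hf.self_of_nhds (X j 1) (X i 1)
    rw [← hinv] at h1
    have h2 : (fun y ↦ dirDeriv I f y (mulRightInvariantVectorField (X i 1) y)) =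
        fun y ↦ ∑ k, A k y * dirDeriv I f y (X k y) := by
      ext y
      conv_lhs => rw [← hX.sum_coord y (mulRightInvariantVectorField (X i 1) y)]
      rw [dirDeriv_sum_vec]
      exact Finset.sum_congr rfl fun k _ ↦ dirDeriv_smul_vec _ _ _ _
    have h3 (k) : MDifferentiableAt I 𝓘(ℝ, ℝ) (fun y ↦ dirDeriv I f y (X k y)) 1 :=
      (contMDiffAt_dirDeriv (hX.smooth k 1).contMDiffAt hf.self_of_nhds).mdifferentiableAt (by simp)
    have h4 (k) : MDifferentiableAt I 𝓘(ℝ, ℝ) (A k) 1 := (hA k 1).mdifferentiableAt (by simp)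
    have h5 (k) : MDifferentiableAt I 𝓘(ℝ, ℝ) (fun y ↦ A k y * dirDeriv I f y (X k y)) 1 :=
      (h4 k).mul (h3 k)
    rw [h2, dirDeriv_sum _ fun k _ ↦ h5 k] at h1
    have h6 := (hX.smooth j 1).dirDeriv_mlieBracket (hX.smooth i 1) hf.self_of_nhds
    rw [hX.bracket, dirDeriv_sum_vec] at h6
    simp only [dirDeriv_mul (h4 _) (h3 _), hA1, Finset.sum_add_distrib, ite_mul, one_mul, zero_mul,
      Finset.sum_ite_eq, Finset.mem_univ, if_true] at h1
    rw [dirDeriv_sum_vec, dirDeriv_zero_vec]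
    simp only [dirDeriv_smul_vec, add_mul, Finset.sum_add_distrib] at h6 ⊢
    rw [h6]
    simp only [mul_comm (dirDeriv I (A _) 1 _)]
    linear_combination h1
  have h0 := congrArg (hX.coord k 1) key
  rw [hX.coord_sum, map_zero] at h0
  linear_combination h0

variable [T2Space G] [SigmaCompactSpace G] [MeasurableSpace G] [BorelSpace G]

/-- The adjoint representation of a unimodular group is traceless. -/
theorem sum_structConst_eq_zero (hG : IsUnimodular G) (hX : IsLieFrame X c)
    (hinv : ∀ i, X i = mulInvariantVectorField (X i 1)) (i : ι) : ∑ j, c i j j = 0 := by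
  have := I.locallyCompactSpace
  have := ChartedSpace.locallyCompactSpace H G
  obtain ⟨μ, hμ, hμ'⟩ := hG
  set A : ι → G → ℝ := fun k g ↦ hX.coord k g (mulRightInvariantVectorField (X i 1) g) with hAdef
  have hA (k) : ContMDiff I 𝓘(ℝ, ℝ) ∞ (A k) := fun g ↦
    hX.contMDiffAt_coord_apply (smooth_mulRightInvariantVectorField _ g) k
  set φ : G → ℝ := fun g ↦ ∑ j, dirDeriv I (A j) g (X j g)
  have hd {f : G → ℝ} (hf : ContMDiff I 𝓘(ℝ, ℝ) ∞ f) (j) :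
      Continuous fun g ↦ dirDeriv I f g (X j g) := continuous_iff_continuousAt.2 fun x ↦
    (contMDiffAt_dirDeriv (hX.smooth j x).contMDiffAt (hf x)).continuousAt
  have hφ : Continuous φ := continuous_finsetSum _ fun j _ ↦ hd (hA j) j
  have hint : ∀ f : G → ℝ, ContMDiff I 𝓘(ℝ, ℝ) ∞ f → HasCompactSupport f →
      ∫ g, f g • φ g ∂μ = 0 := by
    intro f hf hfc
    have h1 (j) : ∫ g, dirDeriv I (fun y ↦ A j y * f y) g (X j g) ∂μ = 0 := by
      rw [hinv j]
      exact integral_mulInvariantVectorField _ ((hA j).mul hf) hfc.mul_left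
    have h2 := integral_mulRightInvariantVectorField (μ := μ) (X i 1) hf hfc
    have hsupp (j) : HasCompactSupport fun g ↦ dirDeriv I f g (X j g) :=
      hfc.mono' fun g hg ↦ by
        by_contra hg'
        have h3 : f =ᶠ[𝓝 g] fun _ ↦ 0 := notMem_tsupport_iff_eventuallyEq.1 hg'
        exact hg ((dirDeriv_congr h3 _).trans (dirDeriv_const 0 g _))
    have e1 : ∀ g, dirDeriv I f g (mulRightInvariantVectorField (X i 1) g) =
        ∑ j, A j g * dirDeriv I f g (X j g) := fun g ↦ by
      conv_lhs => rw [← hX.sum_coord g (mulRightInvariantVectorField (X i 1) g)]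
      rw [dirDeriv_sum_vec]
      exact Finset.sum_congr rfl fun k _ ↦ dirDeriv_smul_vec _ _ _ _
    have i1 (j) : Integrable (fun g ↦ A j g * dirDeriv I f g (X j g)) μ :=
      ((hA j).continuous.mul (hd hf j)).integrable_of_hasCompactSupport (hsupp j).mul_left
    have i2 (j) : Integrable (fun g ↦ f g * dirDeriv I (A j) g (X j g)) μ :=
      (hf.continuous.mul (hd (hA j) j)).integrable_of_hasCompactSupport hfc.mul_right
    simp only [e1] at h2
    rw [integral_finsetSum _ fun j _ ↦ i1 j] at h2
    have h3 (j) : ∫ g, A j g * dirDeriv I f g (X j g) ∂μ +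
        ∫ g, f g * dirDeriv I (A j) g (X j g) ∂μ = 0 := by
      rw [← integral_add (i1 j) (i2 j), ← h1 j]
      refine integral_congr_ae (Eventually.of_forall fun g ↦ ?_)
      exact (dirDeriv_mul ((hA j).mdifferentiableAt (by simp))
        (hf.mdifferentiableAt (by simp)) _).symm
    simp only [φ, smul_eq_mul, Finset.mul_sum]
    rw [integral_finsetSum _ fun j _ ↦ i2 j]
    have h4 := Finset.sum_congr rfl fun j (_ : j ∈ Finset.univ) ↦ h3 j
    rw [Finset.sum_add_distrib, h2] at h4
    simpa using h4
  have hae := ae_eq_zero_of_integral_contMDiff_smul_eq_zero I hφ.locallyIntegrable hint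
  have hzero : φ = fun _ ↦ 0 := (hφ.ae_eq_iff_eq μ continuous_const).1 hae
  have h1 := congrFun hzero 1
  simp only [φ, hAdef, hX.dirDeriv_coord_mulRightInvariant hinv] at h1
  have hanti (j) : - c j i j = c i j j := by
    have h2 := congrArg (hX.coord j 1) (hX.bracket j i 1)
    have h3 := congrArg (hX.coord j 1) (hX.bracket i j 1)
    rw [hX.coord_sum] at h2 h3
    rw [← h2, ← h3, mlieBracket_swap_apply, map_neg, neg_neg]
  simpa only [hanti] using h1

end IsLieFrame

end Trace

section ContactForm

variable {E : Type*} [NormedAddCommGroup E] [NormedSpace ℝ E] [FiniteDimensional ℝ E]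
  {H : Type*} [TopologicalSpace H] {I : ModelWithCorners ℝ E H} [I.Boundaryless]
  {M : Type*} [TopologicalSpace M] [ChartedSpace H M] [IsManifold I ∞ M]

lemma OneForm.extDeriv_sub_left (α : OneForm I M) (x : M) (u v w : TangentSpace I x) :
    α.extDeriv I x (u - v) w = α.extDeriv I x u w - α.extDeriv I x v w := by
  have h : mfderiv I 𝓘(ℝ, E) (extChartAt I x) x (u - v) = (mfderiv I 𝓘(ℝ, E) (extChartAt I x) x u -
      mfderiv I 𝓘(ℝ, E) (extChartAt I x) x v : E) := map_sub _ _ _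
  have key (D : E →L[ℝ] E →L[ℝ] ℝ) (p q r : E) :
      D (p - q) r - D r (p - q) = D p r - D r p - (D q r - D r q) := by
    simp only [map_sub, sub_apply]; ring
  simp only [OneForm.extDeriv, h]
  exact key _ _ _ _

lemma OneForm.extDeriv_smul_add_smul_left (α : OneForm I M) (x : M) (a b : ℝ)
    (u v w : TangentSpace I x) :
    α.extDeriv I x (a • u + b • v) w = a * α.extDeriv I x u w + b * α.extDeriv I x v w := by
  have h : mfderiv I 𝓘(ℝ, E) (extChartAt I x) x (a • u + b • v) =
      (a • mfderiv I 𝓘(ℝ, E) (extChartAt I x) x u +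
        b • mfderiv I 𝓘(ℝ, E) (extChartAt I x) x v : E) :=
    (map_add _ _ _).trans (congrArg₂ (· + ·) (map_smul _ _ _) (map_smul _ _ _))
  have key (D : E →L[ℝ] E →L[ℝ] ℝ) (p q r : E) : D (a • p + b • q) r - D r (a • p + b • q) =
      a * (D p r - D r p) + b * (D q r - D r q) := by
    simp only [map_add, map_smul, add_apply, smul_apply, smul_eq_mul]; ring
  simp only [OneForm.extDeriv, h]
  exact key _ _ _ _

lemma OneForm.extDeriv_self (α : OneForm I M) (x : M) (u : TangentSpace I x) :
    α.extDeriv I x u u = 0 := sub_self _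

lemma OneForm.extDeriv_swap (α : OneForm I M) (x : M) (u v : TangentSpace I x) :
    α.extDeriv I x u v = - α.extDeriv I x v u := (neg_sub _ _).symm

lemma OneForm.Smooth.contMDiffAt_apply {α : OneForm I M} (hα : α.Smooth) {X : VF I M} {x : M}
    (hX : VF.SmoothNear I X x) : ContMDiffAt I 𝓘(ℝ, ℝ) ∞ (fun y ↦ α y (X y)) x :=
  (SubRiem.contMDiffAt_linFun (p := (⟨x, α x⟩ : Cotangent I M)) hX.contMDiffAt).comp x (hα x)

variable {ι : Type*} [Fintype ι] [DecidableEq ι] {X : ι → VF I M} {c : ι → ι → ι → ℝ}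

lemma IsLieFrame.structConst_swap (hX : IsLieFrame X c) [Nonempty M] (i j k : ι) :
    c i j k = - c j i k := by
  obtain ⟨x⟩ := ‹Nonempty M›
  have h2 := congrArg (hX.coord k x) (hX.bracket j i x)
  have h3 := congrArg (hX.coord k x) (hX.bracket i j x)
  rw [hX.coord_sum] at h2 h3
  rw [← h2, ← h3, mlieBracket_swap_apply, map_neg]

/-- The exterior derivative of a one-form in terms of a frame. -/
lemma IsLieFrame.extDeriv_eq (hX : IsLieFrame X c) {α : OneForm I M} (hα : α.Smooth) (x : M)
    (i j : ι) : α.extDeriv I x (X i x) (X j x) =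
      dirDeriv I (fun y ↦ α y (X j y)) x (X i x) - dirDeriv I (fun y ↦ α y (X i y)) x (X j x)
        - ∑ k, c i j k * α x (X k x) := by
  have hm (i) : MDifferentiableAt I 𝓘(ℝ, ℝ) (fun y ↦ α y (X i y)) x :=
    (hα.contMDiffAt_apply (hX.smooth i x)).mdifferentiableAt (by simp)
  have hc := OneForm.differentiableAt_inChart (α := α) hX.card_eq
    (fun i ↦ (hX.smooth i x).mdifferentiableAt) (hX.linearIndependent x) hm
  rw [OneForm.extDeriv_apply hc (hX.smooth i x).mdifferentiableAt
    (hX.smooth j x).mdifferentiableAt (hm i) (hm j), hX.bracket, map_sum]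
  congr 1
  exact Finset.sum_congr rfl fun k _ ↦ map_smul (α x) _ _

end ContactForm

section LeftInvariant

variable {E : Type*} [NormedAddCommGroup E] [NormedSpace ℝ E] [FiniteDimensional ℝ E]
  {H : Type*} [TopologicalSpace H] {I : ModelWithCorners ℝ E H} [I.Boundaryless]
  {G : Type*} [TopologicalSpace G] [ChartedSpace H G] [Group G] [LieGroup I ∞ G]

/-- Left-invariant fields form frames with constant structure functions. -/
lemma exists_isLieFrame {ι : Type*} [Fintype ι] [DecidableEq ι] {v : ι → TangentSpace I (1 : G)}
    (hv : LinearIndependent ℝ v) (hcard : Fintype.card ι = Module.finrank ℝ E) :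
    ∃ c, IsLieFrame (I := I) (M := G) (fun i ↦ mulInvariantVectorField (v i)) c := by
  have hspan : Submodule.span ℝ (range v) = ⊤ := hv.span_eq_top_of_card_eq_finrank' hcard
  have hex (i j : ι) : ∃ c : ι → ℝ, ∑ k, c k • v k =
      mlieBracket I (mulInvariantVectorField (v i)) (mulInvariantVectorField (v j)) 1 :=
    (Submodule.mem_span_range_iff_exists_fun ℝ).1 (hspan ▸ Submodule.mem_top)
  choose c hc using hex
  refine ⟨c, ⟨fun i x ↦ smoothNear_mulInvariantVectorField _ _, hcard, fun x ↦ ?_,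
    fun i j x ↦ ?_⟩⟩
  · have h := hv.map' (mfderiv I I (fun z ↦ x * z) (1 : G)).toLinearMap
      (LinearMap.ker_eq_bot.2 (mulInvariantVectorField_injective x))
    exact h
  · rw [← mulInvariantVector_mlieBracket, ← hc i j]
    refine (map_sum (mfderiv I I (fun z ↦ x * z) (1 : G)) _ _).trans ?_
    exact Finset.sum_congr rfl fun k _ ↦ map_smul (mfderiv I I (fun z ↦ x * z) (1 : G)) _ _

lemma isLeftInvariant_mulInvariantVectorField (v : TangentSpace I (1 : G)) :
    VF.IsLeftInvariant I (mulInvariantVectorField v : VF I G) := fun x y ↦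
  dLeft_mulInvariantVectorField v x y

variable {S : SubRiemStr I G}

lemma SubRiemStr.IsLeftInvariant.isOrthonormal_dLeft (hS : S.IsLeftInvariant) (x y : G)
    {u v : TangentSpace I y} (h : S.IsOrthonormal y u v) :
    S.IsOrthonormal (x * y) (dLeft I x y u) (dLeft I x y v) := by
  obtain ⟨hspan, hu, hv, h11, h22, h12⟩ := h
  have hmem {u : TangentSpace I y} (hu : u ∈ S.distr y) : dLeft I x y u ∈ S.distr (x * y) :=
    hS.1 x y ▸ Submodule.mem_map_of_mem hu
  refine ⟨?_, hmem hu, hmem hv, ?_, ?_, ?_⟩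
  · rw [← hS.1 x y, ← hspan, Submodule.map_span, image_pair]
    rfl
  · exact (hS.2 x y ⟨u, hu⟩ ⟨u, hu⟩ _ _).trans h11
  · exact (hS.2 x y ⟨v, hv⟩ ⟨v, hv⟩ _ _).trans h22
  · exact (hS.2 x y ⟨u, hu⟩ ⟨v, hv⟩ _ _).trans h12

lemma SubRiemStr.IsLeftInvariant.isOrthonormal_mulInvariantVectorField (hS : S.IsLeftInvariant)
    {u v : TangentSpace I (1 : G)} (h : S.IsOrthonormal 1 u v) (y : G) :
    S.IsOrthonormal y (mulInvariantVectorField u y) (mulInvariantVectorField v y) := by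
  have h1 := hS.isOrthonormal_dLeft y 1 (u := mulInvariantVectorField u 1)
    (v := mulInvariantVectorField v 1)
    (by rwa [mulInvariantVectorField_one, mulInvariantVectorField_one])
  rw [dLeft_mulInvariantVectorField, dLeft_mulInvariantVectorField] at h1
  have key : ∀ z, z = y → S.IsOrthonormal z (mulInvariantVectorField u z)
      (mulInvariantVectorField v z) → S.IsOrthonormal y (mulInvariantVectorField u y)
      (mulInvariantVectorField v y) := by
    rintro _ rfl h; exact h
  exact key _ (mul_one y) h1

lemma IsOrthonormalPair.eq_zero {V : Type*} [AddCommGroup V] [Module ℝ V] {D : Submodule ℝ V}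
    {g : LinearMap.BilinForm ℝ D} {u v : V} (hs : ∀ x y, g x y = g y x)
    (h : IsOrthonormalPair D g u v) {a b : ℝ} (hab : a • u + b • v = 0) : a = 0 ∧ b = 0 := by
  obtain ⟨-, hu, hv, h11, h22, h12⟩ := h
  have h0 : (a • ⟨u, hu⟩ + b • ⟨v, hv⟩ : D) = 0 := Subtype.ext hab
  have h21 : g ⟨v, hv⟩ ⟨u, hu⟩ = 0 := by rw [hs, h12]
  have h1 := congrArg (fun z ↦ g z ⟨u, hu⟩) h0
  have h2 := congrArg (fun z ↦ g z ⟨v, hv⟩) h0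
  simp only [map_add, map_smul, LinearMap.add_apply, LinearMap.smul_apply, h11, h12, h21, h22,
    smul_eq_mul, map_zero, LinearMap.zero_apply] at h1 h2
  exact ⟨by linarith, by linarith⟩

lemma IsOrthonormalPair.left_mem {V : Type*} [AddCommGroup V] [Module ℝ V] {D : Submodule ℝ V}
    {g : LinearMap.BilinForm ℝ D} {u v : V} (h : IsOrthonormalPair D g u v) : u ∈ D := h.2.1

lemma IsOrthonormalPair.right_mem {V : Type*} [AddCommGroup V] [Module ℝ V] {D : Submodule ℝ V}
    {g : LinearMap.BilinForm ℝ D} {u v : V} (h : IsOrthonormalPair D g u v) : v ∈ D := h.2.2.1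

variable [ConnectedSpace G] {α : OneForm I G} {X₀ : VF I G}

/-- A left-invariant orthonormal frame of a left-invariant contact structure, completed by the Reeb
vector field. -/
lemma exists_isLieFrame_of_isOrthonormal (hdim : Module.finrank ℝ E = 3)
    (hS : S.IsLeftInvariant) (hα : S.IsNormalizedContactForm α) (hX₀ : IsReeb I α X₀)
    {u v : TangentSpace I (1 : G)} (huv : S.IsOrthonormal 1 u v) :
    ∃ c, IsLieFrame (I := I) (M := G)
        (fun i ↦ mulInvariantVectorField (![X₀ 1, u, v] i)) c ∧
      X₀ = mulInvariantVectorField (X₀ 1) ∧ |c 1 2 0| = 1 ∧ c 0 1 0 = 0 ∧ c 0 2 0 = 0 := by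
  obtain ⟨hαs, hker, hnorm⟩ := hα
  have hw : LinearIndependent ℝ ![X₀ 1, u, v] := by
    refine Fintype.linearIndependent_iff.2 fun g hg ↦ ?_
    rw [Fin.sum_univ_three] at hg
    simp only [Matrix.cons_val] at hg
    have h0 := congrArg (α 1) hg
    rw [map_add, map_add, map_smul, map_smul, map_smul, (hX₀ 1).1, (hker 1 u).1 huv.left_mem,
      (hker 1 v).1 huv.right_mem, map_zero] at h0
    simp only [smul_eq_mul, mul_one, mul_zero, add_zero] at h0
    rw [h0, zero_smul, zero_add] at hg
    obtain ⟨h1, h2⟩ := huv.eq_zero (S.metric_symm 1) hg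
    intro i
    fin_cases i
    exacts [h0, h1, h2]
  obtain ⟨c, hX⟩ := exists_isLieFrame hw (by simp [hdim])
  refine ⟨c, hX, ?_⟩
  set X : Fin 3 → VF I G := fun i ↦ mulInvariantVectorField (![X₀ 1, u, v] i) with hXdef
  have hon : ∀ y, S.IsOrthonormal y (X 1 y) (X 2 y) :=
    hS.isOrthonormal_mulInvariantVectorField huv
  have h1 (y) : α y (X 1 y) = 0 := (hker y _).1 (hon y).left_mem
  have h2 (y) : α y (X 2 y) = 0 := (hker y _).1 (hon y).right_mem
  have hX01 : X 0 1 = X₀ 1 := mulInvariantVectorField_one _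
  have h01 : α 1 (X 0 1) = 1 := by rw [hX01]; exact (hX₀ 1).1
  have hd12 (y) : α.extDeriv I y (X 1 y) (X 2 y) = - (c 1 2 0 * α y (X 0 y)) := by
    rw [hX.extDeriv_eq hαs, Fin.sum_univ_three]
    simp only [h1, h2, dirDeriv_const]
    ring
  have habs (y) : |c 1 2 0| * |α y (X 0 y)| = 1 := by
    have := hnorm y _ _ (hon y)
    rwa [hd12, abs_neg, abs_mul] at this
  have hc : |c 1 2 0| = 1 := by simpa [h01] using habs 1
  have h0 (y) : α y (X 0 y) = 1 := by
    have hcont : Continuous fun y ↦ α y (X 0 y) := continuous_iff_continuousAt.2 fun y ↦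
      (hαs.contMDiffAt_apply (hX.smooth 0 y)).continuousAt
    have hsq : EqOn ((fun y ↦ α y (X 0 y)) ^ 2) 1 univ := fun y _ ↦ by
      have := habs y
      rw [hc, one_mul] at this
      simp [← sq_abs (α y (X 0 y)), this]
    rcases isPreconnected_univ.eq_one_or_eq_neg_one_of_sq_eq hcont.continuousOn hsq with h | h
    · exact h (mem_univ y)
    · have := h (mem_univ 1)
      simp only [h01] at this
      norm_num at this
  have hd01 (y) : α.extDeriv I y (X 0 y) (X 1 y) = - c 0 1 0 := by
    rw [hX.extDeriv_eq hαs, Fin.sum_univ_three]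
    simp only [h0, h1, h2, dirDeriv_const]
    ring
  have hd02 (y) : α.extDeriv I y (X 0 y) (X 2 y) = - c 0 2 0 := by
    rw [hX.extDeriv_eq hαs, Fin.sum_univ_three]
    simp only [h0, h1, h2, dirDeriv_const]
    ring
  have hc1 : c 0 1 0 = 0 := by
    have := hd01 1
    rw [hX01, (hX₀ 1).2] at this
    linarith
  have hc2 : c 0 2 0 = 0 := by
    have := hd02 1
    rw [hX01, (hX₀ 1).2] at this
    linarith
  refine ⟨funext fun y ↦ ?_, hc, hc1, hc2⟩
  have hmem : X₀ y - X 0 y ∈ S.distr y := by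
    rw [hker, map_sub, (hX₀ y).1, h0, sub_self]
  rw [← (hon y).1] at hmem
  obtain ⟨s, t, hst⟩ := Submodule.mem_span_pair.1 hmem
  have e1 : α.extDeriv I y (X₀ y - X 0 y) (X 1 y) = 0 := by
    rw [OneForm.extDeriv_sub_left, (hX₀ y).2, hd01, hc1]; simp
  have e2 : α.extDeriv I y (X₀ y - X 0 y) (X 2 y) = 0 := by
    rw [OneForm.extDeriv_sub_left, (hX₀ y).2, hd02, hc2]; simp
  have hne : c 1 2 0 ≠ 0 := fun h ↦ by simp [h] at hc
  rw [← hst, OneForm.extDeriv_smul_add_smul_left, OneForm.extDeriv_self,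
    OneForm.extDeriv_swap _ _ (X 2 y), hd12, h0] at e1
  rw [← hst, OneForm.extDeriv_smul_add_smul_left, OneForm.extDeriv_self, hd12, h0] at e2
  have hs : s = 0 := by simpa [hne] using e2
  have ht : t = 0 := by simpa [hne] using e1
  rw [hs, ht, zero_smul, zero_smul, zero_add] at hst
  exact sub_eq_zero.1 hst.symm

/-- The structure constants of a contact structure with traceless adjoint representation. -/
lemma eq_structConst {c : Fin 3 → Fin 3 → Fin 3 → ℝ} (hsw : ∀ i j k, c i j k = - c j i k)
    (htr : ∀ i, ∑ j, c i j j = 0) (h120 : c 1 2 0 = -1) (h010 : c 0 1 0 = 0) (h020 : c 0 2 0 = 0) :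
    c = structConst (c 1 0 1) (c 2 0 1) (c 1 0 2) := by
  simp only [Fin.sum_univ_three] at htr
  have t0 := htr 0
  have t1 := htr 1
  have t2 := htr 2
  have z (i k) : c i i k = 0 := by linarith [hsw i i k]
  have e100 : c 1 0 0 = 0 := by linarith [hsw 1 0 0]
  have e200 : c 2 0 0 = 0 := by linarith [hsw 2 0 0]
  have e011 := hsw 0 1 1
  have e012 := hsw 0 1 2
  have e021 := hsw 0 2 1
  have e022 : c 0 2 2 = c 1 0 1 := by linarith [z 0 0]
  have e202 : c 2 0 2 = - c 1 0 1 := by rw [hsw 2 0 2, e022]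
  have e210 : c 2 1 0 = 1 := by rw [hsw 2 1 0, h120, neg_neg]
  have e122 : c 1 2 2 = 0 := by linarith [z 1 1]
  have e211 : c 2 1 1 = 0 := by linarith [z 2 2]
  have e121 : c 1 2 1 = 0 := by rw [hsw, e211, neg_zero]
  have e212 : c 2 1 2 = 0 := by rw [hsw, e122, neg_zero]
  ext i j k
  fin_cases i <;> fin_cases j <;> fin_cases k <;>
    simp [structConst, z, e100, e200, e011, e012, e021, e022, e202, e210, e122, e211, e121, e212,
      h120, h010, h020]

variable [T2Space G] [SigmaCompactSpace G] [MeasurableSpace G] [BorelSpace G]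

/-- The structure constants of a left-invariant contact structure on a unimodular group. -/
theorem exists_isLieFrame_structConst (hG : IsUnimodular G) (hdim : Module.finrank ℝ E = 3)
    (hS : S.IsLeftInvariant) (hα : S.IsNormalizedContactForm α) (hX₀ : IsReeb I α X₀) :
    ∃ (X : Fin 3 → VF I G) (p a b : ℝ), IsLieFrame X (structConst p a b) ∧ X 0 = X₀ ∧
      (∀ i, VF.IsLeftInvariant I (X i)) ∧ ∀ y, S.IsOrthonormal y (X 1 y) (X 2 y) := by
  have hne : ∃ u v : TangentSpace I (1 : G), S.IsOrthonormal 1 u v ∧ ∃ c,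
      IsLieFrame (I := I) (M := G) (fun i ↦ mulInvariantVectorField (![X₀ 1, u, v] i)) c ∧
      X₀ = mulInvariantVectorField (X₀ 1) ∧ c 1 2 0 = -1 ∧ c 0 1 0 = 0 ∧ c 0 2 0 = 0 := by
    obtain ⟨U, V, -, -, hUV⟩ := S.exists_frame 1
    have huv := hUV.self_of_nhds
    have hvu : S.IsOrthonormal 1 (V 1) (U 1) := by
      obtain ⟨h, hu, hv, h11, h22, h12⟩ := huv
      exact ⟨pair_comm (U 1) (V 1) ▸ h, hv, hu, h22, h11, by rw [S.metric_symm, h12]⟩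
    obtain ⟨c, hX, hr, hc⟩ := exists_isLieFrame_of_isOrthonormal hdim hS hα hX₀ huv
    obtain ⟨c', hX', hr', hc'⟩ := exists_isLieFrame_of_isOrthonormal hdim hS hα hX₀ hvu
    rcases eq_or_eq_neg_of_abs_eq hc.1 with h | h
    · refine ⟨V 1, U 1, hvu, c', hX', hr', ?_, hc'.2⟩
      have e1 := hX.bracket 1 2 1
      have e2 := hX'.bracket 1 2 1
      simp only [Fin.sum_univ_three, Matrix.cons_val, mulInvariantVectorField_one] at e1 e2
      rw [mlieBracket_swap_apply] at e2
      have e3 := congrArg (α 1) (neg_eq_iff_eq_neg.1 e2 ▸ e1)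
      simp only [map_neg, map_add, map_smul, (hX₀ 1).1, (hα.2.1 1 _).1 huv.left_mem,
        (hα.2.1 1 _).1 huv.right_mem, smul_eq_mul] at e3
      linarith
    · exact ⟨U 1, V 1, huv, c, hX, hr, h, hc.2⟩
  obtain ⟨u, v, huv, c, hX, hr, hc12, hc1, hc2⟩ := hne
  have htr := hX.sum_structConst_eq_zero hG fun i ↦ by rw [mulInvariantVectorField_one]
  have hsw := hX.structConst_swap
  obtain ⟨p, a, b, hc⟩ : ∃ p a b, c = structConst p a b :=
    ⟨_, _, _, eq_structConst hsw htr hc12 hc1 hc2⟩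
  rw [hc] at hX
  refine ⟨_, p, a, b, hX, hr.symm,
    fun i ↦ isLeftInvariant_mulInvariantVectorField _,
    hS.isOrthonormal_mulInvariantVectorField huv⟩

end LeftInvariant

section Invariants

variable {E : Type*} [NormedAddCommGroup E] [NormedSpace ℝ E] [FiniteDimensional ℝ E]
  {H : Type*} [TopologicalSpace H] {I : ModelWithCorners ℝ E H} [I.Boundaryless]
  {M : Type*} [TopologicalSpace M] [ChartedSpace H M] [IsManifold I ∞ M]

namespace IsLieFrame

section General
variable {ι : Type*} [Fintype ι] [DecidableEq ι] {X : ι → VF I M} {c : ι → ι → ι → ℝ}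

lemma dirDeriv_dirDeriv_eq_sum (hX : IsLieFrame X c) {V W : VF I M} {x : M}
    (hW : VF.SmoothNear I W x) {f : M → ℝ} (hf : ContMDiffAt I 𝓘(ℝ, ℝ) ∞ f x) :
    dirDeriv I (fun y ↦ dirDeriv I f y (W y)) x (V x) =
      ∑ k, (dirDeriv I f x (X k x) * dirDeriv I (fun y ↦ hX.coord k y (W y)) x (V x)
        + ∑ j, hX.coord k x (W x) * hX.coord j x (V x) *
          dirDeriv I (fun y ↦ dirDeriv I f y (X k y)) x (X j x)) := by
  have h0 : (fun y ↦ dirDeriv I f y (W y)) =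
      fun y ↦ ∑ k, hX.coord k y (W y) * dirDeriv I f y (X k y) := by
    ext y
    conv_lhs => rw [← hX.sum_coord y (W y)]
    rw [dirDeriv_sum_vec]
    exact Finset.sum_congr rfl fun i _ ↦ dirDeriv_smul_vec _ _ _ _
  have h2 (k : ι) : MDifferentiableAt I 𝓘(ℝ, ℝ) (fun y ↦ dirDeriv I f y (X k y)) x :=
    (contMDiffAt_dirDeriv (hX.smooth k x).contMDiffAt hf).mdifferentiableAt (by simp)
  have h3 (k : ι) : MDifferentiableAt I 𝓘(ℝ, ℝ) (fun y ↦ hX.coord k y (W y)) x :=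
    (hX.contMDiffAt_coord_apply hW.contMDiffAt k).mdifferentiableAt (by simp)
  have h4 (k : ι) : MDifferentiableAt I 𝓘(ℝ, ℝ)
      (fun y ↦ hX.coord k y (W y) * dirDeriv I f y (X k y)) x := (h3 k).mul (h2 k)
  rw [h0, dirDeriv_sum Finset.univ fun k _ ↦ h4 k]
  refine Finset.sum_congr rfl fun k _ ↦ ?_
  rw [dirDeriv_mul (h3 k) (h2 k), add_comm]
  congr 1
  conv_lhs => rw [← hX.sum_coord x (V x)]
  rw [dirDeriv_sum_vec, Finset.mul_sum]
  exact Finset.sum_congr rfl fun j _ ↦ by rw [dirDeriv_smul_vec]; ring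

/-- The components of a Lie bracket. -/
theorem coord_mlieBracket (hX : IsLieFrame X c) {V W : VF I M} {x : M}
    (hV : VF.SmoothNear I V x) (hW : VF.SmoothNear I W x) (i : ι) :
    hX.coord i x (mlieBracket I V W x) =
      dirDeriv I (fun y ↦ hX.coord i y (W y)) x (V x)
        - dirDeriv I (fun y ↦ hX.coord i y (V y)) x (W x)
        + ∑ j, ∑ k, c j k i * hX.coord j x (V x) * hX.coord k x (W x) := by
  have key : mlieBracket I V W x =
      ∑ i, (dirDeriv I (fun y ↦ hX.coord i y (W y)) x (V x)
        - dirDeriv I (fun y ↦ hX.coord i y (V y)) x (W x)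
        + ∑ j, ∑ k, c j k i * hX.coord j x (V x) * hX.coord k x (W x)) • X i x := by
    refine eq_of_dirDeriv_eq fun f hf ↦ ?_
    have hf0 := hf.self_of_nhds
    rw [hV.dirDeriv_mlieBracket hW hf0, hX.dirDeriv_dirDeriv_eq_sum hW hf0,
      hX.dirDeriv_dirDeriv_eq_sum hV hf0, dirDeriv_sum_vec]
    simp only [dirDeriv_smul_vec]
    have hbr (j k : ι) : ∑ i, c j k i * dirDeriv I f x (X i x) =
        dirDeriv I (fun y ↦ dirDeriv I f y (X k y)) x (X j x)
          - dirDeriv I (fun y ↦ dirDeriv I f y (X j y)) x (X k x) := by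
      rw [← (hX.smooth j x).dirDeriv_mlieBracket (hX.smooth k x) hf0, hX.bracket,
        dirDeriv_sum_vec]
      simp only [dirDeriv_smul_vec]
    have h4 : ∑ i, (∑ j, ∑ k, c j k i * hX.coord j x (V x) * hX.coord k x (W x)) *
        dirDeriv I f x (X i x) =
        ∑ j, ∑ k, hX.coord j x (V x) * hX.coord k x (W x) *
          (dirDeriv I (fun y ↦ dirDeriv I f y (X k y)) x (X j x)
            - dirDeriv I (fun y ↦ dirDeriv I f y (X j y)) x (X k x)) := by
      simp only [← hbr, Finset.sum_mul, Finset.mul_sum]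
      rw [Finset.sum_comm]
      refine Finset.sum_congr rfl fun j _ ↦ ?_
      rw [Finset.sum_comm]
      exact Finset.sum_congr rfl fun k _ ↦ Finset.sum_congr rfl fun i _ ↦ by ring
    simp only [add_mul, sub_mul, Finset.sum_add_distrib, Finset.sum_sub_distrib, h4, mul_sub]
    rw [Finset.sum_comm (f := fun k j ↦ hX.coord k x (W x) * hX.coord j x (V x) *
          dirDeriv I (fun y ↦ dirDeriv I f y (X k y)) x (X j x))]
    simp only [mul_comm (dirDeriv I f x _)]
    have h5 : ∀ j k : ι, hX.coord k x (W x) * hX.coord j x (V x) =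
      hX.coord j x (V x) * hX.coord k x (W x) := fun _ _ ↦ mul_comm _ _
    simp only [h5]
    ring
  conv_lhs => rw [key, hX.coord_sum]

/-- Linear combinations of the fields of a frame, with constant coefficients. -/
lemma linearCombination (hX : IsLieFrame X c) {P : ι → ι → ℝ} {c' : ι → ι → ι → ℝ}
    (hP : ∀ g : ι → ℝ, (∀ j, ∑ i, g i * P i j = 0) → ∀ i, g i = 0)
    (hc : ∀ i j l, ∑ k, c' i j k * P k l = ∑ a, ∑ b, c a b l * P i a * P j b) :
    IsLieFrame (I := I) (M := M) (fun i y ↦ ∑ j, P i j • X j y) c' := by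
  have hs (i x) : VF.SmoothNear I (fun y ↦ ∑ j, P i j • X j y) x :=
    VF.SmoothNear.sum _ fun j _ ↦
      VF.SmoothNear.smul (Eventually.of_forall fun _ ↦ contMDiffAt_const) (hX.smooth j x)
  have hsum (g : ι → ℝ) (x) : ∑ i, g i • ∑ j, P i j • X j x = ∑ j, (∑ i, g i * P i j) • X j x := by
    simp only [Finset.smul_sum, Finset.sum_smul, smul_smul]
    exact Finset.sum_comm
  refine ⟨hs, hX.card_eq, fun x ↦ Fintype.linearIndependent_iff.2 fun g hg ↦ hP g fun j ↦ ?_,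
    fun i j x ↦ ?_⟩
  · rw [hsum] at hg
    exact Fintype.linearIndependent_iff.1 (hX.linearIndependent x) _ hg j
  · rw [hsum, ← hX.sum_coord x (mlieBracket I _ _ x)]
    refine Finset.sum_congr rfl fun l _ ↦ ?_
    rw [hX.coord_mlieBracket (hs i x) (hs j x), hc]
    simp only [hX.coord_sum, dirDeriv_const, sub_zero, zero_add]

end General

variable {X : Fin 3 → VF I M} {p a b : ℝ} (hX : IsLieFrame X (structConst p a b))
  {S : SubRiemStr I M} (hS : ∀ y, S.IsOrthonormal y (X 1 y) (X 2 y)) {x : M}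

include hX hS

/-- The first invariant in terms of structure constants. -/
lemma sq_eq_of_hasChi {χ : ℝ} (h : S.HasChi (X 0) x χ) :
    χ ^ 2 = p ^ 2 + ((a + b) / 2) ^ 2 := by
  obtain ⟨Y₁, Y₂, ⟨-, -, hon⟩, A, hA, hAp, rfl⟩ := h
  obtain ⟨c, s, ε, hcs, hε, e1, e2⟩ :=
    (hS x).exists_rotation (S.metric_symm x) hon.self_of_nhds
  have key (ξ η : ℝ) : p * ξ ^ 2 + (a + b) * (ξ * η) - p * η ^ 2 =
      A 0 0 * (c * ξ + s * η) ^ 2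
        + 2 * A 0 1 * ((c * ξ + s * η) * (-(ε * s) * ξ + ε * c * η))
        + A 1 1 * (-(ε * s) * ξ + ε * c * η) ^ 2 := by
    let ℓ : E →ₗ[ℝ] ℝ := (ξ • hX.coord 1 x + η • hX.coord 2 x : TangentSpace I x →ₗ[ℝ] ℝ)
    let μ₀ : E →L[ℝ] ℝ := LinearMap.toContinuousLinearMap ℓ
    let μ : TangentSpace I x →L[ℝ] ℝ := μ₀
    have hμ (v) : μ v = ξ * hX.coord 1 x v + η * hX.coord 2 x v := rfl
    have h1 : linFun I (X 1) (⟨x, μ⟩ : Cotangent I M) = ξ := by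
      rw [linFun, hμ, hX.coord_frame, hX.coord_frame]; simp
    have h2 : linFun I (X 2) (⟨x, μ⟩ : Cotangent I M) = η := by
      rw [linFun, hμ, hX.coord_frame, hX.coord_frame]; simp
    have h3 : linFun I Y₁ (⟨x, μ⟩ : Cotangent I M) = c * ξ + s * η := by
      rw [linFun, e1, map_add, map_smul, map_smul]
      exact congrArg₂ (fun u v ↦ c * u + s * v) h1 h2
    have h4 : linFun I Y₂ (⟨x, μ⟩ : Cotangent I M) = -(ε * s) * ξ + ε * c * η := by
      rw [linFun, e2, map_add, map_smul, map_smul]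
      exact congrArg₂ (fun u v ↦ -(ε * s) * u + ε * c * v) h1 h2
    have h5 := hAp ⟨x, μ⟩ rfl
    rwa [poisson_hamiltonian_linFun_zero S hS hX, h1, h2, h3, h4] at h5
  have k1 := key c s
  have k2 := key (-(ε * s)) (ε * c)
  have k3 := key (c - ε * s) (s + ε * c)
  have r1 : c * c + s * s = 1 := by linarith
  have r2 : -(ε * s) * c + ε * c * s = 0 := by ring
  have r3 : c * -(ε * s) + s * (ε * c) = 0 := by ring
  have r4 : -(ε * s) * -(ε * s) + ε * c * (ε * c) = 1 := by
    linear_combination hcs * ε ^ 2 + hε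
  have r5 : c * (c - ε * s) + s * (s + ε * c) = 1 := by linarith
  have r6 : -(ε * s) * (c - ε * s) + ε * c * (s + ε * c) = 1 := by linarith
  rw [r1, r2] at k1
  rw [r3, r4] at k2
  rw [r5, r6] at k3
  have hA00 : A 0 0 = p * (c ^ 2 - s ^ 2) + (a + b) * (c * s) := by linear_combination -k1
  have hA11 : A 1 1 = - A 0 0 := by
    linear_combination -k2 - k1 + (p * s ^ 2 - p * c ^ 2 - (a + b) * (c * s)) * hε
  have hA01 : A 0 1 = ε * ((a + b) / 2 * (c ^ 2 - s ^ 2) - 2 * p * (c * s)) := by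
    linear_combination (-1 / 2) * (k3 - k1 - k2)
  have hA10 : A 1 0 = A 0 1 := hA.apply 0 1
  have hdet : - A.det = p ^ 2 + ((a + b) / 2) ^ 2 := by
    rw [Matrix.det_fin_two, hA10, hA11, hA00, hA01]
    linear_combination ((a + b) / 2 * (c ^ 2 - s ^ 2) - 2 * p * (c * s)) ^ 2 * hε +
      (p ^ 2 + ((a + b) / 2) ^ 2) * (c ^ 2 + s ^ 2 + 1) * hcs
  rw [hdet, Real.sq_sqrt (by positivity)]

/-- The second invariant in terms of structure constants. -/
lemma eq_of_hasKappa {κ : ℝ} (h : S.HasKappa (X 0) x κ) : κ = (b - a) / 2 := by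
  obtain ⟨Y₁, Y₂, ⟨hY₁, hY₂, hon⟩, a01, b01, a02, b02, a12, b12, hbr, rfl⟩ := h
  obtain ⟨c, hc⟩ : ∃ c : M → ℝ, ∀ y, hX.coord 1 y (Y₁ y) = c y := ⟨_, fun _ ↦ rfl⟩
  obtain ⟨s, hs⟩ : ∃ s : M → ℝ, ∀ y, hX.coord 2 y (Y₁ y) = s y := ⟨_, fun _ ↦ rfl⟩
  have hY₁n := VF.smoothNear_iff.1 hY₁
  have hY₂n := VF.smoothNear_iff.1 hY₂
  have hcomp : ∀ᶠ y in 𝓝 x, hX.coord 0 y (Y₁ y) = 0 ∧ hX.coord 0 y (Y₂ y) = 0 ∧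
      c y ^ 2 + s y ^ 2 = 1 ∧ ∃ ε : ℝ, ε ^ 2 = 1 ∧ hX.coord 1 y (Y₂ y) = -(ε * s y) ∧
        hX.coord 2 y (Y₂ y) = ε * c y := by
    filter_upwards [hon] with y hy
    obtain ⟨c', s', ε, hcs, hε, e1, e2⟩ := (hS y).exists_rotation (S.metric_symm y) hy
    have f (k) (u v : ℝ) : hX.coord k y (u • X 1 y + v • X 2 y) =
        u * (if 1 = k then 1 else 0) + v * (if 2 = k then 1 else 0) := by
      rw [map_add, map_smul, map_smul, hX.coord_frame, hX.coord_frame]; rfl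
    have hc' : c' = c y := by rw [← hc, e1, f]; simp
    have hs' : s' = s y := by rw [← hs, e1, f]; simp
    subst hc' hs'
    refine ⟨?_, ?_, hcs, ε, hε, ?_, ?_⟩
    · rw [e1, f]; simp
    · rw [e2, f]; simp
    · rw [e2, f]; simp
    · rw [e2, f]; simp
  have hgood : ∀ᶠ y in 𝓝 x, VF.SmoothNear I Y₁ y ∧ VF.SmoothNear I Y₂ y :=
    (hY₁n.eventually_nhds.and hY₂n.eventually_nhds).mono fun y hy ↦
      ⟨VF.smoothNear_iff.2 hy.1, VF.smoothNear_iff.2 hy.2⟩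
  -- the orientation of the local frame
  have hcomp' : ∀ᶠ y in 𝓝 x, hX.coord 0 y (Y₁ y) = 0 ∧ hX.coord 0 y (Y₂ y) = 0 ∧
      c y ^ 2 + s y ^ 2 = 1 ∧ hX.coord 1 y (Y₂ y) = -s y ∧ hX.coord 2 y (Y₂ y) = c y := by
    filter_upwards [hcomp, hcomp.eventually_nhds, hbr, hgood] with y hy hy' hbry hg
    obtain ⟨h1, h2, hcs, ε, hε, h3, h4⟩ := hy
    have e := hX.coord_mlieBracket hg.2 hg.1 0
    rw [dirDeriv_congr (g := fun _ ↦ 0) (hy'.mono fun z hz ↦ hz.1),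
      dirDeriv_congr (g := fun _ ↦ 0) (hy'.mono fun z hz ↦ hz.2.1), hbry.2.2, map_add, map_add,
      map_smul, map_smul, h1, h2, hX.coord_frame, dirDeriv_const, dirDeriv_const] at e
    simp only [Fin.sum_univ_three, h1, h2, h3, h4, hc, hs] at e
    simp [structConst] at e
    have hε1 : ε = 1 := by linear_combination -e - ε * hcs
    rw [hε1] at h3 h4
    exact ⟨h1, h2, hcs, by simpa using h3, by simpa using h4⟩
  have hcd : ∀ᶠ y in 𝓝 x, ContMDiffAt I 𝓘(ℝ, ℝ) ∞ c y := by
    rw [← funext hc]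
    filter_upwards [hY₁n] with y hy using hX.contMDiffAt_coord_apply hy 1
  have hsd : ∀ᶠ y in 𝓝 x, ContMDiffAt I 𝓘(ℝ, ℝ) ∞ s y := by
    rw [← funext hs]
    filter_upwards [hY₁n] with y hy using hX.contMDiffAt_coord_apply hy 2
  have hneg {f : M → ℝ} {y : M} (v : TangentSpace I y) :
      dirDeriv I (fun z ↦ - f z) y v = - dirDeriv I f y v := dirDeriv_neg v
  -- the coefficients of the brackets
  have hab : ∀ᶠ y in 𝓝 x,
      a12 y = c y * dirDeriv I s y (Y₁ y) - s y * dirDeriv I c y (Y₁ y) ∧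
      b12 y = c y * dirDeriv I s y (Y₂ y) - s y * dirDeriv I c y (Y₂ y) ∧
      (∀ v : TangentSpace I y, c y * dirDeriv I c y v + s y * dirDeriv I s y v = 0) ∧
      b01 y - a02 y = b - a
        - 2 * (c y * dirDeriv I s y (X 0 y) - s y * dirDeriv I c y (X 0 y)) := by
    filter_upwards [hcomp', hcomp'.eventually_nhds, hbr, hgood, hcd, hsd]
      with y hy hy' hbry hg hcy hsy
    obtain ⟨h1, h2, hcs, h3, h4⟩ := hy
    have hz (v : TangentSpace I y) : c y * dirDeriv I c y v + s y * dirDeriv I s y v = 0 := by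
      have hcm := hcy.mdifferentiableAt (by simp)
      have hsm := hsy.mdifferentiableAt (by simp)
      have hcc : MDifferentiableAt I 𝓘(ℝ, ℝ) (fun z ↦ c z * c z) y := hcm.mul hcm
      have hss : MDifferentiableAt I 𝓘(ℝ, ℝ) (fun z ↦ s z * s z) y := hsm.mul hsm
      have e1 : (fun z ↦ c z * c z + s z * s z) =ᶠ[𝓝 y] fun _ ↦ 1 := by
        filter_upwards [hy'] with z hz
        linear_combination hz.2.2.1
      have e2 := dirDeriv_congr e1 v
      rw [dirDeriv_add hcc hss, dirDeriv_mul hcm hcm, dirDeriv_mul hsm hsm, dirDeriv_const] at e2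
      linarith
    have hY2c : (fun z ↦ hX.coord 1 z (Y₂ z)) =ᶠ[𝓝 y] fun z ↦ - s z :=
      hy'.mono fun z hz ↦ hz.2.2.2.1
    have hY2s : (fun z ↦ hX.coord 2 z (Y₂ z)) =ᶠ[𝓝 y] c := hy'.mono fun z hz ↦ hz.2.2.2.2
    have h10 : (fun z ↦ hX.coord 1 z (X 0 z)) = fun _ ↦ 0 := by ext z; rw [hX.coord_frame]; simp
    have h20 : (fun z ↦ hX.coord 2 z (X 0 z)) = fun _ ↦ 0 := by ext z; rw [hX.coord_frame]; simp
    have k1 := hX.coord_mlieBracket hg.2 hg.1 1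
    have k2 := hX.coord_mlieBracket hg.2 hg.1 2
    have l1 := hX.coord_mlieBracket hg.1 (hX.smooth 0 y) 1
    have l2 := hX.coord_mlieBracket hg.1 (hX.smooth 0 y) 2
    have m1 := hX.coord_mlieBracket hg.2 (hX.smooth 0 y) 1
    have m2 := hX.coord_mlieBracket hg.2 (hX.smooth 0 y) 2
    rw [hbry.2.2, dirDeriv_congr hY2c, funext hc, hneg] at k1
    rw [hbry.2.2, dirDeriv_congr hY2s, funext hs] at k2
    rw [hbry.1, h10, dirDeriv_const, funext hc] at l1
    rw [hbry.1, h20, dirDeriv_const, funext hs] at l2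
    rw [hbry.2.1, h10, dirDeriv_const, dirDeriv_congr hY2c, hneg] at m1
    rw [hbry.2.1, h20, dirDeriv_const, dirDeriv_congr hY2s] at m2
    simp only [Fin.sum_univ_three, map_add, map_smul, smul_eq_mul, hX.coord_frame, h1, h2, h3, h4,
      hc, hs] at k1 k2 l1 l2 m1 m2
    simp [structConst] at k1 k2 l1 l2 m1 m2
    have z1 := hz (Y₁ y)
    have z2 := hz (Y₂ y)
    refine ⟨?_, ?_, hz, ?_⟩
    · linear_combination c y * k1 + s y * k2 + z2 - a12 y * hcs
    · linear_combination (-s y) * k1 + c y * k2 - z1 - b12 y * hcs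
    · linear_combination (-s y) * l1 + c y * l2 - c y * m1 - s y * m2
        + (b - a - b01 y + a02 y) * hcs
  obtain ⟨ha, hb, hz, h0⟩ := hab.self_of_nhds
  obtain ⟨-, -, hcs, -, -⟩ := hcomp'.self_of_nhds
  have hc0 := hcd.self_of_nhds
  have hs0 := hsd.self_of_nhds
  have hcm := hc0.mdifferentiableAt (by simp)
  have hsm := hs0.mdifferentiableAt (by simp)
  have hm {f : M → ℝ} (hf : ContMDiffAt I 𝓘(ℝ, ℝ) ∞ f x) {V : VF I M}
      (hV : VF.SmoothNear I V x) :
      MDifferentiableAt I 𝓘(ℝ, ℝ) (fun y ↦ dirDeriv I f y (V y)) x :=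
    (contMDiffAt_dirDeriv hV.contMDiffAt hf).mdifferentiableAt (by simp)
  have hder {V : VF I M} (hV : VF.SmoothNear I V x) {g : M → ℝ}
      (hg : g =ᶠ[𝓝 x] fun y ↦ c y * dirDeriv I s y (V y) - s y * dirDeriv I c y (V y))
      (v : TangentSpace I x) : dirDeriv I g x v =
        c x * dirDeriv I (fun y ↦ dirDeriv I s y (V y)) x v
          + dirDeriv I s x (V x) * dirDeriv I c x v
          - (s x * dirDeriv I (fun y ↦ dirDeriv I c y (V y)) x v
            + dirDeriv I c x (V x) * dirDeriv I s x v) := by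
    have i1 : MDifferentiableAt I 𝓘(ℝ, ℝ) (fun y ↦ c y * dirDeriv I s y (V y)) x :=
      hcm.mul (hm hs0 hV)
    have i2 : MDifferentiableAt I 𝓘(ℝ, ℝ) (fun y ↦ s y * dirDeriv I c y (V y)) x :=
      hsm.mul (hm hc0 hV)
    rw [dirDeriv_congr hg, dirDeriv_sub i1 i2, dirDeriv_mul hcm (hm hs0 hV),
      dirDeriv_mul hsm (hm hc0 hV)]
  rw [hder hY₁ (hab.mono fun y hy ↦ hy.1), hder hY₂ (hab.mono fun y hy ↦ hy.2.1)]
  have bc := hY₂.dirDeriv_mlieBracket hY₁ hc0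
  have bs := hY₂.dirDeriv_mlieBracket hY₁ hs0
  rw [hbr.self_of_nhds.2.2, dirDeriv_add_vec, dirDeriv_add_vec, dirDeriv_smul_vec,
    dirDeriv_smul_vec] at bc bs
  have z1 := hz (Y₁ x)
  have z2 := hz (Y₂ x)
  have hw : dirDeriv I c x (Y₂ x) * dirDeriv I s x (Y₁ x)
      - dirDeriv I s x (Y₂ x) * dirDeriv I c x (Y₁ x) = 0 := by
    linear_combination (-(dirDeriv I c x (Y₂ x) * dirDeriv I s x (Y₁ x)
      - dirDeriv I s x (Y₂ x) * dirDeriv I c x (Y₁ x))) * hcs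
      + (c x * dirDeriv I s x (Y₁ x) - s x * dirDeriv I c x (Y₁ x)) * z2
      + (s x * dirDeriv I c x (Y₂ x) - c x * dirDeriv I s x (Y₂ x)) * z1
  linear_combination 2 * hw - c x * bs + s x * bc - a12 x * ha - b12 x * hb + h0 / 2

end IsLieFrame

end Invariants

lemma exists_rotation_of_sq_eq {p m χ : ℝ} (h : χ ^ 2 = p ^ 2 + m ^ 2) :
    ∃ c s : ℝ, c ^ 2 + s ^ 2 = 1 ∧ c * m - s * p = χ * c ∧ c * p + s * m = -(χ * s) := by
  by_cases hm : m + χ = 0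
  · have hp : p = 0 := by
      have : p ^ 2 = 0 := by linear_combination (χ - m) * hm - h
      simpa using this
    exact ⟨0, 1, by simp, by simp [hp], by linear_combination hm⟩
  · have hr : 0 < (m + χ) ^ 2 + p ^ 2 := by positivity
    have hr2 := Real.sq_sqrt hr.le
    have hr0 := (Real.sqrt_pos.2 hr).ne'
    set r := √((m + χ) ^ 2 + p ^ 2)
    refine ⟨(m + χ) / r, -p / r, ?_, ?_, ?_⟩ <;> field_simp
    · linear_combination -hr2
    · linear_combination -h
    · ring

section

variable {E : Type*} [NormedAddCommGroup E] [NormedSpace ℝ E] [FiniteDimensional ℝ E]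
  {H : Type*} [TopologicalSpace H] {I : ModelWithCorners ℝ E H} [I.Boundaryless]
  {M : Type*} [TopologicalSpace M] [ChartedSpace H M] [IsManifold I ∞ M]

lemma IsLieFrame.rotate {X : Fin 3 → VF I M} {p m κ χ c s : ℝ}
    (hX : IsLieFrame X (structConst p (m - κ) (m + κ))) (hcs : c ^ 2 + s ^ 2 = 1)
    (h1 : c * m - s * p = χ * c) (h2 : c * p + s * m = -(χ * s)) :
    IsLieFrame (I := I) (M := M)
      (fun i y ↦ ∑ j, (![![1, 0, 0], ![0, c, s], ![0, -s, c]] : Fin 3 → Fin 3 → ℝ) i j • X j y)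
      (structConst 0 (χ - κ) (χ + κ)) := by
  refine hX.linearCombination (fun g hg ↦ ?_) ?_
  · have g0 := hg 0
    have g1 := hg 1
    have g2 := hg 2
    simp [Fin.sum_univ_three] at g0 g1 g2
    have h1 : g 1 = 0 := by linear_combination c * g1 + s * g2 - g 1 * hcs
    have h2 : g 2 = 0 := by linear_combination c * g2 - s * g1 - g 2 * hcs
    intro i
    fin_cases i <;> assumption
  · intro i j l
    fin_cases i <;> fin_cases j <;> fin_cases l <;>
      simp [structConst, Fin.sum_univ_three] <;> grind

end

section

variable {E : Type*} [NormedAddCommGroup E] [NormedSpace ℝ E]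
  {H : Type*} [TopologicalSpace H] {I : ModelWithCorners ℝ E H}
  {G : Type*} [TopologicalSpace G] [ChartedSpace H G] [Group G]

lemma VF.IsLeftInvariant.sum_smul {ι : Type*} [Fintype ι] {X : ι → VF I G}
    (hX : ∀ i, VF.IsLeftInvariant I (X i)) (g : ι → ℝ) :
    VF.IsLeftInvariant I (fun y ↦ ∑ i, g i • X i y) := fun x y ↦ by
  rw [map_sum]
  exact Finset.sum_congr rfl fun i _ ↦ by rw [map_smul, hX i x y]

/-- Left-invariant frames adapted to the first invariant. -/
theorem exists_isLieFrame_of_hasChi [FiniteDimensional ℝ E] [I.Boundaryless] [LieGroup I ∞ G]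
    [ConnectedSpace G] [T2Space G] [SigmaCompactSpace G] [MeasurableSpace G] [BorelSpace G]
    (hG : IsUnimodular G) (hdim : Module.finrank ℝ E = 3)
    {S : SubRiemStr I G} (hS : S.IsLeftInvariant)
    {α : OneForm I G} (hα : S.IsNormalizedContactForm α) {X₀ : VF I G} (hX₀ : IsReeb I α X₀)
    {x : G} {χ κ : ℝ} (hχ : S.HasChi X₀ x χ) (hκ : S.HasKappa X₀ x κ) :
    ∃ X : Fin 3 → VF I G, IsLieFrame X (structConst 0 (χ - κ) (χ + κ)) ∧ X 0 = X₀ ∧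
      (∀ i, VF.IsLeftInvariant I (X i)) ∧ ∀ y, S.IsOrthonormal y (X 1 y) (X 2 y) := by
  obtain ⟨X, p, a, b, hX, rfl, hl, hon⟩ := exists_isLieFrame_structConst hG hdim hS hα hX₀
  obtain ⟨m, hm⟩ : ∃ m, m = (a + b) / 2 := ⟨_, rfl⟩
  have e1 := hX.sq_eq_of_hasChi hon hχ
  have e2 := hX.eq_of_hasKappa hon hκ
  obtain rfl : a = m - κ := by linarith
  obtain rfl : b = m + κ := by linarith
  rw [← hm] at e1
  obtain ⟨c, s, hcs, h1, h2⟩ := exists_rotation_of_sq_eq e1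
  refine ⟨_, hX.rotate hcs h1 h2, ?_, fun i ↦ VF.IsLeftInvariant.sum_smul hl _, fun y ↦ ?_⟩
  · ext y
    simp [Fin.sum_univ_three]
  · simpa [Fin.sum_univ_three, SubRiemStr.IsOrthonormal] using
      (hon y).rotate (S.metric_symm y) hcs (one_pow 2)

end

end SubRiem

end

theorem proposition7p4
    {G : Type*} [TopologicalSpace G] [ChartedSpace (EuclideanSpace ℝ (Fin 3)) G] [Group G]
    [LieGroup (𝓡 3) ∞ G] [T2Space G] [SecondCountableTopology G] [ConnectedSpace G]
    [MeasurableSpace G] [BorelSpace G] (hG : IsUnimodular G)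
    (S : SubRiemStr (𝓡 3) G) (hS : S.IsLeftInvariant)
    (α : OneForm (𝓡 3) G) (hα : S.IsNormalizedContactForm α)
    (X₀ : VF (𝓡 3) G) (hX₀ : IsReeb (𝓡 3) α X₀)
    (x : G) (χ κ : ℝ) (hχ : S.HasChi X₀ x χ) (hκ : S.HasKappa X₀ x κ) (hχ_pos : 0 < χ) :
    ∃ X₁ X₂ : VF (𝓡 3) G,
      VF.IsLeftInvariant (𝓡 3) X₁ ∧ VF.IsLeftInvariant (𝓡 3) X₂ ∧
      (∀ y, S.IsOrthonormal y (X₁ y) (X₂ y)) ∧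
      (∀ p, poisson (𝓡 3) S.hamiltonian (linFun (𝓡 3) X₀) p =
        2 * χ * linFun (𝓡 3) X₁ p * linFun (𝓡 3) X₂ p) ∧
      (∀ y, mlieBracket (𝓡 3) X₁ X₀ y = (χ + κ) • X₂ y) ∧
      (∀ y, mlieBracket (𝓡 3) X₂ X₀ y = (χ - κ) • X₁ y) ∧
      (∀ y, mlieBracket (𝓡 3) X₂ X₁ y = X₀ y) ∧
      (∀ p, poisson (𝓡 3) S.hamiltonian
        (fun q ↦ linFun (𝓡 3) X₀ q ^ 2 / (2 * χ) + linFun (𝓡 3) X₂ q ^ 2) p = 0) ∧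
      ∀ (J : Set ℝ) (lam : ℝ → Cotangent (𝓡 3) G), IsOpen J → J.OrdConnected →
        S.IsNontrivialExtremal lam J →
        (∃ E F R, S.IsCanonicalFrame lam J E F R) ∧
        ∀ E F R, S.IsCanonicalFrame lam J E F R → ∀ t ∈ J,
          let h₀ := linFun (𝓡 3) X₀ (lam t)
          let h₁ := linFun (𝓡 3) X₁ (lam t)
          let h₂ := linFun (𝓡 3) X₂ (lam t)
          SubRiemStr.ric₁ R t = h₀ ^ 2 + 3 * χ * (h₁ ^ 2 - h₂ ^ 2) + κ * (h₁ ^ 2 + h₂ ^ 2) ∧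
          SubRiemStr.ric₂ R t = 6 * χ * (h₁ ^ 2 - h₂ ^ 2) * h₀ ^ 2 - 2 * χ * (χ + κ) * h₁ ^ 4
            - 12 * χ ^ 2 * h₁ ^ 2 * h₂ ^ 2 - 2 * χ * (χ - κ) * h₂ ^ 4 := by
  have : LocallyCompactSpace G := ChartedSpace.locallyCompactSpace (EuclideanSpace ℝ (Fin 3)) G
  obtain ⟨X, hX, rfl, hl, hon⟩ := exists_isLieFrame_of_hasChi hG finrank_euclideanSpace_fin
    hS hα hX₀ hχ hκ
  refine ⟨X 1, X 2, hl 1, hl 2, hon, fun p ↦ ?_, fun y ↦ ?_, fun y ↦ ?_, fun y ↦ ?_,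
    IsLieFrame.poisson_hamiltonian_constant_of_motion S hon hχ_pos.ne' hX (by ring), ?_⟩
  · rw [IsLieFrame.poisson_hamiltonian_linFun_zero S hon hX]
    ring
  · rw [hX.bracket, Fin.sum_univ_three]
    simp [structConst]
  · rw [hX.bracket, Fin.sum_univ_three]
    simp [structConst]
  · rw [hX.bracket, Fin.sum_univ_three]
    simp [structConst]
  · intro J lam hJ _ hlam
    refine ⟨hX.exists_isCanonicalFrame hon hJ hlam, fun E F R h t ht ↦ ?_⟩
    obtain ⟨h1, h2⟩ := hX.ricci_of_isCanonicalFrame hon hJ hlam h ht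
    simp only [SubRiemStr.ric₁, SubRiemStr.ric₂, Finset.sum_singleton]
    refine ⟨h1.trans ?_, h2⟩
    rw [IsLieFrame.ricOne]
    ring
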